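/- **Setting.** Let $\mathcal O,\mathcal A$ be finite sets and $H\ge 1$. A *system* (model) $f$ specifies the conditional law $\mathbb P_f(\cdot\mid\tau_{h})\in\Delta_{\mathcal O}$ of $o_{h+1}$ given each history $\tau_{h}=(o_1,a_1,\dots,o_{h},a_{h})$, $0\le h\le H-1$; after step $H$ only a fixed dummy observation $o_{\rm dummy}\in\mathcal O$ is generated. A policy $\pi$ specifies laws $\pi(\cdot\mid\tau_{h-1},o_h)\in\Delta_{\mathcal A}$, and $\mathbb P_f^\pi(\tau_n)=\prod_{h\le n}\mathbb P_f(o_h\mid\tau_{h-1})\,\pi(a_h\mid\tau_{h-1},o_h)$. The rewards are known functions $r_h(\tau_h)$ with $|r_h|\le 1$; $V_f^\pi=\sum_{\tau_H}\mathbb P_f^\pi(\tau_H)\sum_{h=1}^H r_h(\tau_h)$. The true system is $f^*$, $V^\pi=V^\pi_{f^*}$ and $V^*=\sup_\pi V^\pi$. A *test* is $t=(o_{1:W},a_{1:W-1})\in\mathcal O^W\times\mathcal A^{W-1}$, $W\ge1$. For a reachable history $\tau_h$ (one with $\mathbb P_f^\pi(\tau_h)>0$ for some $\pi$), $\mathbb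 P_f(t\mid\tau_h)$ is the product of the conditional probabilities of the observations of $t$ when its actions are executed after $\tau_h$; for unreachable $\tau_h$ it is $0$. $D_{h;f}$ is the matrix $(\mathbb P_f(t\mid\tau_h))_{t,\tau_h}$ over all tests $t$ and all histories $\tau_h$ of length $h$; $d_{\rm PSR}=\max_{0\le h\le H-1}\operatorname{rank}D_{h;f^*}$. A finite set $\mathcal U_{h+1}$ of tests is a *core test set* of $f$ if the submatrix $\overline D_{h;f}$ of the rows in $\mathcal U_{h+1}$ has the same rank as $D_{h;f}$. A *core matrix* at step $h$ consists of $\operatorname{rank}D_{h;f}$ columns of $\overline D_{h;f}$ whose span contains all columns of $\overline D_{h;f}$; $K_{h;f}$ is a core matrix with the smallest $\|K_{h;f}^\dagger\|_{1\mapsto1}$, where $\dagger$ is the Moore–Penrose inverse and $\|X\|_{1\mapsto 1}=\sup_{\|x\|_1=1}\|Xx\|_1$. Let finite sets of tests $\mathcal U_1,\dots,\mathcal U_H$ be given, let $\mathcal U_{A,h}$ be the set of action sequences of the tests in $\mathcal U_h$, and $|\mathcal U_A|=\max_{1\le h\le H}|\mathcal U_{A,h}|$. For a class $\mathcal F$ of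 systems, the bracket number $\mathcal N_{\mathcal F}(\epsilon)$ is the least $N$ for which there are real functions $g_1^i,g_2^i$ ($i\le N$) of a policy and a trajectory of length $H$ such that $\|g_1^i(\pi,\cdot)-g_2^i(\pi,\cdot)\|_1\le\epsilon$ for all $i,\pi$, and each $f\in\mathcal F$ has an $i$ with $g_1^i(\pi,\tau_H)\le\mathbb P_f^\pi(\tau_H)\le g_2^i(\pi,\tau_H)$ for all $\pi,\tau_H$. **Algorithm CRANE** (input $\mathcal F$, $\{\mathcal U_h\}$, $K$, $\beta$). Start with no data. For $k=1,\dots,K$: let $\mathcal B^k$ be the set of $f\in\mathcal F$ with $\sum_{(\pi,\tau_H)}\log\mathbb P_f^\pi(\tau_H)\ge\sup_{f'\in\mathcal F}\sum_{(\pi,\tau_H)}\log\mathbb P_{f'}^\pi(\tau_H)-\beta$, the sums being over all data collected so far (so $\mathcal B^1=\mathcal F$); choose $(f^k,\pi^k)\in\arg\max_{f\in\mathcal B^k,\pi}V_f^\pi$ (assumed to be attained; ties broken arbitrarily, possibly at random); for each $0\le h\le H-1$ and $w\in\mathcal U_{A,h+1}$ run one episode in the true system with the policy that follows $\pi^k$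 at steps $1,\dots,h-1$, is uniform at step $h$ (if $h\ge1$), executes $w$ from step $h+1$ on and is uniform afterwards, and add the pair of this policy and the observed trajectory to the data. **Theorem.** There are absolute constants $c,C>0$ such that the following holds. Let $\alpha>0$ and assume: (i) $\|K_{h;f^*}^\dagger\|_{1\mapsto1}\le1/\alpha$ for all $0\le h\le H-1$; (ii) every one-step observation $o\in\mathcal O$, as a test of length one, belongs to $\mathcal U_H$; (iii) $f^*\in\mathcal F$; $\|K_{h;f}^\dagger\|_{1\mapsto1}\le1/\alpha$ for all $f\in\mathcal F$, $0\le h\le H-1$; and for every $f\in\mathcal F$ and $h\in\{1,\dots,H\}$, $\mathcal U_h$ is a core test set of $f$. Let $\delta\in(0,1]$, $K\ge1$, $\epsilon_{\rm b}=1/(KH|\mathcal U_A|)$, and run CRANE with $\beta=c\log\big(\mathcal N_{\mathcal F}(\epsilon_{\rm b})KH|\mathcal U_A|/\delta\big)$. Then with probability at least $1-\delta$, $$\sum_{k=1}^K\big(V^*-V^{\pi^k}\big)\le C\,d_{\rm PSR}^2\,H^{7/2}\,|\mathcal U_A|^4\,|\mathcal A|^2\,K^{1/2}\,\alpha^{-3}\,\log\!\big(KH\,\mathcal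 N_{\mathcal F}(\epsilon_{\rm b})\,|\mathcal O||\mathcal A|/\delta\big).$$ -/

import Mathlib

open scoped Matrix

namespace PSR

noncomputable section

universe u v

variable {O : Type u} {A : Type v}

/-! ### Controlled systems, policies, trajectory probabilities -/

/-- A history `(o₁, a₁), …, (o_h, a_h)`. -/
abbrev History (O : Type u) (A : Type v) := List (O × A)

/-- The dynamics of a system: the conditional law of the next observation given the history.
The value at `[]` is the law of the first observation. -/
abbrev Dynamics (O : Type u) (A : Type v) [Fintype O] := History O A → stdSimplex ℝ O

/-- A history-dependent randomized policy: the law of `a_h` given `(τ_{h-1}, o_h)`. -/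
abbrev Policy (O : Type u) (A : Type v) [Fintype A] := History O A → O → stdSimplex ℝ A

/-- Trajectories of length `n`. -/
abbrev Traj (O : Type u) (A : Type v) (n : ℕ) := Fin n → O × A

/-- The first `i` observation-action pairs of a trajectory. -/
def past {n : ℕ} (τ : Traj O A n) (i : ℕ) : History O A := (List.ofFn τ).take i

theorem past_snoc {n : ℕ} (τ : Traj O A n) (x : O × A) {i : ℕ} (hi : i ≤ n) :
    past (Fin.snoc τ x : Traj O A (n + 1)) i = past τ i := by
  unfold past
  rw [List.ofFn_succ']
  simp only [Fin.snoc_castSucc, Fin.snoc_last, List.concat_eq_append]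
  rw [List.take_append_of_le_length (by simpa using hi)]

section Prob

variable [Fintype O] [Fintype A]

/-- `ℙ_κ^π(τ_n) = ∏_{i ≤ n} ℙ_κ(o_i | τ_{i-1}) π(a_i | τ_{i-1}, o_i)`. -/
def trajProb (κ : Dynamics O A) (π : Policy O A) {n : ℕ} (τ : Traj O A n) : ℝ :=
  ∏ i : Fin n, κ (past τ i) (τ i).1 * π (past τ i) (τ i).1 (τ i).2

theorem trajProb_nonneg (κ : Dynamics O A) (π : Policy O A) {n : ℕ} (τ : Traj O A n) :
    0 ≤ trajProb κ π τ :=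
  Finset.prod_nonneg fun _ _ => mul_nonneg ((κ _).2.1 _) ((π _ _).2.1 _)

theorem trajProb_snoc (κ : Dynamics O A) (π : Policy O A) {n : ℕ} (τ : Traj O A n) (x : O × A) :
    trajProb κ π (Fin.snoc τ x : Traj O A (n + 1)) =
      trajProb κ π τ * (κ (past τ n) x.1 * π (past τ n) x.1 x.2) := by
  unfold trajProb
  rw [Fin.prod_univ_castSucc]
  simp only [Fin.snoc_castSucc, Fin.snoc_last, Fin.val_castSucc, Fin.val_last]
  rw [past_snoc τ x le_rfl]
  congr 1
  refine Finset.prod_congr rfl fun i _ => ?_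
  rw [past_snoc τ x i.2.le]

theorem sum_trajProb (κ : Dynamics O A) (π : Policy O A) (n : ℕ) :
    ∑ τ : Traj O A n, trajProb κ π τ = 1 := by
  induction n with
  | zero => simp [trajProb]
  | succ n ih =>
    rw [← (Fin.snocEquiv fun _ : Fin (n + 1) => O × A).sum_comp, Fintype.sum_prod_type_right]
    have h : ∀ (τ : Traj O A n) (x : O × A),
        trajProb κ π ((Fin.snocEquiv fun _ : Fin (n + 1) => O × A) (x, τ)) =
          trajProb κ π τ * (κ (past τ n) x.1 * π (past τ n) x.1 x.2) :=
      fun τ x => trajProb_snoc κ π τ x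
    simp only [h, ← Finset.mul_sum, Fintype.sum_prod_type]
    rw [← ih]
    refine Finset.sum_congr rfl fun τ _ => ?_
    have h1 : ∀ o, ∑ a, π (past τ n) o a = 1 := fun o => (π (past τ n) o).2.2
    have h2 : ∑ o, κ (past τ n) o = 1 := (κ (past τ n)).2.2
    simp [h1, h2]

/-- The law of the trajectory of one episode in which `π` is executed in the system `κ`. -/
def episodeLaw (κ : Dynamics O A) (π : Policy O A) (n : ℕ) : PMF (Traj O A n) :=
  PMF.ofFintype (fun τ => ENNReal.ofReal (trajProb κ π τ)) (by
    rw [← ENNReal.ofReal_sum_of_nonneg fun τ _ => trajProb_nonneg κ π τ, sum_trajProb,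
      ENNReal.ofReal_one])

/-- The value `V_κ^π` for the horizon `H`. The reward at step `h` is `r τ_h`, a deterministic
function of the history up to and including `(o_h, a_h)`. -/
def value (r : History O A → ℝ) (H : ℕ) (κ : Dynamics O A) (π : Policy O A) : ℝ :=
  ∑ τ : Traj O A H, trajProb κ π τ * ∑ i : Fin H, r (past τ (i + 1))

/-- The optimal value. -/
def optValue (r : History O A → ℝ) (H : ℕ) (κ : Dynamics O A) : ℝ :=
  ⨆ π : Policy O A, value r H κ π

end Prob

/-! ### Tests, system dynamics matrices, core tests and core matrices -/

/-- A test `(o₁, …, o_W; a₁, …, a_{W-1})`, `W ≥ 1`, written as the list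
`(o₁, a₁), …, (o_{W-1}, a_{W-1})` followed by the last observation `o_W`. -/
abbrev Test (O : Type u) (A : Type v) := List (O × A) × O

/-- The action sequence of a test. -/
def Test.actions (t : Test O A) : List A := t.1.map Prod.snd

section Tests

variable [Fintype O] [Fintype A]

open Classical in
/-- The probability that `o` follows the history `τ`; after step `H` only the dummy observation
is generated. -/
def obsProb (H : ℕ) (dummy : O) (κ : Dynamics O A) (τ : History O A) (o : O) : ℝ :=
  if τ.length < H then κ τ o else if o = dummy then 1 else 0

/-- The product of the conditional probabilities of the observations of the test `(l, o)` after the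
history `τ`, when the actions of the test are executed. -/
def doProb (H : ℕ) (dummy : O) (κ : Dynamics O A) : History O A → List (O × A) → O → ℝ
  | τ, [], o => obsProb H dummy κ τ o
  | τ, (o', a) :: l, o => obsProb H dummy κ τ o' * doProb H dummy κ (τ ++ [(o', a)]) l o

/-- A history is reachable if some policy produces it with positive probability. -/
def Reachable (κ : Dynamics O A) {h : ℕ} (τ : Traj O A h) : Prop :=
  ∃ π : Policy O A, 0 < trajProb κ π τ

open Classical in
/-- The one-step system dynamics matrix `D_h`: rows are all tests, columns are all histories of
length `h`, and the entries are `ℙ(t | τ_h)`, which is `0` for unreachable `τ_h`. -/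
def dynMatrix (H : ℕ) (dummy : O) (κ : Dynamics O A) (h : ℕ) :
    Matrix (Test O A) (Traj O A h) ℝ :=
  Matrix.of fun t τ => if Reachable κ τ then doProb H dummy κ (List.ofFn τ) t.1 t.2 else 0

/-- The submatrix of `D_h` with rows in the set of tests `W`; its columns are the predictive
states `q_{τ_h}`. -/
def predMatrix (H : ℕ) (dummy : O) (κ : Dynamics O A) (h : ℕ) (W : Finset (Test O A)) :
    Matrix W (Traj O A h) ℝ :=
  (dynMatrix H dummy κ h).submatrix (fun t : W => t.1) id

/-- `W` is a core test set for the tests that follow histories of length `h`. -/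
def IsCoreTestSet (H : ℕ) (dummy : O) (κ : Dynamics O A) (h : ℕ) (W : Finset (Test O A)) : Prop :=
  (predMatrix H dummy κ h W).rank = (dynMatrix H dummy κ h).rank

/-- The PSR rank: the maximum of `rank D_h` over `0 ≤ h ≤ H - 1`. -/
def psrRank (H : ℕ) (dummy : O) (κ : Dynamics O A) : ℕ :=
  (Finset.range H).sup fun h => (dynMatrix H dummy κ h).rank

/-- `K` is a core matrix at step `h`: its columns are the predictive states of `rank D_h` many
histories, and each predictive state is a linear combination of its columns. -/
def IsCoreMatrix (H : ℕ) (dummy : O) (κ : Dynamics O A) (h : ℕ) (W : Finset (Test O A))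
    (K : Matrix W (Fin (dynMatrix H dummy κ h).rank) ℝ) : Prop :=
  (∃ σ : Fin (dynMatrix H dummy κ h).rank → Traj O A h,
      K = (predMatrix H dummy κ h W).submatrix id σ) ∧
    ∀ τ : Traj O A h, ∃ v, (fun t => predMatrix H dummy κ h W t τ) = K *ᵥ v

end Tests

/-- `X` is the Moore-Penrose pseudo-inverse of the real matrix `K`. -/
def IsPseudoInverse {m n : Type*} [Fintype m] [Fintype n] (K : Matrix m n ℝ) (X : Matrix n m ℝ) :
    Prop :=
  K * X * K = K ∧ X * K * X = X ∧ (K * X)ᵀ = K * X ∧ (X * K)ᵀ = X * K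

/-- `‖X‖_{1 ↦ 1} ≤ b`. -/
def OneNormLE {m n : Type*} [Fintype m] [Fintype n] (X : Matrix n m ℝ) (b : ℝ) : Prop :=
  ∀ x : m → ℝ, ∑ j, |x j| = 1 → ∑ i, |(X *ᵥ x) i| ≤ b

section Regular

variable [Fintype O] [Fintype A]

/-- `α`-regularity: for each `0 ≤ h ≤ H - 1` the core matrix `K_h` with the smallest
`‖K_h†‖_{1 ↦ 1}` satisfies `‖K_h†‖_{1 ↦ 1} ≤ 1 / α`; equivalently, some core matrix does.
`U (h + 1)` is the core test set that belongs to histories of length `h`. -/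
def IsRegular (H : ℕ) (dummy : O) (U : ℕ → Finset (Test O A)) (α : ℝ) (κ : Dynamics O A) : Prop :=
  ∀ h < H, ∃ K X, IsCoreMatrix H dummy κ h (U (h + 1)) K ∧ IsPseudoInverse K X ∧
    OneNormLE X (1 / α)

end Regular

open Classical in
/-- `𝒰_{A,h}`: the set of action sequences of the tests in `U h`. -/
def actionSeqs (U : ℕ → Finset (Test O A)) (h : ℕ) : Finset (List A) :=
  (U h).image Test.actions

/-- `|𝒰_A| = max_{1 ≤ h ≤ H} |𝒰_{A,h}|`. -/
def numActionSeqs (H : ℕ) (U : ℕ → Finset (Test O A)) : ℕ :=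
  (Finset.Icc 1 H).sup fun h => (actionSeqs U h).card

/-! ### Brackets -/

section Bracket

variable [Fintype O] [Fintype A]

/-- There is an `ε`-bracket of size `N` for the model class `F`. -/
def HasBracket (H : ℕ) (F : Set (Dynamics O A)) (ε : ℝ) (N : ℕ) : Prop :=
  ∃ g₁ g₂ : Fin N → Policy O A → Traj O A H → ℝ,
    (∀ i π, ∑ τ, |g₁ i π τ - g₂ i π τ| ≤ ε) ∧
    ∀ κ ∈ F, ∃ i, ∀ π τ, g₁ i π τ ≤ trajProb κ π τ ∧ trajProb κ π τ ≤ g₂ i π τ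

/-- The `ε`-bracket number `𝒩_F(ε)`. -/
def bracketNumber (H : ℕ) (F : Set (Dynamics O A)) (ε : ℝ) : ℕ :=
  sInf {N | HasBracket H F ε N}

end Bracket

/-! ### The algorithm -/

section Algorithm

variable [Fintype O] [Fintype A]

/-- A collection of pairs (executed policy, observed trajectory). -/
abbrev Dataset (O : Type u) (A : Type v) [Fintype A] (H : ℕ) := List (Policy O A × Traj O A H)

/-- The log-likelihood of a data set under the model `κ`, with `log 0 = -∞`. -/
def logLik {H : ℕ} (κ : Dynamics O A) (D : Dataset O A H) : EReal :=
  (D.map fun p => ENNReal.log (ENNReal.ofReal (trajProb κ p.1 p.2))).sum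

/-- The confidence set of all models whose log-likelihood is within `β` of the maximum. -/
def confSet {H : ℕ} (F : Set (Dynamics O A)) (β : ℝ) (D : Dataset O A H) : Set (Dynamics O A) :=
  {κ | κ ∈ F ∧ (⨆ κ' ∈ F, logLik κ' D) - (β : EReal) ≤ logLik κ D}

open Classical in
/-- The exploration policy `π_{1:h-1} ∘ Unif(A) ∘ w`: it follows `π` at the steps `1, …, h - 1`,
is uniform at step `h`, executes the action sequence `w` from step `h + 1` on, and is uniform
afterwards. For `h = 0` it executes `w` from the first step on. -/
def explorePolicy [Nonempty A] (π : Policy O A) (h : ℕ) (w : List A) : Policy O A := fun τ o =>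
  if τ.length + 1 < h then π τ o
  else if τ.length + 1 = h then stdSimplex.barycenter
  else match w[τ.length - h]? with
    | some a => stdSimplex.vertex a
    | none => stdSimplex.barycenter

/-- The pairs `(h, w)`, `0 ≤ h ≤ H - 1`, `w ∈ 𝒰_{A,h+1}`, over which one iteration loops. -/
def exploreList (H : ℕ) (U : ℕ → Finset (Test O A)) : List (ℕ × List A) :=
  (List.range H).flatMap fun h => (actionSeqs U (h + 1)).toList.map fun w => (h, w)

/-- Sample collection in one iteration: for each pair `(h, w)` of the list one episode is run with
the corresponding exploration policy in the true system `κ`. -/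
def collect [Nonempty A] (H : ℕ) (κ : Dynamics O A) (π : Policy O A) :
    List (ℕ × List A) → PMF (Dataset O A H)
  | [] => PMF.pure []
  | p :: l => (episodeLaw κ (explorePolicy π p.1 p.2) H).bind fun τ =>
      (collect H κ π l).map fun D => (explorePolicy π p.1 p.2, τ) :: D

/-- The record of a run: for each completed iteration `k` the pair `(f^k, π^k)` and the data that
this iteration has collected. -/
abbrev Log (O : Type u) (A : Type v) [Fintype O] [Fintype A] (H : ℕ) :=
  List ((Dynamics O A × Policy O A) × Dataset O A H)

/-- All data collected in the iterations on record. -/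
def Log.data {H : ℕ} (L : Log O A H) : Dataset O A H := L.flatMap Prod.snd

/-- The law of the record of the first `k` iterations in the true system `κ`, when the planning step
draws `(f^k, π^k)` from `plan L`, where `L` is the record of the earlier iterations. -/
def runLaw [Nonempty A] (H : ℕ) (U : ℕ → Finset (Test O A)) (κ : Dynamics O A)
    (plan : Log O A H → PMF (Dynamics O A × Policy O A)) : ℕ → PMF (Log O A H)
  | 0 => PMF.pure []
  | k + 1 => (runLaw H U κ plan k).bind fun L => (plan L).bind fun fp =>
      (collect H κ fp.2 (exploreList H U)).map fun D => L ++ [(fp, D)]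

/-- `(f, π)` attains `max_{f' ∈ B, π'} V_{f'}^{π'}`. -/
def IsOptimisticPair (r : History O A → ℝ) (H : ℕ) (B : Set (Dynamics O A))
    (fp : Dynamics O A × Policy O A) : Prop :=
  fp.1 ∈ B ∧ ∀ κ ∈ B, ∀ π : Policy O A, value r H κ π ≤ value r H fp.1 fp.2

/-- The planning rule `plan` is that of the algorithm with `K` iterations and slack `β`: in each run,
the planned pair is optimistic for the current confidence set, with ties broken in any way, possibly
at random. -/
def IsCrane [Nonempty A] (r : History O A → ℝ) (H : ℕ) (U : ℕ → Finset (Test O A))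
    (κ : Dynamics O A) (F : Set (Dynamics O A)) (β : ℝ) (K : ℕ)
    (plan : Log O A H → PMF (Dynamics O A × Policy O A)) : Prop :=
  ∀ k < K, ∀ L ∈ (runLaw H U κ plan k).support, ∀ fp ∈ (plan L).support,
    IsOptimisticPair r H (confSet F β L.data) fp

/-- The total suboptimality `∑_k (V^* - V^{π^k})` of a run. -/
def totalSubopt {H : ℕ} (r : History O A → ℝ) (κ : Dynamics O A) (L : Log O A H) : ℝ :=
  (L.map fun e => optValue r H κ - value r H κ e.1.2).sum

end Algorithm

end

end PSR

/-!
The proof combines a likelihood argument for the confidence sets with a bound, by an elliptical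
potential, on how often a model that is consistent with the data can still be wrong.

*Confidence sets.* For the upper end `g` of a bracket, the products over the data of `g / ℙ` and
of `√(g / ℙ) · exp (1 - ∑ √(g ℙ))`, where `ℙ` is the law under the true system, have bounded
expectation, because the policy of each episode is fixed before the episode is observed. Markov's
inequality and a union bound over brackets and iterations (`concentration`) make them all small
with probability `1 - δ`. On that event the true system is in all confidence sets (`mem_confSet`),
so that the planned pair is optimistic, and each model in a confidence set has trajectory laws
close in `ℓ¹` to the true ones on the executed policies, with squared distances that add up to a
logarithmic quantity (`sum_sq_lawDist_le`).

*Error decomposition.* Core tests and core matrices provide, for each model and each level `n`, a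
linear map `P` that recovers the probabilities of all tests from those of the core tests, with
norm at most `1 / α` (`IsPredictor`). Replacing the predictions of the model `f` by the true ones
level by level bounds the distance of the trajectory laws of `f` and of the true system by the
initial error and the update errors `P x - x` at the *true* predictive states `x` (`lawDist_le`).
The update errors are bounded by differences of predictive states of the two systems, where `π`
weights all actions but the last one (`futureSum_stepErr_le`), and these are what the exploration
policies measure (`stateErr_le`).

*Summation over the iterations.* The update error of iteration `k` along the policy of iteration
`i` is a sum of absolute inner products of vectors `u k` and `x i` in dimension `rank D`. The data
of the iterations `i < k` bound these sums for `i < k`; the case `i = k` is needed. For a single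
vector `x i` this is the elliptical potential argument; here the family of all histories has to be
treated at once. For this the Gram matrix is built from sign combinations `z i = ∑ ± x i τ` of
maximal norm: `|u ⬝ᵥ z i|` is still bounded by the sum of the `|u ⬝ᵥ x i τ|`, and conversely the
norm of `z i` controls the sum of the norms of the vectors `x i τ` up to the dimension
(`exists_sign_combination`, `sum_abs_dotProduct_le`).

For `K = 1` the logarithm in the bound can vanish. It does so only if there is a single action,
and then all policies agree; otherwise the trivial bound `2 H` is enough.
-/

open scoped Matrix

namespace PSR

noncomputable section

universe u v

variable {O : Type u} {A : Type v}

/-! ### Sums over the continuations of a history -/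

section Futures

section System

variable [Fintype O]

/-- The probability that the system generates the observations of `l` after the history `τ` when
the actions of `l` are executed. -/
def seqProb (κ : Dynamics O A) : History O A → List (O × A) → ℝ
  | _, [] => 1
  | τ, x :: l => κ τ x.1 * seqProb κ (τ ++ [x]) l

theorem simplex_le_one {ι : Type*} [Fintype ι] (p : stdSimplex ℝ ι) (i : ι) : p i ≤ 1 := by
  have h := Finset.single_le_sum (f := fun j => p j) (fun j _ => p.2.1 j) (Finset.mem_univ i)
  have h2 : ∑ j, p j = 1 := p.2.2
  rwa [h2] at h

theorem seqProb_nonneg (κ : Dynamics O A) (τ : History O A) (l : List (O × A)) :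
    0 ≤ seqProb κ τ l := by
  induction l generalizing τ with
  | nil => simp [seqProb]
  | cons x l ih => exact mul_nonneg ((κ _).2.1 _) (ih _)

theorem seqProb_append (κ : Dynamics O A) (τ : History O A) (l l' : List (O × A)) :
    seqProb κ τ (l ++ l') = seqProb κ τ l * seqProb κ (τ ++ l) l' := by
  induction l generalizing τ with
  | nil => simp [seqProb]
  | cons x l ih => simp [seqProb, ih, mul_assoc]

theorem seqProb_snoc (κ : Dynamics O A) (τ : History O A) (x : O × A) :
    seqProb κ [] (τ ++ [x]) = seqProb κ [] τ * κ τ x.1 := by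
  rw [seqProb_append]; simp [seqProb]

end System

theorem ofFn_snoc {n : ℕ} (τ : Traj O A n) (x : O × A) :
    List.ofFn (Fin.snoc τ x : Traj O A (n + 1)) = List.ofFn τ ++ [x] := by
  rw [List.ofFn_succ']
  simp

section Policy

variable [Fintype A]

/-- The product of the probabilities that `π` gives to the actions of `τ`. -/
def polProb (π : Policy O A) {n : ℕ} (τ : Traj O A n) : ℝ :=
  ∏ i : Fin n, π (past τ i) (τ i).1 (τ i).2

theorem polProb_nonneg (π : Policy O A) {n : ℕ} (τ : Traj O A n) : 0 ≤ polProb π τ :=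
  Finset.prod_nonneg fun _ _ => (π _ _).2.1 _

theorem polProb_snoc (π : Policy O A) {n : ℕ} (τ : Traj O A n) (x : O × A) :
    polProb π (Fin.snoc τ x : Traj O A (n + 1)) =
      polProb π τ * π (List.ofFn τ) x.1 x.2 := by
  unfold polProb
  rw [Fin.prod_univ_castSucc]
  simp only [Fin.snoc_castSucc, Fin.snoc_last, Fin.val_castSucc, Fin.val_last]
  rw [past_snoc τ x le_rfl]
  have : past τ n = List.ofFn τ := by simp [past]
  rw [this]
  congr 1
  refine Finset.prod_congr rfl fun i _ => ?_
  rw [past_snoc τ x i.2.le]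

end Policy

variable [Fintype O] [Fintype A]

/-- The sum of `F s` over all continuations `s` of length `m` of the history `τ`, each one weighted
with the product of the probabilities that `π` gives to its actions. -/
def futureSum (π : Policy O A) : ℕ → History O A → (List (O × A) → ℝ) → ℝ
  | 0, _, F => F []
  | m + 1, τ, F => ∑ x : O × A, π τ x.1 x.2 * futureSum π m (τ ++ [x]) fun s => F (x :: s)

theorem futureSum_mono (π : Policy O A) {m : ℕ} {τ : History O A} {F G : List (O × A) → ℝ}
    (h : ∀ s, s.length = m → F s ≤ G s) : futureSum π m τ F ≤ futureSum π m τ G := by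
  induction m generalizing τ F G with
  | zero => exact h [] rfl
  | succ m ih =>
    refine Finset.sum_le_sum fun x _ => mul_le_mul_of_nonneg_left ?_ ((π _ _).2.1 _)
    exact ih fun s hs => h _ (by simp [hs])

theorem futureSum_congr (π : Policy O A) {m : ℕ} {τ : History O A} {F G : List (O × A) → ℝ}
    (h : ∀ s, s.length = m → F s = G s) : futureSum π m τ F = futureSum π m τ G :=
  le_antisymm (futureSum_mono π fun s hs => (h s hs).le)
    (futureSum_mono π fun s hs => (h s hs).ge)

theorem futureSum_zero_fun (π : Policy O A) (m : ℕ) (τ : History O A) :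
    futureSum π m τ (fun _ => 0) = 0 := by
  induction m generalizing τ with
  | zero => rfl
  | succ m ih => simp [futureSum, ih]

theorem futureSum_nonneg (π : Policy O A) {m : ℕ} {τ : History O A} {F : List (O × A) → ℝ}
    (h : ∀ s, s.length = m → 0 ≤ F s) : 0 ≤ futureSum π m τ F := by
  rw [← futureSum_zero_fun π m τ]; exact futureSum_mono π h

theorem futureSum_add (π : Policy O A) (m : ℕ) (τ : History O A) (F G : List (O × A) → ℝ) :
    futureSum π m τ (fun s => F s + G s) = futureSum π m τ F + futureSum π m τ G := by
  induction m generalizing τ F G with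
  | zero => rfl
  | succ m ih => simp [futureSum, ih, mul_add, Finset.sum_add_distrib]

theorem futureSum_mul_left (π : Policy O A) (m : ℕ) (τ : History O A) (c : ℝ)
    (F : List (O × A) → ℝ) :
    futureSum π m τ (fun s => c * F s) = c * futureSum π m τ F := by
  induction m generalizing τ F with
  | zero => rfl
  | succ m ih =>
    simp only [futureSum, ih, Finset.mul_sum]
    exact Finset.sum_congr rfl fun _ _ => by ring

theorem futureSum_finset_sum {ι : Type*} (I : Finset ι) (π : Policy O A) (m : ℕ)
    (τ : History O A) (F : ι → List (O × A) → ℝ) :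
    futureSum π m τ (fun s => ∑ i ∈ I, F i s) = ∑ i ∈ I, futureSum π m τ (F i) := by
  classical
  induction I using Finset.induction_on with
  | empty => simp [futureSum_zero_fun]
  | insert i I hi ih => simp [Finset.sum_insert hi, futureSum_add, ih]

theorem futureSum_split (π : Policy O A) (m n : ℕ) (τ : History O A) (F : List (O × A) → ℝ) :
    futureSum π (m + n) τ F =
      futureSum π m τ fun s => futureSum π n (τ ++ s) fun s' => F (s ++ s') := by
  induction m generalizing τ F with
  | zero => simp [futureSum]
  | succ m ih =>
    rw [Nat.succ_add_eq_add_succ, Nat.add_succ]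
    simp only [futureSum, ih]
    refine Finset.sum_congr rfl fun x _ => ?_
    simp

theorem futureSum_snoc (π : Policy O A) (m : ℕ) (τ : History O A) (F : List (O × A) → ℝ) :
    futureSum π (m + 1) τ F =
      futureSum π m τ fun s => ∑ x : O × A, π (τ ++ s) x.1 x.2 * F (s ++ [x]) := by
  rw [futureSum_split]; rfl

theorem futureSum_policy_congr {π π' : Policy O A} {m : ℕ} {τ : History O A}
    (h : ∀ s : List (O × A), s.length < m → π (τ ++ s) = π' (τ ++ s)) (F : List (O × A) → ℝ) :
    futureSum π m τ F = futureSum π' m τ F := by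
  induction m generalizing τ F with
  | zero => rfl
  | succ m ih =>
    refine Finset.sum_congr rfl fun x _ => ?_
    have h0 := h [] (by simp)
    simp only [List.append_nil] at h0
    rw [h0, ih]
    intro s hs
    simpa using h (x :: s) (by simpa using hs)

/-- A system generates some continuation with probability one. -/
theorem futureSum_seqProb (κ : Dynamics O A) (π : Policy O A) (m : ℕ) (σ τ : History O A) :
    futureSum π m τ (seqProb κ σ) = 1 := by
  induction m generalizing σ τ with
  | zero => rfl
  | succ m ih =>
    simp only [futureSum, seqProb, futureSum_mul_left, ih, mul_one]
    rw [Fintype.sum_prod_type]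
    have h1 : ∀ o, ∑ a, π τ o a = 1 := fun o => (π τ o).2.2
    have h2 : ∑ o, κ σ o = 1 := (κ σ).2.2
    simp [← Finset.sum_mul, h1, h2]

theorem sum_traj_succ {n : ℕ} (F : Traj O A (n + 1) → ℝ) :
    ∑ τ, F τ = ∑ τ : Traj O A n, ∑ x : O × A, F (Fin.snoc τ x) := by
  rw [← (Fin.snocEquiv fun _ : Fin (n + 1) => O × A).sum_comp, Fintype.sum_prod_type_right]
  rfl

theorem trajProb_eq (κ : Dynamics O A) (π : Policy O A) {n : ℕ} (τ : Traj O A n) :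
    trajProb κ π τ = seqProb κ [] (List.ofFn τ) * polProb π τ := by
  induction n with
  | zero => simp [trajProb, polProb, seqProb]
  | succ n ih =>
    obtain ⟨τ', x, rfl⟩ : ∃ (τ' : Traj O A n) (x : O × A), τ = Fin.snoc τ' x :=
      ⟨Fin.init τ, τ (Fin.last n), (Fin.snoc_init_self τ).symm⟩
    rw [trajProb_snoc, polProb_snoc, ofFn_snoc, seqProb_snoc, ih]
    have : past τ' n = List.ofFn τ' := by simp [past]
    rw [this]
    ring

theorem sum_polProb_mul (π : Policy O A) (n : ℕ) (F : List (O × A) → ℝ) :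
    ∑ τ : Traj O A n, polProb π τ * F (List.ofFn τ) = futureSum π n [] F := by
  induction n generalizing F with
  | zero => simp [polProb, futureSum]
  | succ n ih =>
    rw [sum_traj_succ, futureSum_snoc, ← ih]
    refine Finset.sum_congr rfl fun τ _ => ?_
    rw [Finset.mul_sum]
    refine Finset.sum_congr rfl fun x _ => ?_
    rw [polProb_snoc, ofFn_snoc]
    simp [mul_assoc]

/-- The `ℓ¹` distance of the trajectory laws of two systems under the same policy. -/
def lawDist (H : ℕ) (f κ : Dynamics O A) (π : Policy O A) : ℝ :=
  ∑ τ : Traj O A H, |trajProb f π τ - trajProb κ π τ|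

theorem lawDist_nonneg (H : ℕ) (f κ : Dynamics O A) (π : Policy O A) : 0 ≤ lawDist H f κ π :=
  Finset.sum_nonneg fun _ _ => abs_nonneg _

theorem lawDist_eq (H : ℕ) (f κ : Dynamics O A) (π : Policy O A) :
    lawDist H f κ π = futureSum π H [] fun s => |seqProb f [] s - seqProb κ [] s| := by
  rw [← sum_polProb_mul]
  refine Finset.sum_congr rfl fun τ _ => ?_
  rw [trajProb_eq, trajProb_eq, ← sub_mul, abs_mul, abs_of_nonneg (polProb_nonneg π τ), mul_comm]

theorem reachable_iff [Nonempty A] (κ : Dynamics O A) {n : ℕ} (τ : Traj O A n) :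
    Reachable κ τ ↔ 0 < seqProb κ [] (List.ofFn τ) := by
  constructor
  · rintro ⟨π, hπ⟩
    rw [trajProb_eq] at hπ
    exact pos_of_mul_pos_left hπ (polProb_nonneg π τ)
  · intro h
    refine ⟨fun _ _ => stdSimplex.barycenter, ?_⟩
    rw [trajProb_eq]
    refine mul_pos h (Finset.prod_pos fun i _ => ?_)
    exact inv_pos.2 (Nat.cast_pos.2 Fintype.card_pos)

end Futures

/-! ### Tests, predictive states and core histories -/

section Prediction

section Norm

/-- The `ℓ¹` norm of the coordinates of `x` at the tests in `W`. -/
def testNorm (W : Finset (Test O A)) (x : Test O A → ℝ) : ℝ := ∑ t ∈ W, |x t|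

theorem testNorm_nonneg (W : Finset (Test O A)) (x : Test O A → ℝ) : 0 ≤ testNorm W x :=
  Finset.sum_nonneg fun _ _ => abs_nonneg _

theorem testNorm_smul (W : Finset (Test O A)) (c : ℝ) (x : Test O A → ℝ) :
    testNorm W (c • x) = |c| * testNorm W x := by
  simp [testNorm, abs_mul, Finset.mul_sum]

/-- The test that observes `y.1`, executes `y.2` and continues with the test `t`. -/
def consTest (y : O × A) (t : Test O A) : Test O A := (y :: t.1, t.2)

theorem consTest_injective (y : O × A) : Function.Injective (consTest y) := by
  intro t t' h
  simp only [consTest, Prod.mk.injEq, List.cons.injEq, true_and] at h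
  exact Prod.ext h.1 h.2

theorem exists_ofFn_eq {n : ℕ} (τ : History O A) (h : τ.length = n) :
    ∃ τ' : Traj O A n, List.ofFn τ' = τ := by
  subst h
  exact ⟨τ.get, List.ofFn_get τ⟩

theorem card_actionSeqs_le (U : ℕ → Finset (Test O A)) {H n : ℕ} (hn : n < H) :
    (actionSeqs U (n + 1)).card ≤ numActionSeqs H U :=
  Finset.le_sup (f := fun h => (actionSeqs U h).card) (Finset.mem_Icc.2 ⟨by omega, hn⟩)

theorem OneNormLE.sum_le {m n : Type*} [Fintype m] [Fintype n] {X : Matrix n m ℝ} {b : ℝ}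
    (h : OneNormLE X b) (x : m → ℝ) : ∑ i, |(X *ᵥ x) i| ≤ b * ∑ j, |x j| := by
  rcases (Finset.sum_nonneg fun j (_ : j ∈ Finset.univ) => abs_nonneg (x j)).eq_or_lt with h0 | h0
  · have hx : x = 0 := by
      funext j
      have := (Finset.sum_eq_zero_iff_of_nonneg fun j _ => abs_nonneg (x j)).1 h0.symm j
        (Finset.mem_univ j)
      simpa using this
    simp [hx]
  · set S := ∑ j, |x j| with hS
    have h1 := h (S⁻¹ • x) (by
      simp only [Pi.smul_apply, smul_eq_mul, abs_mul, ← Finset.mul_sum]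
      rw [abs_of_pos (inv_pos.2 h0), ← hS, inv_mul_cancel₀ h0.ne'])
    rw [Matrix.mulVec_smul] at h1
    simp only [Pi.smul_apply, smul_eq_mul, abs_mul, ← Finset.mul_sum] at h1
    rw [abs_of_pos (inv_pos.2 h0), inv_mul_le_iff₀ h0] at h1
    linarith

end Norm

section TestSum

variable [Fintype O]

/-- The sum of `F` over all tests with the action sequence `w`. -/
def testSum : List A → (Test O A → ℝ) → ℝ
  | [], F => ∑ o, F ([], o)
  | a :: w, F => ∑ o, testSum w fun t => F (consTest (o, a) t)

theorem testSum_congr {w : List A} {F G : Test O A → ℝ} (h : ∀ t, F t = G t) :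
    testSum w F = testSum w G := by
  rw [funext h]

theorem testSum_mul_left (w : List A) (c : ℝ) (F : Test O A → ℝ) :
    testSum w (fun t => c * F t) = c * testSum w F := by
  induction w generalizing F with
  | nil => simp [testSum, Finset.mul_sum]
  | cons a w ih => simp [testSum, Finset.mul_sum, ih]

open Classical in
theorem sum_filter_actions_le_testSum (w : List A) (S : Finset (Test O A)) {F : Test O A → ℝ}
    (hF : ∀ t, 0 ≤ F t) : ∑ t ∈ S with t.actions = w, F t ≤ testSum w F := by
  induction w generalizing S F with
  | nil =>
    unfold testSum
    have hinj : Function.Injective fun o : O => (([], o) : Test O A) :=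
      fun o o' h => (Prod.mk.inj h).2
    rw [← Finset.sum_image (s := Finset.univ) (g := fun o : O => (([], o) : Test O A)) (f := F)
      hinj.injOn]
    refine Finset.sum_le_sum_of_subset_of_nonneg ?_ fun t _ _ => hF t
    rintro ⟨l, o⟩ ht
    simp only [Finset.mem_filter, Test.actions, List.map_eq_nil_iff] at ht
    simp [ht.2]
  | cons a w ih =>
    unfold testSum
    refine le_trans ?_ (Finset.sum_le_sum fun o _ => ih
      (S.preimage (consTest (o, a)) (consTest_injective _).injOn)
      (F := fun t => F (consTest (o, a) t)) fun t => hF _)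
    have hdisj : ((Finset.univ : Finset O) : Set O).PairwiseDisjoint fun o =>
        ((S.preimage (consTest (o, a)) (consTest_injective _).injOn).filter
          fun t => t.actions = w).image (consTest (o, a)) := by
      intro o _ o' _ hne
      simp only [Function.onFun, Finset.disjoint_left, Finset.mem_image]
      rintro _ ⟨t, _, rfl⟩ ⟨t', _, h⟩
      simp only [consTest, Prod.mk.injEq, List.cons.injEq] at h
      exact hne h.1.1.1.symm
    have hsum : ∀ o : O, (∑ t ∈ S.preimage (consTest (o, a)) (consTest_injective _).injOn with
        t.actions = w, F (consTest (o, a) t)) =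
        ∑ t ∈ ((S.preimage (consTest (o, a)) (consTest_injective _).injOn).filter
          fun t => t.actions = w).image (consTest (o, a)), F t := fun o =>
      (Finset.sum_image (consTest_injective (o, a)).injOn).symm
    simp only [hsum]
    rw [← Finset.sum_biUnion hdisj]
    refine Finset.sum_le_sum_of_subset_of_nonneg ?_ fun t _ _ => hF t
    rintro ⟨l, o'⟩ ht
    rw [Finset.mem_filter] at ht
    rcases l with _ | ⟨⟨o, b⟩, l⟩
    · simp [Test.actions] at ht
    · simp only [Test.actions, List.map_cons, List.cons.injEq] at ht
      obtain ⟨h1, rfl, h2⟩ := ht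
      simp only [Finset.mem_biUnion, Finset.mem_image, Finset.mem_filter, Finset.mem_preimage]
      exact ⟨o, Finset.mem_univ _, (l, o'), ⟨h1, h2⟩, rfl⟩

theorem sum_tests_le (U : ℕ → Finset (Test O A)) (h : ℕ) {F : Test O A → ℝ}
    (hF : ∀ t, 0 ≤ F t) : ∑ t ∈ U h, F t ≤ ∑ w ∈ actionSeqs U h, testSum w F := by
  classical
  rw [← Finset.sum_fiberwise_of_maps_to (s := U h) (t := actionSeqs U h) (g := Test.actions)
    (fun t ht => by unfold actionSeqs; exact Finset.mem_image_of_mem _ ht)]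
  refine Finset.sum_le_sum fun w _ => ?_
  convert sum_filter_actions_le_testSum w (U h) hF

/-- The predictive state of the history `τ`, as a function on all tests. -/
def predVec (H : ℕ) (dummy : O) (κ : Dynamics O A) (τ : History O A) : Test O A → ℝ :=
  fun t => doProb H dummy κ τ t.1 t.2

theorem obsProb_nonneg (H : ℕ) (dummy : O) (κ : Dynamics O A) (τ : History O A) (o : O) :
    0 ≤ obsProb H dummy κ τ o := by
  unfold obsProb
  split_ifs
  exacts [(κ τ).2.1 o, zero_le_one, le_rfl]

theorem sum_obsProb (H : ℕ) (dummy : O) (κ : Dynamics O A) (τ : History O A) :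
    ∑ o, obsProb H dummy κ τ o = 1 := by
  unfold obsProb
  split_ifs
  · exact (κ τ).2.2
  · rw [Finset.sum_eq_single dummy (fun o _ ho => if_neg ho)
      fun h => absurd (Finset.mem_univ _) h, if_pos rfl]

theorem predVec_nonneg (H : ℕ) (dummy : O) (κ : Dynamics O A) (τ : History O A) (t : Test O A) :
    0 ≤ predVec H dummy κ τ t := by
  obtain ⟨l, o⟩ := t
  unfold predVec
  induction l generalizing τ with
  | nil => exact obsProb_nonneg _ _ _ _ _
  | cons x l ih => exact mul_nonneg (obsProb_nonneg _ _ _ _ _) (ih _)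

theorem predVec_nil (H : ℕ) (dummy : O) (κ : Dynamics O A) (τ : History O A) (o : O) :
    predVec H dummy κ τ ([], o) = obsProb H dummy κ τ o := rfl

theorem predVec_cons (H : ℕ) (dummy : O) (κ : Dynamics O A) (τ : History O A) (y : O × A)
    (t : Test O A) : predVec H dummy κ τ (consTest y t) =
      obsProb H dummy κ τ y.1 * predVec H dummy κ (τ ++ [y]) t := rfl

theorem testSum_predVec (H : ℕ) (dummy : O) (κ : Dynamics O A) (w : List A) (τ : History O A) :
    testSum w (predVec H dummy κ τ) = 1 := by
  induction w generalizing τ with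
  | nil => exact sum_obsProb _ _ _ _
  | cons a w ih => simp [testSum, predVec_cons, testSum_mul_left, ih, sum_obsProb]

theorem testNorm_predVec_le {H : ℕ} (dummy : O) (κ : Dynamics O A) (τ : History O A)
    (U : ℕ → Finset (Test O A)) {n : ℕ} (hn : n < H) :
    testNorm (U (n + 1)) (predVec H dummy κ τ) ≤ numActionSeqs H U := by
  have h1 : testNorm (U (n + 1)) (predVec H dummy κ τ) =
      ∑ t ∈ U (n + 1), predVec H dummy κ τ t :=
    Finset.sum_congr rfl fun t _ => abs_of_nonneg (predVec_nonneg _ _ _ _ _)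
  rw [h1]
  refine (sum_tests_le U (n + 1) (predVec_nonneg H dummy κ τ)).trans ?_
  simp only [testSum_predVec, Finset.sum_const, nsmul_eq_mul, mul_one]
  exact_mod_cast card_actionSeqs_le U hn

/-- A complete trajectory is the test that observes it and then the dummy observation. -/
theorem predVec_full {H : ℕ} (dummy : O) (κ : Dynamics O A) (τ : History O A)
    (s : List (O × A)) (h : τ.length + s.length = H) :
    predVec H dummy κ τ (s, dummy) = seqProb κ τ s := by
  induction s generalizing τ with
  | nil =>
    have : ¬ τ.length < H := by simp at h; omega
    simp [predVec_nil, obsProb, this, seqProb]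
  | cons x s ih =>
    have h1 : τ.length < H := by simp at h; omega
    have : ((x :: s, dummy) : Test O A) = consTest x (s, dummy) := rfl
    rw [this, predVec_cons, ih _ (by simp at h ⊢; omega)]
    simp [obsProb, h1, seqProb]

end TestSum

variable [Fintype O] [Fintype A]

/-- Since the rows of the core tests have the same rank as all rows, a combination of columns that
vanishes at the core tests vanishes at all tests. -/
theorem IsCoreTestSet.mulVec_eq_zero {H : ℕ} {dummy : O} {κ : Dynamics O A} {h : ℕ}
    {W : Finset (Test O A)} (hW : IsCoreTestSet H dummy κ h W) {v : Traj O A h → ℝ}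
    (hv : predMatrix H dummy κ h W *ᵥ v = 0) : dynMatrix H dummy κ h *ᵥ v = 0 := by
  have hle : LinearMap.ker (dynMatrix H dummy κ h).mulVecLin ≤
      LinearMap.ker (predMatrix H dummy κ h W).mulVecLin := by
    intro x hx
    rw [LinearMap.mem_ker, Matrix.mulVecLin_apply] at hx ⊢
    funext t
    exact congrFun hx t.1
  have h1 := LinearMap.finrank_range_add_finrank_ker (dynMatrix H dummy κ h).mulVecLin
  have h2 := LinearMap.finrank_range_add_finrank_ker (predMatrix H dummy κ h W).mulVecLin
  have h3 : Module.finrank ℝ (LinearMap.range (predMatrix H dummy κ h W).mulVecLin) =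
      Module.finrank ℝ (LinearMap.range (dynMatrix H dummy κ h).mulVecLin) := hW
  have heq := Submodule.eq_of_le_of_finrank_eq hle (by omega)
  have : v ∈ LinearMap.ker (predMatrix H dummy κ h W).mulVecLin := hv
  rw [← heq] at this
  exact this

/-- Predictive states are stably represented by those of the core histories: there are `rank D_n`
many histories `σ j` and coefficients `y x j`, linear in the coordinates of `x` at the core tests
and of `ℓ¹` norm at most `‖x‖₁ / α`, that reproduce the predictive state of each reachable
history. -/
theorem exists_coreCoeff [Nonempty A] {H : ℕ} {dummy : O} {κ : Dynamics O A}
    {U : ℕ → Finset (Test O A)} {α : ℝ} (hreg : IsRegular H dummy U α κ) {n : ℕ} (hn : n < H)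
    (hcore : IsCoreTestSet H dummy κ n (U (n + 1))) :
    ∃ (σ : Fin (dynMatrix H dummy κ n).rank → History O A)
      (y : (Test O A → ℝ) →ₗ[ℝ] (Fin (dynMatrix H dummy κ n).rank → ℝ)),
      (∀ j, (σ j).length = n) ∧
      (∀ x, ∑ j, |y x j| ≤ 1 / α * testNorm (U (n + 1)) x) ∧
      (∀ x j, y x j ≠ 0 → 0 < seqProb κ [] (σ j)) ∧
      ∀ τ : History O A, τ.length = n → 0 < seqProb κ [] τ →
        ∑ j, y (predVec H dummy κ τ) j • predVec H dummy κ (σ j) = predVec H dummy κ τ := by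
  classical
  obtain ⟨K, X, ⟨⟨σ, hK⟩, hspan⟩, ⟨hKXK, -⟩, hX⟩ := hreg n hn
  let res : (Test O A → ℝ) →ₗ[ℝ] (U (n + 1) → ℝ) := LinearMap.funLeft ℝ ℝ Subtype.val
  let y0 : (Test O A → ℝ) →ₗ[ℝ] (Fin (dynMatrix H dummy κ n).rank → ℝ) := X.mulVecLin ∘ₗ res
  let y : (Test O A → ℝ) →ₗ[ℝ] (Fin (dynMatrix H dummy κ n).rank → ℝ) :=
    LinearMap.pi fun j => if Reachable κ (σ j) then (LinearMap.proj j) ∘ₗ y0 else 0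
  have hy : ∀ x j, y x j = if Reachable κ (σ j) then (X *ᵥ fun t : U (n + 1) => x t) j else 0 := by
    intro x j
    simp only [y, LinearMap.pi_apply]
    split_ifs <;> rfl
  refine ⟨fun j => List.ofFn (σ j), y, fun j => by simp, fun x => ?_, fun x j hj => ?_, ?_⟩
  · refine le_trans (Finset.sum_le_sum fun j _ => ?_)
      ((hX.sum_le fun t : U (n + 1) => x t).trans_eq ?_)
    · rw [hy]
      split_ifs
      · exact le_rfl
      · simp
    · rw [testNorm, Finset.sum_coe_sort (U (n + 1)) (fun t => |x t|)]
  · rw [hy] at hj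
    split_ifs at hj with h
    · exact (reachable_iff κ _).1 h
    · exact absurd rfl hj
  · intro τ hτ hpos
    obtain ⟨τ, rfl⟩ := exists_ofFn_eq τ hτ
    have hr : Reachable κ τ := (reachable_iff κ τ).2 hpos
    obtain ⟨v, hv⟩ := hspan τ
    set q : U (n + 1) → ℝ := fun t => predMatrix H dummy κ n (U (n + 1)) t τ with hq
    have hq' : q = fun t : U (n + 1) => predVec H dummy κ (List.ofFn τ) t := by
      funext t
      simp [hq, predMatrix, dynMatrix, hr, predVec]
    -- the difference of the two sides is a combination of columns that vanishes at the core tests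
    set c : Fin (dynMatrix H dummy κ n).rank → ℝ := X *ᵥ q with hc
    set z : Traj O A n → ℝ := (∑ j, c j • Pi.single (σ j) 1) - Pi.single τ 1 with hz
    have hmul : ∀ {ι : Type _} (M : Matrix ι (Traj O A n) ℝ) (t : ι),
        (M *ᵥ z) t = ∑ j, c j * M t (σ j) - M t τ := by
      intro ι M t
      rw [hz, Matrix.mulVec_sub, Matrix.mulVec_sum]
      simp [Matrix.mulVec_smul]
    have hz0 : predMatrix H dummy κ n (U (n + 1)) *ᵥ z = 0 := by
      funext t
      rw [hmul]
      have h1 : ∑ j, c j * predMatrix H dummy κ n (U (n + 1)) t (σ j) = (K *ᵥ c) t := by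
        rw [hK]
        simp [Matrix.mulVec, dotProduct, mul_comm]
      have h2 : K *ᵥ c = q := by
        rw [hc, hv, Matrix.mulVec_mulVec, Matrix.mulVec_mulVec, hKXK]
      rw [h1, h2]
      simp [hq]
    have hD := hcore.mulVec_eq_zero hz0
    funext t
    have ht := congrFun hD t
    rw [hmul] at ht
    have h3 : dynMatrix H dummy κ n t τ = predVec H dummy κ (List.ofFn τ) t := by
      simp [dynMatrix, hr, predVec]
    rw [h3] at ht
    simp only [Finset.sum_apply, Pi.smul_apply, smul_eq_mul]
    rw [← sub_eq_zero]
    refine Eq.trans ?_ ht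
    congr 1
    refine Finset.sum_congr rfl fun j _ => ?_
    rw [hy, ← hq', ← hc]
    split_ifs with h
    · simp [dynMatrix, h, predVec]
    · simp [dynMatrix, h]

end Prediction

/-! ### Decomposition of the distance of trajectory laws into update errors -/

section Telescoping

/-- The prediction of a complete trajectory from the vector `x` at level `n`. At the last level the
observation itself is a core test, and the coordinate of `x` at that test is used. -/
def trajPred (H : ℕ) (dummy : O) (n : ℕ) (P : (Test O A → ℝ) →ₗ[ℝ] (Test O A → ℝ))
    (x : Test O A → ℝ) (s : List (O × A)) : ℝ :=
  if n + 1 = H then s.head?.elim 0 fun y => x ([], y.1) else P x (s, dummy)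

theorem trajPred_add (H : ℕ) (dummy : O) (n : ℕ) (P : (Test O A → ℝ) →ₗ[ℝ] (Test O A → ℝ))
    (x x' : Test O A → ℝ) (s : List (O × A)) :
    trajPred H dummy n P (x + x') s = trajPred H dummy n P x s + trajPred H dummy n P x' s := by
  unfold trajPred
  split_ifs
  · cases s.head? <;> simp
  · simp

variable [Fintype O]

/-- The vector `x` at the tests that start with `y`, as a function of the rest of the test. -/
def tailVec (y : O × A) (x : Test O A → ℝ) : Test O A → ℝ := fun t => x (consTest y t)

/-- The predictive state of `τ` multiplied with the probability of the observations of `τ`. -/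
def stateVec (H : ℕ) (dummy : O) (κ : Dynamics O A) (τ : History O A) : Test O A → ℝ :=
  seqProb κ [] τ • predVec H dummy κ τ

theorem tailVec_predVec {H : ℕ} (dummy : O) (κ : Dynamics O A) {τ : History O A}
    (h : τ.length < H) (y : O × A) :
    tailVec y (predVec H dummy κ τ) = κ τ y.1 • predVec H dummy κ (τ ++ [y]) := by
  funext t
  simp [tailVec, predVec_cons, obsProb, h]

theorem tailVec_stateVec {H : ℕ} (dummy : O) (κ : Dynamics O A) {τ : History O A}
    (h : τ.length < H) (y : O × A) :
    tailVec y (stateVec H dummy κ τ) = stateVec H dummy κ (τ ++ [y]) := by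
  have h1 := tailVec_predVec dummy κ h y
  unfold stateVec
  rw [seqProb_snoc, mul_smul, ← h1]
  rfl

theorem sum_testNorm_tailVec_predVec_le [Fintype A] {H : ℕ} (dummy : O) (κ : Dynamics O A)
    {τ : History O A} (h : τ.length < H) (U : ℕ → Finset (Test O A)) {n : ℕ} (hn : n < H) :
    ∑ y : O × A, testNorm (U (n + 1)) (tailVec y (predVec H dummy κ τ)) ≤
      Fintype.card A * numActionSeqs H U := by
  have h1 : ∀ y : O × A, testNorm (U (n + 1)) (tailVec y (predVec H dummy κ τ)) ≤
      κ τ y.1 * numActionSeqs H U := by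
    intro y
    have h0 : 0 ≤ κ τ y.1 := (κ τ).2.1 _
    rw [tailVec_predVec dummy κ h, testNorm_smul, abs_of_nonneg h0]
    exact mul_le_mul_of_nonneg_left (testNorm_predVec_le dummy κ _ U hn) h0
  refine (Finset.sum_le_sum fun y _ => h1 y).trans_eq ?_
  rw [← Finset.sum_mul, Fintype.sum_prod_type]
  have h2 : ∑ o, κ τ o = 1 := (κ τ).2.2
  simp [← Finset.mul_sum, h2]

/-- `P` predicts, from the coordinates at the core tests, all tests after histories of length `n`:
it fixes the predictive states, and each `P x` is a combination of predictive states with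
coefficients of `ℓ¹` norm at most `‖x‖₁ / α`. -/
structure IsPredictor (H : ℕ) (dummy : O) (U : ℕ → Finset (Test O A)) (α : ℝ)
    (κ : Dynamics O A) (n : ℕ) (P : (Test O A → ℝ) →ₗ[ℝ] (Test O A → ℝ)) : Prop where
  apply_predVec : ∀ τ : History O A, τ.length = n → 0 < seqProb κ [] τ →
    P (predVec H dummy κ τ) = predVec H dummy κ τ
  exists_coeff : ∀ x, ∃ (m : ℕ) (σ : Fin m → History O A) (c : Fin m → ℝ),
    P x = ∑ j, c j • predVec H dummy κ (σ j) ∧ (∀ j, (σ j).length = n) ∧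
      (∀ j, c j ≠ 0 → 0 < seqProb κ [] (σ j)) ∧ ∑ j, |c j| ≤ 1 / α * testNorm (U (n + 1)) x

/-- The predictor combines the predictive states of the core histories with the coefficients
of `exists_coreCoeff`. -/
theorem exists_isPredictor [Fintype A] [Nonempty A] {H : ℕ} {dummy : O} {κ : Dynamics O A}
    {U : ℕ → Finset (Test O A)} {α : ℝ} (hreg : IsRegular H dummy U α κ)
    (hcore : ∀ h < H, IsCoreTestSet H dummy κ h (U (h + 1))) :
    ∃ P : ℕ → (Test O A → ℝ) →ₗ[ℝ] (Test O A → ℝ),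
      ∀ n < H, IsPredictor H dummy U α κ n (P n) := by
  have h : ∀ n, ∃ P : (Test O A → ℝ) →ₗ[ℝ] (Test O A → ℝ),
      n < H → IsPredictor H dummy U α κ n P := by
    intro n
    by_cases hn : n < H
    · obtain ⟨σ, y, hlen, hy, hpos, hrep⟩ := exists_coreCoeff hreg hn (hcore n hn)
      have hP : ∀ x, (∑ j, (LinearMap.proj j ∘ₗ y).smulRight (predVec H dummy κ (σ j))) x =
          ∑ j, y x j • predVec H dummy κ (σ j) := fun x => by simp
      exact ⟨_, fun _ => ⟨fun τ h1 h2 => (hP _).trans (hrep τ h1 h2),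
        fun x => ⟨_, σ, y x, hP x, hlen, hpos x, hy x⟩⟩⟩
    · exact ⟨0, fun h => absurd h hn⟩
  choose P hP using h
  exact ⟨P, hP⟩

section

variable {H : ℕ} {dummy : O} {U : ℕ → Finset (Test O A)} {α : ℝ} {κ : Dynamics O A} {n : ℕ}
  {P : (Test O A → ℝ) →ₗ[ℝ] (Test O A → ℝ)}

theorem IsPredictor.apply_stateVec (hP : IsPredictor H dummy U α κ n P) {τ : History O A}
    (hτ : τ.length = n) : P (stateVec H dummy κ τ) = stateVec H dummy κ τ := by
  unfold stateVec
  rcases (seqProb_nonneg κ [] τ).eq_or_lt with h | h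
  · simp [← h]
  · rw [map_smul, hP.apply_predVec τ hτ h]

/-- The bound `α ≤ |𝒰_A|`, which holds since `P` preserves the total mass of a predictive state. -/
theorem IsPredictor.one_le (hP : IsPredictor H dummy U α κ 0 P) (hα : 0 < α) (hH : 0 < H) :
    1 ≤ (numActionSeqs H U : ℝ) / α := by
  obtain ⟨m, σ, c, h1, -, -, h2⟩ := hP.exists_coeff (predVec H dummy κ [])
  rw [hP.apply_predVec [] rfl (by simp [seqProb])] at h1
  have h3 : (1 : ℝ) = ∑ j, c j := by
    have h4 := congrArg (testSum []) h1
    rw [testSum_predVec] at h4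
    rw [h4]
    simp only [testSum, Finset.sum_apply, Pi.smul_apply, smul_eq_mul]
    rw [Finset.sum_comm]
    refine Finset.sum_congr rfl fun j _ => ?_
    rw [← Finset.mul_sum]
    have := testSum_predVec H dummy κ [] (σ j)
    simp only [testSum] at this
    rw [this, mul_one]
  have h5 : ∑ j, c j ≤ ∑ j, |c j| := Finset.sum_le_sum fun j _ => le_abs_self _
  have h6 := testNorm_predVec_le dummy κ [] U hH
  calc (1 : ℝ) ≤ 1 / α * testNorm (U (0 + 1)) (predVec H dummy κ []) := by linarith
    _ ≤ 1 / α * numActionSeqs H U := by gcongr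
    _ = numActionSeqs H U / α := by ring

/-- The bound `|𝒜| |𝒰_A| / α` on the norm of one update. -/
theorem IsPredictor.sum_testNorm_tailVec_le [Fintype A] (hP : IsPredictor H dummy U α κ n P)
    (hn : n + 1 < H) (x : Test O A → ℝ) :
    ∑ y : O × A, testNorm (U (n + 2)) (tailVec y (P x)) ≤
      Fintype.card A * (numActionSeqs H U / α) * testNorm (U (n + 1)) x := by
  obtain ⟨m, σ, c, h1, hlen, -, h2⟩ := hP.exists_coeff x
  have h3 : ∀ y : O × A, testNorm (U (n + 2)) (tailVec y (P x)) ≤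
      ∑ j, |c j| * testNorm (U (n + 2)) (tailVec y (predVec H dummy κ (σ j))) := by
    intro y
    simp only [testNorm, Finset.mul_sum, tailVec, h1]
    rw [Finset.sum_comm]
    refine Finset.sum_le_sum fun t _ => ?_
    rw [Finset.sum_apply]
    refine (Finset.abs_sum_le_sum_abs _ _).trans_eq ?_
    simp [abs_mul]
  calc _ ≤ ∑ y : O × A, ∑ j, |c j| *
        testNorm (U (n + 2)) (tailVec y (predVec H dummy κ (σ j))) :=
        Finset.sum_le_sum fun y _ => h3 y
    _ = ∑ j, |c j| * ∑ y : O × A,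
        testNorm (U (n + 2)) (tailVec y (predVec H dummy κ (σ j))) := by
        rw [Finset.sum_comm]
        simp [Finset.mul_sum]
    _ ≤ ∑ j, |c j| * (Fintype.card A * numActionSeqs H U) := by
        refine Finset.sum_le_sum fun j _ => mul_le_mul_of_nonneg_left ?_ (abs_nonneg _)
        exact sum_testNorm_tailVec_predVec_le dummy κ (by rw [hlen]; omega) U hn
    _ = (∑ j, |c j|) * (Fintype.card A * numActionSeqs H U) := by rw [Finset.sum_mul]
    _ ≤ (1 / α * testNorm (U (n + 1)) x) * (Fintype.card A * numActionSeqs H U) := by gcongr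
    _ = _ := by ring

end

section

variable {H : ℕ} {dummy : O} {U : ℕ → Finset (Test O A)} {α : ℝ} {κ : Dynamics O A} {n : ℕ}
  {P P' : (Test O A → ℝ) →ₗ[ℝ] (Test O A → ℝ)}

theorem trajPred_stateVec (hP : IsPredictor H dummy U α κ n P) {τ : History O A}
    (hτ : τ.length = n) {s : List (O × A)} (hs : n + s.length = H) :
    trajPred H dummy n P (stateVec H dummy κ τ) s = seqProb κ [] (τ ++ s) := by
  unfold trajPred
  rw [seqProb_append]
  split_ifs with h
  · obtain ⟨y, rfl⟩ : ∃ y, s = [y] := List.length_eq_one_iff.1 (by omega)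
    have : τ.length < H := by omega
    simp [stateVec, predVec_nil, obsProb, this, seqProb]
  · rw [hP.apply_stateVec hτ, stateVec, Pi.smul_apply, predVec_full dummy κ τ s (by omega)]
    rfl

/-- A perturbation `x` of the state changes the predicted trajectory law by at most a multiple of
its norm at the core tests. At the last level this needs that the observations are core tests. -/
theorem futureSum_abs_trajPred_le [Fintype A] (hP : IsPredictor H dummy U α κ n P) (hn : n < H)
    (hU : ∀ o : O, (([], o) : Test O A) ∈ U H) {Λ : ℝ} (h1 : 1 ≤ Λ) (h2 : 1 / α ≤ Λ)
    (π : Policy O A) (τ : History O A) (x : Test O A → ℝ) :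
    futureSum π (H - n) τ (fun s => |trajPred H dummy n P x s|) ≤
      Λ * testNorm (U (n + 1)) x := by
  have hnn := testNorm_nonneg (U (n + 1)) x
  by_cases h : n + 1 = H
  · subst h
    have hd : n + 1 - n = 0 + 1 := by omega
    rw [hd]
    simp only [futureSum, trajPred, if_true, List.head?_cons, Option.elim]
    rw [Fintype.sum_prod_type]
    have h3 : ∀ o, ∑ a, π τ o a = 1 := fun o => (π τ o).2.2
    simp only [← Finset.sum_mul, h3, one_mul]
    have hinj : Function.Injective fun o : O => (([], o) : Test O A) :=
      fun o o' h => (Prod.mk.inj h).2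
    classical
    have h4 : ∑ o : O, |x ([], o)| ≤ testNorm (U (n + 1)) x := by
      rw [← Finset.sum_image (s := Finset.univ) (g := fun o : O => (([], o) : Test O A))
        (f := fun t => |x t|) hinj.injOn]
      refine Finset.sum_le_sum_of_subset_of_nonneg ?_ fun t _ _ => abs_nonneg _
      intro t ht
      obtain ⟨o, -, rfl⟩ := Finset.mem_image.1 ht
      exact hU o
    nlinarith
  · obtain ⟨m, σ, c, h3, hlen, -, h4⟩ := hP.exists_coeff x
    calc futureSum π (H - n) τ (fun s => |trajPred H dummy n P x s|)
        ≤ futureSum π (H - n) τ (fun s => ∑ j, |c j| * seqProb κ (σ j) s) := by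
          refine futureSum_mono π fun s hs => ?_
          rw [trajPred, if_neg h, h3, Finset.sum_apply]
          refine (Finset.abs_sum_le_sum_abs _ _).trans_eq (Finset.sum_congr rfl fun j _ => ?_)
          rw [Pi.smul_apply, predVec_full dummy κ _ s (by rw [hlen]; omega), smul_eq_mul, abs_mul,
            abs_of_nonneg (seqProb_nonneg κ _ _)]
      _ = ∑ j, |c j| := by
          rw [futureSum_finset_sum]
          simp [futureSum_mul_left, futureSum_seqProb]
      _ ≤ 1 / α * testNorm (U (n + 1)) x := h4
      _ ≤ Λ * testNorm (U (n + 1)) x := by gcongr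

/-- Predicting `y` followed by `s` is updating the state along `y` and predicting `s`. -/
theorem trajPred_cons (hP : IsPredictor H dummy U α κ n P)
    (hP' : IsPredictor H dummy U α κ (n + 1) P') (hn : n + 1 < H) (x : Test O A → ℝ) (y : O × A)
    {s : List (O × A)} (hs : n + 1 + s.length = H) :
    trajPred H dummy n P x (y :: s) = trajPred H dummy (n + 1) P' (tailVec y (P x)) s := by
  obtain ⟨m, σ, c, h1, hlen, hpos, -⟩ := hP.exists_coeff x
  have htail : tailVec y (P x) = ∑ j, (c j * κ (σ j) y.1) • predVec H dummy κ (σ j ++ [y]) := by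
    rw [h1]
    funext t
    simp only [tailVec, Finset.sum_apply, Pi.smul_apply, smul_eq_mul]
    refine Finset.sum_congr rfl fun j _ => ?_
    have := congrFun (tailVec_predVec dummy κ (τ := σ j) (H := H) (by rw [hlen]; omega) y) t
    simp only [tailVec, Pi.smul_apply, smul_eq_mul] at this
    rw [this, mul_assoc]
  have hL : trajPred H dummy n P x (y :: s) = tailVec y (P x) (s, dummy) := by
    rw [trajPred, if_neg (by omega)]
    rfl
  rw [hL]
  unfold trajPred
  split_ifs with h
  · obtain ⟨z, rfl⟩ : ∃ z, s = [z] := List.length_eq_one_iff.1 (by omega)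
    simp only [List.head?_cons, Option.elim]
    rw [htail, Finset.sum_apply, Finset.sum_apply]
    refine Finset.sum_congr rfl fun j _ => ?_
    rw [Pi.smul_apply, Pi.smul_apply, predVec_full dummy κ _ _ (by simp [hlen]; omega)]
    have : (σ j ++ [y]).length < H := by simp [hlen]; omega
    rw [predVec_nil, obsProb, if_pos this]
    simp [seqProb]
  · suffices key : P' (tailVec y (P x)) = tailVec y (P x) by rw [key]
    rw [htail, map_sum P']
    refine Finset.sum_congr rfl fun j _ => ?_
    rw [map_smul]
    by_cases hc : c j * κ (σ j) y.1 = 0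
    · simp [hc]
    · rw [hP'.apply_predVec _ (by simp [hlen])]
      rw [seqProb_snoc]
      exact mul_pos (hpos j (left_ne_zero_of_mul hc))
        (lt_of_le_of_ne ((κ _).2.1 _) (right_ne_zero_of_mul hc).symm)

end

variable [Fintype A]

/-- The error of one update of the state `x` at level `n`. -/
def stepErr (U : ℕ → Finset (Test O A)) (n : ℕ) (P : (Test O A → ℝ) →ₗ[ℝ] (Test O A → ℝ))
    (x : Test O A → ℝ) : ℝ :=
  ∑ y : O × A, testNorm (U (n + 2)) (tailVec y (P x - x))

theorem stepErr_nonneg (U : ℕ → Finset (Test O A)) (n : ℕ)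
    (P : (Test O A → ℝ) →ₗ[ℝ] (Test O A → ℝ)) (x : Test O A → ℝ) : 0 ≤ stepErr U n P x :=
  Finset.sum_nonneg fun _ _ => testNorm_nonneg _ _

/-- Predicting with the model `f` from the true state differs from the true probability by the
update errors of `f` that accumulate until the end of the episode. -/
theorem futureSum_trajPred_sub_le {H : ℕ} {dummy : O} {U : ℕ → Finset (Test O A)} {α : ℝ}
    {f κ : Dynamics O A} {P : ℕ → (Test O A → ℝ) →ₗ[ℝ] (Test O A → ℝ)}
    (hP : ∀ n < H, IsPredictor H dummy U α f n (P n))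
    (hU : ∀ o : O, (([], o) : Test O A) ∈ U H) {Λ : ℝ} (h1 : 1 ≤ Λ) (h2 : 1 / α ≤ Λ)
    (π : Policy O A) (k n : ℕ) (hk : n + k + 1 = H) (τ : History O A) (hτ : τ.length = n) :
    futureSum π (k + 1) τ (fun s =>
      |trajPred H dummy n (P n) (stateVec H dummy κ τ) s - seqProb κ [] (τ ++ s)|) ≤
    Λ * ∑ i ∈ Finset.range k, futureSum π i τ fun s =>
      stepErr U (n + i) (P (n + i)) (stateVec H dummy κ (τ ++ s)) := by
  induction k generalizing n τ with
  | zero =>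
    have : futureSum π (0 + 1) τ (fun s =>
        |trajPred H dummy n (P n) (stateVec H dummy κ τ) s - seqProb κ [] (τ ++ s)|) =
        futureSum π (0 + 1) τ fun _ => 0 := by
      refine futureSum_congr π fun s hs => ?_
      obtain ⟨y, rfl⟩ : ∃ y, s = [y] := List.length_eq_one_iff.1 (by omega)
      have hl : τ.length < H := by omega
      rw [abs_eq_zero, sub_eq_zero, trajPred, if_pos (by omega), seqProb_append]
      simp [stateVec, predVec_nil, obsProb, hl, seqProb]
    rw [this, futureSum_zero_fun]
    simp
  | succ k ih =>
    set x := stateVec H dummy κ τ with hx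
    have hy : ∀ y : O × A, futureSum π (k + 1) (τ ++ [y]) (fun s =>
        |trajPred H dummy n (P n) x (y :: s) - seqProb κ [] (τ ++ (y :: s))|) ≤
        Λ * testNorm (U (n + 2)) (tailVec y (P n x - x)) +
        Λ * ∑ i ∈ Finset.range k, futureSum π i (τ ++ [y]) fun s =>
          stepErr U (n + (i + 1)) (P (n + (i + 1))) (stateVec H dummy κ (τ ++ (y :: s))) := by
      intro y
      have ha := futureSum_abs_trajPred_le (hP (n + 1) (by omega)) (by omega) hU h1 h2 π
        (τ ++ [y]) (tailVec y (P n x - x))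
      have hb := ih (n + 1) (by omega) (τ ++ [y]) (by simp [hτ])
      rw [show H - (n + 1) = k + 1 by omega] at ha
      have hc : ∀ i, n + 1 + i = n + (i + 1) := fun i => by omega
      simp only [hc, List.append_assoc, List.singleton_append] at hb
      refine le_trans ?_ (add_le_add ha hb)
      rw [← futureSum_add]
      refine futureSum_mono π fun s hs => ?_
      rw [trajPred_cons (hP n (by omega)) (hP (n + 1) (by omega)) (by omega) x y (by omega)]
      have hd : tailVec y (P n x) = tailVec y (P n x - x) + stateVec H dummy κ (τ ++ [y]) := by
        rw [← tailVec_stateVec dummy κ (by omega) y, ← hx]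
        funext t
        simp [tailVec]
      rw [hd, trajPred_add, add_sub_assoc]
      exact abs_add_le _ _
    have hπ : ∀ y : O × A, 0 ≤ π τ y.1 y.2 := fun y => (π τ y.1).2.1 _
    have hΛ : 0 ≤ Λ := by linarith
    rw [futureSum]
    refine (Finset.sum_le_sum fun y _ => mul_le_mul_of_nonneg_left (hy y) (hπ y)).trans ?_
    simp only [mul_add, Finset.sum_add_distrib]
    rw [Finset.sum_range_succ', mul_add, add_comm]
    refine add_le_add (le_of_eq ?_) ?_
    · simp only [futureSum, Finset.mul_sum]
      rw [Finset.sum_comm]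
      refine Finset.sum_congr rfl fun i _ => Finset.sum_congr rfl fun y _ => ?_
      ring
    · simp only [futureSum, add_zero, List.append_nil, stepErr, Finset.mul_sum]
      refine Finset.sum_le_sum fun y _ => ?_
      exact mul_le_of_le_one_left (mul_nonneg hΛ (testNorm_nonneg _ _)) (simplex_le_one _ _)

/-- The distance of the trajectory laws is bounded by the error at the start and the errors of the
updates along the true states. -/
theorem lawDist_le {H : ℕ} (hH : 1 ≤ H) {dummy : O} {U : ℕ → Finset (Test O A)} {α : ℝ}
    {f κ : Dynamics O A} {P : ℕ → (Test O A → ℝ) →ₗ[ℝ] (Test O A → ℝ)}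
    (hP : ∀ n < H, IsPredictor H dummy U α f n (P n))
    (hU : ∀ o : O, (([], o) : Test O A) ∈ U H) {Λ : ℝ} (h1 : 1 ≤ Λ) (h2 : 1 / α ≤ Λ)
    (π : Policy O A) :
    lawDist H f κ π ≤
      Λ * (testNorm (U 1) (stateVec H dummy f [] - stateVec H dummy κ []) +
        ∑ i ∈ Finset.range (H - 1), futureSum π i [] fun s =>
          stepErr U i (P i) (stateVec H dummy κ s)) := by
  have ha := futureSum_abs_trajPred_le (hP 0 (by omega)) (by omega) hU h1 h2 π []
    (stateVec H dummy f [] - stateVec H dummy κ [])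
  have hb := futureSum_trajPred_sub_le (κ := κ) hP hU h1 h2 π (H - 1) 0 (by omega) [] rfl
  rw [show H - 1 + 1 = H by omega] at hb
  simp only [List.nil_append, Nat.zero_add] at hb
  rw [mul_add]
  refine le_trans ?_ (add_le_add ha hb)
  rw [Nat.sub_zero, ← futureSum_add, lawDist_eq]
  refine futureSum_mono π fun s hs => ?_
  have hc := trajPred_stateVec (hP 0 (by omega)) (τ := []) rfl (s := s) (by omega)
  rw [List.nil_append] at hc
  rw [← hc]
  have hd : stateVec H dummy f [] =
      (stateVec H dummy f [] - stateVec H dummy κ []) + stateVec H dummy κ [] := by simp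
  conv_lhs => rw [hd, trajPred_add, add_sub_assoc]
  exact abs_add_le _ _

end Telescoping

/-! ### Exploration policies and state errors -/

section Exploration

variable [Fintype O]

/-- After the horizon all systems generate the dummy observation. -/
theorem predVec_eq_of_horizon_le {H : ℕ} (dummy : O) (f κ : Dynamics O A) {τ : History O A}
    (h : H ≤ τ.length) : predVec H dummy f τ = predVec H dummy κ τ := by
  funext t
  obtain ⟨l, o⟩ := t
  induction l generalizing τ with
  | nil => simp [predVec_nil, obsProb, h.not_gt]
  | cons y l ih =>
    have hc : ((y :: l, o) : Test O A) = consTest y (l, o) := rfl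
    rw [hc, predVec_cons, predVec_cons, ih (by simp; omega)]
    simp [obsProb, h.not_gt]

variable [Fintype A]

/-- Summing over the later steps of a trajectory cannot increase the `ℓ¹` distance of two systems,
whatever policy `ξ` is followed. -/
theorem sum_abs_seqProb_snoc_le (f κ : Dynamics O A) (ξ : Policy O A) (m : ℕ) (τ : History O A) :
    ∑ o, |seqProb f [] τ * f τ o - seqProb κ [] τ * κ τ o| ≤
      futureSum ξ (m + 1) τ fun s => |seqProb f [] (τ ++ s) - seqProb κ [] (τ ++ s)| := by
  induction m generalizing τ with
  | zero =>
    simp only [futureSum, seqProb_snoc]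
    rw [Fintype.sum_prod_type]
    have h : ∀ o, ∑ a, ξ τ o a = 1 := fun o => (ξ τ o).2.2
    simp [← Finset.sum_mul, h]
  | succ m ih =>
    refine le_trans ?_ (Finset.sum_le_sum fun y _ => mul_le_mul_of_nonneg_left
      (b := |seqProb f [] (τ ++ [y]) - seqProb κ [] (τ ++ [y])|) ?_ ((ξ τ y.1).2.1 _))
    · simp only [seqProb_snoc]
      rw [Fintype.sum_prod_type]
      have h : ∀ o, ∑ a, ξ τ o a = 1 := fun o => (ξ τ o).2.2
      simp [← Finset.sum_mul]
    · have h1 := ih (τ ++ [y])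
      simp only [List.append_assoc, List.singleton_append] at h1
      refine le_trans ?_ h1
      refine le_trans (le_of_eq ?_) (Finset.abs_sum_le_sum_abs _ _)
      have hf : ∑ o, f (τ ++ [y]) o = 1 := (f _).2.2
      have hκ : ∑ o, κ (τ ++ [y]) o = 1 := (κ _).2.2
      rw [Finset.sum_sub_distrib, ← Finset.mul_sum, ← Finset.mul_sum, hf, hκ, mul_one, mul_one]

/-- A policy that executes `w` after `τ` distinguishes two systems at least as well as the tests
with the action sequence `w`. -/
theorem testSum_abs_stateVec_sub_le {H : ℕ} (dummy : O) (f κ : Dynamics O A) (ξ : Policy O A)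
    (m : ℕ) (w : List A) (τ : History O A) (hτ : τ.length + m = H)
    (hξ : ∀ (s : List (O × A)) (a : A), w[s.length]? = some a → ∀ o, ξ (τ ++ s) o a = 1) :
    testSum w (fun t => |stateVec H dummy f τ t - stateVec H dummy κ τ t|) ≤
      futureSum ξ m τ fun s => |seqProb f [] (τ ++ s) - seqProb κ [] (τ ++ s)| := by
  induction m generalizing w τ with
  | zero =>
    have h1 : ∀ t, |stateVec H dummy f τ t - stateVec H dummy κ τ t| =
        |seqProb f [] τ - seqProb κ [] τ| * predVec H dummy κ τ t := by
      intro t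
      rw [stateVec, stateVec, predVec_eq_of_horizon_le dummy f κ (by omega)]
      simp only [Pi.smul_apply, smul_eq_mul]
      rw [← sub_mul, abs_mul, abs_of_nonneg (predVec_nonneg _ _ _ _ _)]
    rw [testSum_congr h1, testSum_mul_left, testSum_predVec]
    simp [futureSum]
  | succ m ih =>
    have hl : τ.length < H := by omega
    cases w with
    | nil =>
      refine le_trans (le_of_eq ?_) (sum_abs_seqProb_snoc_le f κ ξ m τ)
      simp [testSum, stateVec, predVec_nil, obsProb, hl]
    | cons a w =>
      rw [futureSum, Fintype.sum_prod_type]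
      refine Finset.sum_le_sum fun o _ => ?_
      have h1 := ih w (τ ++ [(o, a)]) (by simp; omega) fun s b hb o' => by
        simpa using hξ ((o, a) :: s) b (by simpa using hb) o'
      simp only [← tailVec_stateVec dummy _ hl, List.append_assoc, List.singleton_append] at h1
      refine le_trans h1 ?_
      have h2 : ξ τ o a = 1 := by simpa using hξ [] a (by simp) o
      have h3 := Finset.single_le_sum (f := fun b => ξ τ o b * futureSum ξ m (τ ++ [(o, b)])
        fun s => |seqProb f [] (τ ++ (o, b) :: s) - seqProb κ [] (τ ++ (o, b) :: s)|)
        (fun b _ => mul_nonneg ((ξ τ o).2.1 b) (futureSum_nonneg _ fun s _ => abs_nonneg _))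
        (Finset.mem_univ a)
      simpa [h2] using h3

/-- The error of the model `f` for the states after `n` steps: at `n = 0` the distance of the
initial states, otherwise the sum over the histories of length `n`, where the first `n - 1` actions
are weighted with `π` and the last action is not weighted. -/
def stateErr (H : ℕ) (dummy : O) (U : ℕ → Finset (Test O A)) (f κ : Dynamics O A)
    (π : Policy O A) : ℕ → ℝ
  | 0 => testNorm (U 1) (stateVec H dummy f [] - stateVec H dummy κ [])
  | m + 1 => futureSum π m [] fun s => ∑ y : O × A,
      testNorm (U (m + 2)) (stateVec H dummy f (s ++ [y]) - stateVec H dummy κ (s ++ [y]))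

theorem stateErr_nonneg (H : ℕ) (dummy : O) (U : ℕ → Finset (Test O A)) (f κ : Dynamics O A)
    (π : Policy O A) (n : ℕ) : 0 ≤ stateErr H dummy U f κ π n := by
  cases n with
  | zero => exact testNorm_nonneg _ _
  | succ m => exact futureSum_nonneg _ fun s _ => Finset.sum_nonneg fun _ _ => testNorm_nonneg _ _

theorem futureSum_testNorm_le_stateErr (H : ℕ) (dummy : O) (U : ℕ → Finset (Test O A))
    (f κ : Dynamics O A) (π : Policy O A) (n : ℕ) :
    (futureSum π n [] fun s =>
      testNorm (U (n + 1)) (stateVec H dummy f s - stateVec H dummy κ s)) ≤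
      stateErr H dummy U f κ π n := by
  cases n with
  | zero => exact le_rfl
  | succ m =>
    rw [futureSum_snoc, stateErr]
    refine futureSum_mono π fun s _ => Finset.sum_le_sum fun y _ => ?_
    exact mul_le_of_le_one_left (testNorm_nonneg _ _) (simplex_le_one _ _)

/-- The update errors of a model are controlled by its state errors. -/
theorem futureSum_stepErr_le {H : ℕ} {dummy : O} {U : ℕ → Finset (Test O A)} {α : ℝ}
    {f κ : Dynamics O A} {n : ℕ} {P : (Test O A → ℝ) →ₗ[ℝ] (Test O A → ℝ)}
    (hP : IsPredictor H dummy U α f n P) (hα : 0 < α) (hn : n + 1 < H) (π : Policy O A) :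
    (futureSum π n [] fun s => stepErr U n P (stateVec H dummy κ s)) ≤
      Fintype.card A * (numActionSeqs H U / α) * stateErr H dummy U f κ π n +
        stateErr H dummy U f κ π (n + 1) := by
  have h1 : ∀ s : List (O × A), s.length = n → stepErr U n P (stateVec H dummy κ s) ≤
      Fintype.card A * (numActionSeqs H U / α) *
        testNorm (U (n + 1)) (stateVec H dummy f s - stateVec H dummy κ s) +
      ∑ y : O × A,
        testNorm (U (n + 2)) (stateVec H dummy f (s ++ [y]) - stateVec H dummy κ (s ++ [y])) := by
    intro s hs
    set x := stateVec H dummy f s - stateVec H dummy κ s with hx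
    refine le_trans ?_ (add_le_add_left (hP.sum_testNorm_tailVec_le hn x) _)
    rw [← Finset.sum_add_distrib]
    refine Finset.sum_le_sum fun y _ => ?_
    rw [← tailVec_stateVec dummy f (by omega), ← tailVec_stateVec dummy κ (by omega)]
    unfold testNorm
    rw [← Finset.sum_add_distrib]
    refine Finset.sum_le_sum fun t _ => ?_
    have h2 : P (stateVec H dummy κ s) = stateVec H dummy f s - P x := by
      rw [hx, map_sub, hP.apply_stateVec hs]; simp
    rw [h2]
    simp only [tailVec, Pi.sub_apply]
    have h3 : stateVec H dummy f s (consTest y t) - P x (consTest y t) -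
        stateVec H dummy κ s (consTest y t) = -(P x (consTest y t)) +
        (stateVec H dummy f s (consTest y t) - stateVec H dummy κ s (consTest y t)) := by ring
    rw [h3]
    refine (abs_add_le _ _).trans ?_
    rw [abs_neg]
  refine (futureSum_mono π h1).trans ?_
  rw [futureSum_add, futureSum_mul_left]
  have h2 : (0 : ℝ) ≤ Fintype.card A * (numActionSeqs H U / α) := by positivity
  exact add_le_add_left (mul_le_mul_of_nonneg_left
    (futureSum_testNorm_le_stateErr H dummy U f κ π n) h2) _

/-- The exploration policies detect the state errors of a model. -/
theorem stateErr_le [Nonempty A] {H : ℕ} (dummy : O) (U : ℕ → Finset (Test O A))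
    (f κ : Dynamics O A) (π : Policy O A) {n : ℕ} (hn : n < H) :
    stateErr H dummy U f κ π n ≤ Fintype.card A *
      ∑ w ∈ actionSeqs U (n + 1), lawDist H f κ (explorePolicy π n w) := by
  have hA : (1 : ℝ) ≤ Fintype.card A := by exact_mod_cast Fintype.card_pos
  cases n with
  | zero =>
    refine le_trans ?_ (le_mul_of_one_le_left
      (Finset.sum_nonneg fun w _ => lawDist_nonneg _ _ _ _) hA)
    refine (sum_tests_le U 1 fun t => abs_nonneg _).trans (Finset.sum_le_sum fun w _ => ?_)
    rw [lawDist_eq]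
    refine testSum_abs_stateVec_sub_le dummy f κ (explorePolicy π 0 w) H w [] (by simp) ?_
    intro s a ha o
    simp [explorePolicy, ha, stdSimplex.vertex]
  | succ m =>
    obtain ⟨r, rfl⟩ : ∃ r, H = m + (r + 1) := ⟨H - m - 1, by omega⟩
    have hw : ∀ w, futureSum π m [] (fun s => ∑ y : O × A, (Fintype.card A : ℝ)⁻¹ *
        testSum w fun t => |stateVec (m + (r + 1)) dummy f (s ++ [y]) t -
          stateVec (m + (r + 1)) dummy κ (s ++ [y]) t|) ≤
        lawDist (m + (r + 1)) f κ (explorePolicy π (m + 1) w) := by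
      intro w
      set ξ := explorePolicy π (m + 1) w with hξ
      rw [lawDist_eq, futureSum_split]
      have h1 : futureSum π m [] = futureSum ξ m [] := by
        funext F
        refine futureSum_policy_congr (fun s hs => ?_) F
        funext o
        simp [hξ, explorePolicy, hs]
      rw [h1]
      refine futureSum_mono ξ fun s hs => ?_
      rw [futureSum]
      refine Finset.sum_le_sum fun y _ => ?_
      have h2 : ξ ([] ++ s) y.1 y.2 = (Fintype.card A : ℝ)⁻¹ := by
        simp only [hξ, explorePolicy, List.nil_append, hs, lt_irrefl, if_false, if_true]
        rfl
      rw [h2]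
      refine mul_le_mul_of_nonneg_left ?_ (by positivity)
      have h3 := testSum_abs_stateVec_sub_le (H := m + (r + 1)) dummy f κ ξ r w (s ++ [y])
        (by simp; omega) fun s' a ha o => by
          have h4 : (s ++ [y] ++ s').length = m + 1 + s'.length := by simp; omega
          have h5 : m + 1 + s'.length - (m + 1) = s'.length := by omega
          simp only [hξ, explorePolicy, h4]
          rw [if_neg (by omega), if_neg (by omega)]
          simp [h5, ha, stdSimplex.vertex]
      simpa using h3
    refine le_trans ?_ (mul_le_mul_of_nonneg_left (Finset.sum_le_sum fun w _ => hw w)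
      (by positivity))
    rw [← futureSum_finset_sum, ← futureSum_mul_left, stateErr]
    refine futureSum_mono π fun s _ => ?_
    rw [Finset.sum_comm, Finset.mul_sum]
    refine Finset.sum_le_sum fun y _ => ?_
    rw [← Finset.mul_sum, ← mul_assoc, mul_inv_cancel₀ (by positivity), one_mul]
    exact sum_tests_le U (m + 2) fun t => abs_nonneg _

end Exploration

/-! ### The elliptical potential for families of vectors -/

section Potential

open Matrix in
open scoped MatrixOrder in
/-- Dual factors `Y` of `V` and `C` of `V⁻¹`. They turn the norms of `V` and `V⁻¹` into Euclidean
ones and preserve the pairing. -/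
theorem exists_dual_factors {d : ℕ} {V : Matrix (Fin d) (Fin d) ℝ} (hV : V.PosDef) :
    ∃ Y C : Matrix (Fin d) (Fin d) ℝ, Yᵀ * Y = V ∧ Cᵀ * C = V⁻¹ ∧ Yᵀ * C = 1 := by
  obtain ⟨Y, hY, rfl⟩ := CStarAlgebra.isStrictlyPositive_iff_eq_star_mul_self.mp
    hV.isStrictlyPositive
  have hs : star Y = Yᵀ := by
    rw [star_eq_conjTranspose, conjTranspose_eq_transpose_of_trivial]
  have hu : IsUnit (Yᵀ).det := by
    rw [det_transpose]; exact (Matrix.isUnit_iff_isUnit_det Y).1 hY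
  refine ⟨Y, (Yᵀ)⁻¹, by rw [hs], ?_, mul_nonsing_inv _ hu⟩
  rw [hs, Matrix.mul_inv_rev, transpose_nonsing_inv, transpose_transpose]

theorem dotProduct_sq_le {d : ℕ} (x y : Fin d → ℝ) : (x ⬝ᵥ y) ^ 2 ≤ (x ⬝ᵥ x) * (y ⬝ᵥ y) := by
  have := Finset.sum_mul_sq_le_sq_mul_sq Finset.univ x y
  simpa [dotProduct, sq] using this

theorem dotProduct_self_nonneg' {d : ℕ} (x : Fin d → ℝ) : 0 ≤ x ⬝ᵥ x :=
  Finset.sum_nonneg fun i _ => mul_self_nonneg (x i)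

theorem mulVec_dotProduct_mulVec {d : ℕ} (M N : Matrix (Fin d) (Fin d) ℝ) (x y : Fin d → ℝ) :
    (M *ᵥ x) ⬝ᵥ (N *ᵥ y) = x ⬝ᵥ ((Mᵀ * N) *ᵥ y) := by
  rw [← Matrix.mulVec_mulVec, Matrix.dotProduct_mulVec x, Matrix.vecMul_transpose]

theorem dotProduct_finset_sum {d : ℕ} {ι : Type*} (I : Finset ι) (w : Fin d → ℝ)
    (x : ι → Fin d → ℝ) : w ⬝ᵥ (∑ i ∈ I, x i) = ∑ i ∈ I, w ⬝ᵥ x i := by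
  classical
  induction I using Finset.induction_on with
  | empty => simp
  | insert i I hi ih => simp [Finset.sum_insert hi, dotProduct_add, ih]

/-- Among the combinations `z = ∑ ± x i` one can be chosen whose norm with respect to `V⁻¹`
controls, up to the factor `d`, the sum of all `|w i ⬝ᵥ x i|` with `w i` in a ball of `V`: take `z`
with the largest norm, and compare coordinatewise after a change of basis that turns `V` into the
identity. -/
theorem exists_sign_combination {d : ℕ} {ι : Type*} [Fintype ι] (x : ι → Fin d → ℝ)
    {V : Matrix (Fin d) (Fin d) ℝ} (hV : V.PosDef) :
    ∃ z : Fin d → ℝ, (∃ s : ι → ℝ, (∀ i, |s i| = 1) ∧ z = ∑ i, s i • x i) ∧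
      ∀ (w : ι → Fin d → ℝ) (R : ℝ), 0 ≤ R → (∀ i, w i ⬝ᵥ (V *ᵥ w i) ≤ R ^ 2) →
        ∑ i, |w i ⬝ᵥ x i| ≤ R * (d * √(z ⬝ᵥ (V⁻¹ *ᵥ z))) := by
  classical
  let sg : Bool → ℝ := fun b => if b then 1 else -1
  have hsg : ∀ b, |sg b| = 1 := by intro b; cases b <;> simp [sg]
  let zf : (ι → Bool) → Fin d → ℝ := fun b => ∑ i, sg (b i) • x i
  obtain ⟨b, hb⟩ := Finite.exists_max fun b => zf b ⬝ᵥ (V⁻¹ *ᵥ zf b)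
  refine ⟨zf b, ⟨fun i => sg (b i), fun i => hsg _, rfl⟩, fun w R hR hw => ?_⟩
  obtain ⟨Y, C, hY, hC, hYC⟩ := exists_dual_factors hV
  have hnorm : ∀ v, (C *ᵥ v) ⬝ᵥ (C *ᵥ v) = v ⬝ᵥ (V⁻¹ *ᵥ v) := fun v => by
    rw [mulVec_dotProduct_mulVec, hC]
  have h1 : ∀ i, |w i ⬝ᵥ x i| ≤ R * ∑ c, |(C *ᵥ x i) c| := by
    intro i
    have h2 : w i ⬝ᵥ x i = (Y *ᵥ w i) ⬝ᵥ (C *ᵥ x i) := by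
      rw [mulVec_dotProduct_mulVec, hYC, Matrix.one_mulVec]
    have h3 : (Y *ᵥ w i) ⬝ᵥ (Y *ᵥ w i) ≤ R ^ 2 := by
      rw [mulVec_dotProduct_mulVec, hY]; exact hw i
    have h4 : ∀ c, |(Y *ᵥ w i) c| ≤ R := by
      intro c
      refine abs_le_of_sq_le_sq ?_ hR
      refine le_trans ?_ h3
      have := Finset.single_le_sum (f := fun c => (Y *ᵥ w i) c * (Y *ᵥ w i) c)
        (fun c _ => mul_self_nonneg _) (Finset.mem_univ c)
      simpa [sq, dotProduct] using this
    rw [h2, Finset.mul_sum]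
    refine (Finset.abs_sum_le_sum_abs _ _).trans (Finset.sum_le_sum fun c _ => ?_)
    rw [abs_mul]
    exact mul_le_mul_of_nonneg_right (h4 c) (abs_nonneg _)
  refine (Finset.sum_le_sum fun i _ => h1 i).trans ?_
  rw [← Finset.mul_sum, Finset.sum_comm]
  refine mul_le_mul_of_nonneg_left ?_ hR
  have h5 : ∀ c, ∑ i, |(C *ᵥ x i) c| ≤ √(zf b ⬝ᵥ (V⁻¹ *ᵥ zf b)) := by
    intro c
    let b' : ι → Bool := fun i => decide (0 ≤ (C *ᵥ x i) c)
    have h6 : ∑ i, |(C *ᵥ x i) c| = (C *ᵥ zf b') c := by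
      rw [Matrix.mulVec_sum, Finset.sum_apply]
      refine Finset.sum_congr rfl fun i _ => ?_
      rw [Matrix.mulVec_smul, Pi.smul_apply, smul_eq_mul]
      by_cases h : 0 ≤ (C *ᵥ x i) c
      · simp [b', sg, h, abs_of_nonneg h]
      · simp [b', sg, h, abs_of_neg (not_le.1 h)]
    rw [h6]
    refine Real.le_sqrt_of_sq_le (le_trans ?_ (hb b'))
    rw [← hnorm]
    have := Finset.single_le_sum (f := fun e => (C *ᵥ zf b') e * (C *ᵥ zf b') e)
      (fun e _ => mul_self_nonneg _) (Finset.mem_univ c)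
    simpa [sq, dotProduct] using this
  refine (Finset.sum_le_sum fun c _ => h5 c).trans_eq ?_
  simp

/-- The matrix `l • 1 + ∑ i < k, z i (z i)ᵀ`. -/
def gramMatrix {d : ℕ} (l : ℝ) (z : ℕ → Fin d → ℝ) : ℕ → Matrix (Fin d) (Fin d) ℝ
  | 0 => l • 1
  | k + 1 => gramMatrix l z k + Matrix.vecMulVec (z k) (z k)

section Gram

variable {d : ℕ} {l : ℝ} (z : ℕ → Fin d → ℝ)

theorem gramMatrix_posDef (hl : 0 < l) (k : ℕ) : (gramMatrix l z k).PosDef := by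
  induction k with
  | zero => exact Matrix.PosDef.one.smul hl
  | succ k ih =>
    refine ih.add_posSemidef ?_
    simpa using Matrix.posSemidef_vecMulVec_self_star (z k)

theorem dotProduct_gramMatrix (k : ℕ) (w : Fin d → ℝ) :
    w ⬝ᵥ (gramMatrix l z k *ᵥ w) = l * (w ⬝ᵥ w) + ∑ i ∈ Finset.range k, (w ⬝ᵥ z i) ^ 2 := by
  induction k with
  | zero => simp [gramMatrix, Matrix.smul_mulVec, dotProduct_smul]
  | succ k ih =>
    rw [gramMatrix, Matrix.add_mulVec, dotProduct_add, ih, Finset.sum_range_succ,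
      Matrix.vecMulVec_mulVec]
    simp [dotProduct_comm (z k) w]
    ring

/-- The matrix determinant lemma. -/
theorem det_gramMatrix_succ (hl : 0 < l) (k : ℕ) :
    (gramMatrix l z (k + 1)).det =
      (gramMatrix l z k).det * (1 + z k ⬝ᵥ ((gramMatrix l z k)⁻¹ *ᵥ z k)) := by
  have hu : IsUnit (gramMatrix l z k).det := (gramMatrix_posDef z hl k).det_pos.ne'.isUnit
  have h := Matrix.det_add_replicateCol_mul_replicateRow (ι := Unit) hu (z k) (z k)
  rw [← Matrix.vecMulVec_eq] at h
  rw [gramMatrix, h]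
  congr 1
  rw [Matrix.det_unique]
  simp [Matrix.mul_assoc, Matrix.mul_apply, Matrix.replicateRow, Matrix.replicateCol, dotProduct,
    Matrix.mulVec]

theorem det_gramMatrix_le (hl : 0 < l) (hz : ∀ k, z k ⬝ᵥ z k ≤ l) (k : ℕ) :
    (gramMatrix l z k).det ≤ (l * (1 + k)) ^ d := by
  have hp := gramMatrix_posDef z hl k
  rw [hp.isHermitian.det_eq_prod_eigenvalues]
  have h : ∀ i, hp.isHermitian.eigenvalues i ≤ l * (1 + k) := by
    intro i
    rw [hp.isHermitian.eigenvalues_eq]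
    set v : Fin d → ℝ := ⇑(hp.isHermitian.eigenvectorBasis i) with hv
    have hv1 : v ⬝ᵥ v = 1 := by
      have h1 := hp.isHermitian.eigenvectorBasis.orthonormal.1 i
      have h2 := EuclideanSpace.real_norm_sq_eq (hp.isHermitian.eigenvectorBasis i)
      rw [h1] at h2
      simp only [hv, dotProduct, ← sq]
      rw [← h2]; norm_num
    have h3 : star v = v := by simp
    rw [h3, dotProduct_gramMatrix]
    simp only [RCLike.re_to_real]
    have h4 : ∑ i ∈ Finset.range k, (v ⬝ᵥ z i) ^ 2 ≤ ∑ i ∈ Finset.range k, l := by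
      refine Finset.sum_le_sum fun i _ => ?_
      have := dotProduct_sq_le v (z i)
      rw [hv1, one_mul] at this
      exact this.trans (hz i)
    rw [hv1]
    simp only [Finset.sum_const, Finset.card_range, nsmul_eq_mul] at h4
    linarith
  refine (Finset.prod_le_prod (fun i _ => by simpa using hp.eigenvalues_pos i |>.le)
    fun i _ => by simpa using h i).trans_eq ?_
  simp

theorem inv_quadratic_nonneg (hl : 0 < l) (k : ℕ) (v : Fin d → ℝ) :
    0 ≤ v ⬝ᵥ ((gramMatrix l z k)⁻¹ *ᵥ v) := by
  simpa using (gramMatrix_posDef z hl k).inv.posSemidef.dotProduct_mulVec_nonneg v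

theorem inv_quadratic_le_one (hl : 0 < l) (k : ℕ) {v : Fin d → ℝ} (hv : v ⬝ᵥ v ≤ l) :
    v ⬝ᵥ ((gramMatrix l z k)⁻¹ *ᵥ v) ≤ 1 := by
  set w := (gramMatrix l z k)⁻¹ *ᵥ v with hw
  have hu : IsUnit (gramMatrix l z k).det := (gramMatrix_posDef z hl k).det_pos.ne'.isUnit
  have h1 : gramMatrix l z k *ᵥ w = v := by
    rw [hw, Matrix.mulVec_mulVec, Matrix.mul_nonsing_inv _ hu, Matrix.one_mulVec]
  have h2 : v ⬝ᵥ w = l * (w ⬝ᵥ w) + ∑ i ∈ Finset.range k, (w ⬝ᵥ z i) ^ 2 := by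
    rw [← dotProduct_gramMatrix, h1, dotProduct_comm]
  have h3 : l * (w ⬝ᵥ w) ≤ v ⬝ᵥ w := by
    rw [h2]
    exact le_add_of_nonneg_right (Finset.sum_nonneg fun i _ => sq_nonneg _)
  have h4 := dotProduct_sq_le v w
  have h5 : (v ⬝ᵥ w) ^ 2 ≤ v ⬝ᵥ w := by
    refine h4.trans (le_trans ?_ h3)
    exact mul_le_mul_of_nonneg_right hv (dotProduct_self_nonneg' w)
  nlinarith

/-- The elliptical potential bound: the squared norms add up to at most `2 d log (1 + K)`, since
each of them is at most twice an increment of the logarithm of the determinant. -/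
theorem sum_inv_quadratic_le (hl : 0 < l) (hz : ∀ k, z k ⬝ᵥ z k ≤ l) (K : ℕ) :
    ∑ k ∈ Finset.range K, z k ⬝ᵥ ((gramMatrix l z k)⁻¹ *ᵥ z k) ≤ 2 * (d * Real.log (1 + K)) := by
  have h1 : ∀ k, z k ⬝ᵥ ((gramMatrix l z k)⁻¹ *ᵥ z k) ≤
      2 * (Real.log (gramMatrix l z (k + 1)).det - Real.log (gramMatrix l z k).det) := by
    intro k
    set a := z k ⬝ᵥ ((gramMatrix l z k)⁻¹ *ᵥ z k) with ha
    have ha0 : 0 ≤ a := inv_quadratic_nonneg z hl k (z k)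
    have ha1 : a ≤ 1 := inv_quadratic_le_one z hl k (hz k)
    have hd := (gramMatrix_posDef z hl k).det_pos
    rw [det_gramMatrix_succ z hl, Real.log_mul hd.ne' (by positivity), ← ha]
    have h2 := Real.one_sub_inv_le_log_of_pos (show 0 < 1 + a by linarith)
    have h3 : a / 2 ≤ 1 - (1 + a)⁻¹ := by
      have : 1 - (1 + a)⁻¹ = a / (1 + a) := by field_simp; ring
      rw [this]
      gcongr
      linarith
    linarith
  refine (Finset.sum_le_sum fun k _ => h1 k).trans ?_
  rw [← Finset.mul_sum, Finset.sum_range_sub fun k => Real.log (gramMatrix l z k).det]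
  have h4 : Real.log (gramMatrix l z K).det ≤ d * (Real.log l + Real.log (1 + K)) := by
    have hk : (0 : ℝ) < 1 + K := by positivity
    rw [← Real.log_mul hl.ne' hk.ne', ← Real.log_pow]
    exact Real.log_le_log (gramMatrix_posDef z hl K).det_pos (det_gramMatrix_le z hl hz K)
  have h5 : Real.log (gramMatrix l z 0).det = d * Real.log l := by
    simp [gramMatrix]
  rw [h5]
  linarith

end Gram

/-- If each `u k` is nearly orthogonal, in the sum of absolute inner products, to the families
`x i` with `i < k`, then it cannot be far from orthogonal to `x k` for many `k`. -/
theorem sum_abs_dotProduct_le {ι J : Type*} [Fintype ι] [Fintype J] {d K : ℕ}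
    (x : ℕ → ι → Fin d → ℝ) (u : ℕ → J → Fin d → ℝ) {η ρ B : ℝ} (hη : 0 < η)
    (hx : ∀ k, ∑ i, ∑ c, |x k i c| ≤ η) (hu : ∀ k c, ∑ j, |u k j c| ≤ ρ)
    (hB : ∀ k < K, ∑ i ∈ Finset.range k, (∑ t, ∑ j, |u k j ⬝ᵥ x i t|) ^ 2 ≤ B) :
    ∑ k ∈ Finset.range K, ∑ t, ∑ j, |u k j ⬝ᵥ x k t| ≤
      √(d * (η * ρ) ^ 2 + B) * (d * √(K * (2 * (d * Real.log (1 + K))))) := by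
  classical
  have hl : 0 < η ^ 2 := by positivity
  -- `z k` is chosen for the family `x k` and the matrix of the earlier choices
  have hex : ∀ (k : ℕ) (V : Matrix (Fin d) (Fin d) ℝ), ∃ z : Fin d → ℝ,
      (∃ s : ι → ℝ, (∀ i, |s i| = 1) ∧ z = ∑ i, s i • x k i) ∧
      (V.PosDef → ∀ (w : ι → Fin d → ℝ) (R : ℝ), 0 ≤ R → (∀ i, w i ⬝ᵥ (V *ᵥ w i) ≤ R ^ 2) →
        ∑ i, |w i ⬝ᵥ x k i| ≤ R * (d * √(z ⬝ᵥ (V⁻¹ *ᵥ z)))) := by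
    intro k V
    by_cases hV : V.PosDef
    · obtain ⟨z, h1, h2⟩ := exists_sign_combination (x k) hV
      exact ⟨z, h1, fun _ => h2⟩
    · exact ⟨_, ⟨fun _ => 1, fun _ => abs_one, rfl⟩, fun h => absurd h hV⟩
  choose Z hZ1 hZ2 using hex
  let V : ℕ → Matrix (Fin d) (Fin d) ℝ := fun k =>
    Nat.rec (η ^ 2 • 1) (fun k M => M + Matrix.vecMulVec (Z k M) (Z k M)) k
  let z : ℕ → Fin d → ℝ := fun k => Z k (V k)
  have hV : ∀ k, V k = gramMatrix (η ^ 2) z k := by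
    intro k
    induction k with
    | zero => rfl
    | succ k ih =>
      rw [gramMatrix, ← ih]
  have hz : ∀ k, z k ⬝ᵥ z k ≤ η ^ 2 := by
    intro k
    obtain ⟨s, hs, hzk⟩ := hZ1 k (V k)
    have h1 : ∑ c, |z k c| ≤ η := by
      refine le_trans ?_ (hx k)
      rw [Finset.sum_comm]
      refine Finset.sum_le_sum fun c _ => ?_
      have : z k c = ∑ i, s i * x k i c := by
        change Z k (V k) c = _
        rw [hzk]; simp
      rw [this]
      refine (Finset.abs_sum_le_sum_abs _ _).trans_eq (Finset.sum_congr rfl fun i _ => ?_)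
      rw [abs_mul, hs, one_mul]
    have h2 : z k ⬝ᵥ z k ≤ (∑ c, |z k c|) ^ 2 := by
      have := Finset.sum_sq_le_sq_sum_of_nonneg (s := Finset.univ) (f := fun c => |z k c|)
        fun c _ => abs_nonneg _
      simpa [dotProduct, sq] using this
    exact h2.trans (pow_le_pow_left₀ (Finset.sum_nonneg fun _ _ => abs_nonneg _) h1 2)
  have hzx : ∀ (i : ℕ) (v : Fin d → ℝ), |v ⬝ᵥ z i| ≤ ∑ t, |v ⬝ᵥ x i t| := by
    intro i v
    obtain ⟨s, hs, hzk⟩ := hZ1 i (V i)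
    change |v ⬝ᵥ Z i (V i)| ≤ _
    rw [hzk, dotProduct_finset_sum]
    refine (Finset.abs_sum_le_sum_abs _ _).trans_eq (Finset.sum_congr rfl fun t _ => ?_)
    rw [dotProduct_smul, smul_eq_mul, abs_mul, hs, one_mul]
  set R := √(d * (η * ρ) ^ 2 + B) with hR
  have hstep : ∀ k < K, ∑ t, ∑ j, |u k j ⬝ᵥ x k t| ≤
      R * (d * √(z k ⬝ᵥ ((gramMatrix (η ^ 2) z k)⁻¹ *ᵥ z k))) := by
    intro k hk
    -- the inner sum over `j` is a single inner product, with signs that depend on `t`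
    let sg : ι → J → ℝ := fun t j => if 0 ≤ u k j ⬝ᵥ x k t then 1 else -1
    have hsg : ∀ t j, |sg t j| = 1 := by intro t j; simp only [sg]; split_ifs <;> simp
    let w : ι → Fin d → ℝ := fun t => ∑ j, sg t j • u k j
    have hwv : ∀ t v, w t ⬝ᵥ v = ∑ j, sg t j * (u k j ⬝ᵥ v) := by
      intro t v
      rw [dotProduct_comm, dotProduct_finset_sum]
      refine Finset.sum_congr rfl fun j _ => ?_
      rw [dotProduct_smul, dotProduct_comm v, smul_eq_mul]
    have hw : ∀ t, ∑ j, |u k j ⬝ᵥ x k t| = |w t ⬝ᵥ x k t| := by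
      intro t
      have h1 : w t ⬝ᵥ x k t = ∑ j, |u k j ⬝ᵥ x k t| := by
        rw [hwv]
        refine Finset.sum_congr rfl fun j _ => ?_
        by_cases h : 0 ≤ u k j ⬝ᵥ x k t
        · simp [sg, h, abs_of_nonneg h]
        · simp [sg, h, abs_of_neg (not_le.1 h)]
      rw [h1, abs_of_nonneg (Finset.sum_nonneg fun _ _ => abs_nonneg _)]
    have hwc : ∀ t c, |w t c| ≤ ρ := by
      intro t c
      refine le_trans ?_ (hu k c)
      simp only [w, Finset.sum_apply, Pi.smul_apply, smul_eq_mul]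
      refine (Finset.abs_sum_le_sum_abs _ _).trans_eq (Finset.sum_congr rfl fun j _ => ?_)
      rw [abs_mul, hsg, one_mul]
    have hww : ∀ t, w t ⬝ᵥ w t ≤ d * ρ ^ 2 := by
      intro t
      have : ∀ c ∈ Finset.univ, w t c * w t c ≤ ρ ^ 2 := by
        intro c _
        rw [← sq, ← sq_abs]
        exact pow_le_pow_left₀ (abs_nonneg _) (hwc t c) 2
      simpa [dotProduct] using Finset.sum_le_sum this
    simp only [hw, ← hV]
    refine hZ2 k (V k) ?_ w R (Real.sqrt_nonneg _) fun t => ?_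
    · rw [hV]; exact gramMatrix_posDef z hl k
    · have h2 : ∑ i ∈ Finset.range k, (w t ⬝ᵥ z i) ^ 2 ≤ B := by
        refine (Finset.sum_le_sum fun i _ => ?_).trans (hB k hk)
        rw [← sq_abs]
        refine pow_le_pow_left₀ (abs_nonneg _) ?_ 2
        rw [hwv]
        refine (Finset.abs_sum_le_sum_abs _ _).trans ?_
        rw [Finset.sum_comm]
        refine Finset.sum_le_sum fun j _ => ?_
        rw [abs_mul, hsg, one_mul]
        exact hzx i _
      have hB0 : 0 ≤ B := le_trans (Finset.sum_nonneg fun i _ => sq_nonneg _) h2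
      rw [hR, Real.sq_sqrt (by positivity), hV, dotProduct_gramMatrix]
      refine add_le_add ?_ h2
      calc η ^ 2 * (w t ⬝ᵥ w t) ≤ η ^ 2 * (d * ρ ^ 2) :=
            mul_le_mul_of_nonneg_left (hww t) hl.le
        _ = d * (η * ρ) ^ 2 := by ring
  refine (Finset.sum_le_sum fun k hk => hstep k (Finset.mem_range.1 hk)).trans ?_
  rw [← Finset.mul_sum, ← Finset.mul_sum]
  refine mul_le_mul_of_nonneg_left (mul_le_mul_of_nonneg_left ?_ (Nat.cast_nonneg d))
    (Real.sqrt_nonneg _)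
  refine Real.le_sqrt_of_sq_le ?_
  refine (sq_sum_le_card_mul_sum_sq).trans ?_
  rw [Finset.card_range]
  refine mul_le_mul_of_nonneg_left ?_ (Nat.cast_nonneg K)
  refine le_trans (le_of_eq (Finset.sum_congr rfl fun k _ => ?_)) (sum_inv_quadratic_le z hl hz K)
  exact Real.sq_sqrt (inv_quadratic_nonneg z hl k _)

end Potential

/-! ### Expectations along a run of the algorithm -/

section Expectation

open scoped ENNReal

variable {X Y : Type*}

/-- The expectation of an extended nonnegative function. -/
def pmfExp (p : PMF X) (g : X → ℝ≥0∞) : ℝ≥0∞ := ∑' a, p a * g a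

theorem pmfExp_const (p : PMF X) (c : ℝ≥0∞) : pmfExp p (fun _ => c) = c := by
  rw [pmfExp, ENNReal.tsum_mul_right, p.tsum_coe, one_mul]

theorem pmfExp_mono {p : PMF X} {g g' : X → ℝ≥0∞} (h : ∀ a ∈ p.support, g a ≤ g' a) :
    pmfExp p g ≤ pmfExp p g' := by
  refine ENNReal.tsum_le_tsum fun a => ?_
  by_cases ha : p a = 0
  · simp [ha]
  · exact mul_le_mul_right (h a ((p.mem_support_iff a).2 ha)) _

theorem pmfExp_pure (a : X) (g : X → ℝ≥0∞) : pmfExp (PMF.pure a) g = g a := by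
  rw [pmfExp, tsum_eq_single a fun b hb => by simp [PMF.pure_apply, hb]]
  simp

theorem pmfExp_bind (p : PMF X) (f : X → PMF Y) (g : Y → ℝ≥0∞) :
    pmfExp (p.bind f) g = pmfExp p fun a => pmfExp (f a) g := by
  simp only [pmfExp, PMF.bind_apply, ← ENNReal.tsum_mul_right, ← ENNReal.tsum_mul_left]
  rw [ENNReal.tsum_comm]
  simp only [mul_assoc]

theorem pmfExp_map (p : PMF X) (f : X → Y) (g : Y → ℝ≥0∞) :
    pmfExp (p.map f) g = pmfExp p fun a => g (f a) := by
  rw [← PMF.bind_pure_comp, pmfExp_bind]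
  simp [pmfExp_pure]

theorem pmfExp_mul_left (p : PMF X) (c : ℝ≥0∞) (g : X → ℝ≥0∞) :
    pmfExp p (fun a => c * g a) = c * pmfExp p g := by
  simp only [pmfExp, ← ENNReal.tsum_mul_left]
  exact tsum_congr fun a => by ring

theorem pmfExp_add (p : PMF X) (g g' : X → ℝ≥0∞) :
    pmfExp p (fun a => g a + g' a) = pmfExp p g + pmfExp p g' := by
  simp only [pmfExp, mul_add]
  exact ENNReal.tsum_add

theorem pmfExp_finset_sum {ι : Type*} (I : Finset ι) (p : PMF X) (g : ι → X → ℝ≥0∞) :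
    pmfExp p (fun a => ∑ i ∈ I, g i a) = ∑ i ∈ I, pmfExp p (g i) := by
  classical
  induction I using Finset.induction_on with
  | empty => simp [pmfExp_const]
  | insert i I hi ih => simp [Finset.sum_insert hi, pmfExp_add, ih]

/-- Markov's inequality. -/
theorem ofReal_one_sub_le_toOuterMeasure {p : PMF X} {g : X → ℝ≥0∞} {t : ℝ≥0∞} {δ : ℝ}
    (hδ : 0 ≤ δ) (ht0 : t ≠ 0) (ht : t ≠ ∞) (hg : pmfExp p g ≤ t * ENNReal.ofReal δ) {S : Set X}
    (hS : ∀ a ∈ p.support, g a < t → a ∈ S) :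
    ENNReal.ofReal (1 - δ) ≤ p.toOuterMeasure S := by
  have h1 : ∀ a, p a ≤ S.indicator p a + t⁻¹ * (p a * g a) := by
    intro a
    by_cases ha : a ∈ S
    · rw [Set.indicator_of_mem ha]; exact le_self_add
    · by_cases h0 : p a = 0
      · simp [h0]
      · have h2 : t ≤ g a := not_lt.1 fun h => ha (hS a ((p.mem_support_iff a).2 h0) h)
        refine le_add_left ?_
        calc p a = t⁻¹ * (p a * t) := by
              rw [mul_comm (p a) t, ← mul_assoc, ENNReal.inv_mul_cancel ht0 ht, one_mul]
          _ ≤ t⁻¹ * (p a * g a) := by gcongr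
  have h2 : (1 : ℝ≥0∞) ≤ p.toOuterMeasure S + ENNReal.ofReal δ := by
    calc (1 : ℝ≥0∞) = ∑' a, p a := p.tsum_coe.symm
      _ ≤ ∑' a, (S.indicator p a + t⁻¹ * (p a * g a)) := ENNReal.tsum_le_tsum h1
      _ = p.toOuterMeasure S + t⁻¹ * pmfExp p g := by
        rw [ENNReal.tsum_add, ENNReal.tsum_mul_left, p.toOuterMeasure_apply]; rfl
      _ ≤ p.toOuterMeasure S + t⁻¹ * (t * ENNReal.ofReal δ) := by gcongr
      _ = p.toOuterMeasure S + ENNReal.ofReal δ := by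
        rw [← mul_assoc, ENNReal.inv_mul_cancel ht0 ht, one_mul]
  rw [ENNReal.ofReal_sub 1 hδ, ENNReal.ofReal_one]
  exact tsub_le_iff_right.2 h2

end Expectation

section Run

open scoped ENNReal

theorem length_exploreList_le (H : ℕ) (U : ℕ → Finset (Test O A)) :
    (exploreList H U).length ≤ H * numActionSeqs H U := by
  rw [exploreList, List.length_flatMap]
  have h : ∀ n ∈ (List.range H).map fun h =>
      ((actionSeqs U (h + 1)).toList.map fun w => (h, w)).length, n ≤ numActionSeqs H U := by
    intro n hn
    obtain ⟨h, hh, rfl⟩ := List.mem_map.1 hn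
    rw [List.length_map, Finset.length_toList]
    exact card_actionSeqs_le U (List.mem_range.1 hh)
  refine (List.sum_le_card_nsmul _ _ h).trans_eq ?_
  simp

variable [Fintype A]

/-- The product of `φ` over a data set. -/
def dataProd {H : ℕ} (φ : Policy O A → Traj O A H → ℝ≥0∞) (D : Dataset O A H) : ℝ≥0∞ :=
  (D.map fun p => φ p.1 p.2).prod

theorem dataProd_append (φ : Policy O A → Traj O A H → ℝ≥0∞) (D D' : Dataset O A H) :
    dataProd φ (D ++ D') = dataProd φ D * dataProd φ D' := by
  simp [dataProd]

theorem dataProd_ofReal {h : Policy O A → Traj O A H → ℝ} (hh : ∀ π τ, 0 ≤ h π τ)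
    (D : Dataset O A H) : dataProd (fun π τ => ENNReal.ofReal (h π τ)) D =
      ENNReal.ofReal (D.map fun p => h p.1 p.2).prod := by
  induction D with
  | nil => simp [dataProd]
  | cons p D ih =>
    simp only [dataProd, List.map_cons, List.prod_cons] at ih ⊢
    rw [ih, ENNReal.ofReal_mul (hh _ _)]

variable [Fintype O]

theorem pmfExp_episodeLaw (κ : Dynamics O A) (π : Policy O A) (n : ℕ) (g : Traj O A n → ℝ≥0∞) :
    pmfExp (episodeLaw κ π n) g = ∑ τ, ENNReal.ofReal (trajProb κ π τ) * g τ := by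
  rw [pmfExp, tsum_fintype]
  rfl

theorem trajProb_pos_of_mem_support {κ : Dynamics O A} {π : Policy O A} {n : ℕ} {τ : Traj O A n}
    (h : τ ∈ (episodeLaw κ π n).support) : 0 < trajProb κ π τ := by
  rw [PMF.mem_support_iff] at h
  by_contra h0
  exact h (ENNReal.ofReal_of_nonpos (not_lt.1 h0))

variable [Nonempty A] {H : ℕ} {κ : Dynamics O A}

/-- The expectation of a product over independent episodes, with a bound that is uniform in the
policies. -/
theorem pmfExp_collect_le {φ : Policy O A → Traj O A H → ℝ≥0∞} {c : ℝ≥0∞}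
    (hφ : ∀ π, ∑ τ, ENNReal.ofReal (trajProb κ π τ) * φ π τ ≤ c) (π : Policy O A)
    (l : List (ℕ × List A)) : pmfExp (collect H κ π l) (dataProd φ) ≤ c ^ l.length := by
  induction l with
  | nil => simp [collect, pmfExp_pure, dataProd]
  | cons p l ih =>
    rw [collect, pmfExp_bind, pmfExp_episodeLaw, List.length_cons, pow_succ']
    calc _ ≤ ∑ τ, ENNReal.ofReal (trajProb κ (explorePolicy π p.1 p.2) τ) *
          (φ (explorePolicy π p.1 p.2) τ * c ^ l.length) := by
          refine Finset.sum_le_sum fun τ _ => mul_le_mul_right ?_ _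
          rw [pmfExp_map]
          simp only [dataProd, List.map_cons, List.prod_cons]
          rw [pmfExp_mul_left]
          exact mul_le_mul_right ih _
      _ = (∑ τ, ENNReal.ofReal (trajProb κ (explorePolicy π p.1 p.2) τ) *
          φ (explorePolicy π p.1 p.2) τ) * c ^ l.length := by
          rw [Finset.sum_mul]
          exact Finset.sum_congr rfl fun τ _ => by ring
      _ ≤ c * c ^ l.length := mul_le_mul_left (hφ _) _

/-- The policies of the episodes of an iteration are the exploration policies in the given order,
and the observed trajectories have positive probability. -/
theorem collect_support {π : Policy O A} {l : List (ℕ × List A)} {D : Dataset O A H}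
    (hD : D ∈ (collect H κ π l).support) :
    D.map Prod.fst = l.map (fun p => explorePolicy π p.1 p.2) ∧
      ∀ p ∈ D, 0 < trajProb κ p.1 p.2 := by
  induction l generalizing D with
  | nil =>
    simp only [collect, PMF.support_pure, Set.mem_singleton_iff] at hD
    subst hD
    simp
  | cons q l ih =>
    rw [collect, PMF.mem_support_bind_iff] at hD
    obtain ⟨τ, hτ, hD⟩ := hD
    obtain ⟨D', hD', rfl⟩ := (PMF.mem_support_map_iff _ _ _).1 hD
    obtain ⟨h1, h2⟩ := ih hD'
    refine ⟨by simp [h1], fun p hp => ?_⟩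
    rcases List.mem_cons.1 hp with rfl | hp
    · exact trajProb_pos_of_mem_support hτ
    · exact h2 p hp

variable {U : ℕ → Finset (Test O A)} {plan : Log O A H → PMF (Dynamics O A × Policy O A)}

theorem runLaw_succ_support {k : ℕ} {L : Log O A H}
    (hL : L ∈ (runLaw H U κ plan (k + 1)).support) :
    ∃ L' ∈ (runLaw H U κ plan k).support, ∃ fp ∈ (plan L').support,
      ∃ D ∈ (collect H κ fp.2 (exploreList H U)).support, L = L' ++ [(fp, D)] := by
  rw [runLaw, PMF.mem_support_bind_iff] at hL
  obtain ⟨L', hL', hL⟩ := hL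
  rw [PMF.mem_support_bind_iff] at hL
  obtain ⟨fp, hfp, hL⟩ := hL
  obtain ⟨D, hD, rfl⟩ := (PMF.mem_support_map_iff _ _ _).1 hL
  exact ⟨L', hL', fp, hfp, D, hD, rfl⟩

theorem length_of_mem_runLaw_support {k : ℕ} {L : Log O A H}
    (hL : L ∈ (runLaw H U κ plan k).support) : L.length = k := by
  induction k generalizing L with
  | zero =>
    simp only [runLaw, PMF.support_pure, Set.mem_singleton_iff] at hL
    simp [hL]
  | succ k ih =>
    obtain ⟨L', hL', fp, -, D, -, rfl⟩ := runLaw_succ_support hL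
    simp [ih hL']

/-- The structure of a run: each entry was planned and collected from the entries before it. -/
theorem runLaw_support_getElem {k : ℕ} {L : Log O A H}
    (hL : L ∈ (runLaw H U κ plan k).support) {j : ℕ} (hj : j < k) :
    ∃ e : (Dynamics O A × Policy O A) × Dataset O A H, L[j]? = some e ∧
      L.take j ∈ (runLaw H U κ plan j).support ∧ e.1 ∈ (plan (L.take j)).support ∧
      e.2 ∈ (collect H κ e.1.2 (exploreList H U)).support := by
  induction k generalizing L with
  | zero => omega
  | succ k ih =>
    obtain ⟨L', hL', fp, hfp, D, hD, rfl⟩ := runLaw_succ_support hL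
    have hlen := length_of_mem_runLaw_support hL'
    rcases Nat.lt_succ_iff_lt_or_eq.1 hj with h | rfl
    · obtain ⟨e, h1, h2⟩ := ih hL' h
      refine ⟨e, ?_, ?_⟩
      · rw [List.getElem?_append_left (by omega), h1]
      · rwa [List.take_append_of_le_length (by omega)]
    · refine ⟨(fp, D), ?_, ?_⟩
      · rw [← hlen]; simp
      · have : (L' ++ [(fp, D)]).take j = L' := by rw [← hlen]; simp
        rw [this]
        exact ⟨hL', hfp, hD⟩

theorem pmfExp_runLaw_le {φ : Policy O A → Traj O A H → ℝ≥0∞} {c : ℝ≥0∞}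
    (hφ : ∀ π, ∑ τ, ENNReal.ofReal (trajProb κ π τ) * φ π τ ≤ c) (k : ℕ) :
    pmfExp (runLaw H U κ plan k) (fun L => dataProd φ L.data) ≤
      c ^ (k * (exploreList H U).length) := by
  induction k with
  | zero => simp [runLaw, pmfExp_pure, dataProd, Log.data]
  | succ k ih =>
    rw [runLaw, pmfExp_bind, Nat.succ_mul, pow_add]
    calc _ ≤ pmfExp (runLaw H U κ plan k) fun L =>
          c ^ (exploreList H U).length * dataProd φ L.data := by
          refine pmfExp_mono fun L _ => ?_
          rw [pmfExp_bind]
          refine le_trans (pmfExp_mono fun fp _ => ?_) (pmfExp_const _ _).le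
          rw [pmfExp_map]
          simp only [Log.data, List.flatMap_append, dataProd_append, List.flatMap_cons,
            List.flatMap_nil, List.append_nil]
          rw [pmfExp_mul_left, mul_comm]
          exact mul_le_mul_left (pmfExp_collect_le hφ _ _) _
      _ ≤ c ^ (exploreList H U).length * c ^ (k * (exploreList H U).length) := by
          rw [pmfExp_mul_left]
          exact mul_le_mul_right ih _
      _ = _ := mul_comm _ _

/-- The first `j` entries of a run are a run of length `j`. -/
theorem pmfExp_runLaw_take {j k : ℕ} (hjk : j ≤ k) (g : Log O A H → ℝ≥0∞) :
    pmfExp (runLaw H U κ plan k) (fun L => g (L.take j)) ≤ pmfExp (runLaw H U κ plan j) g := by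
  induction k, hjk using Nat.le_induction with
  | base =>
    refine pmfExp_mono fun L hL => ?_
    rw [List.take_of_length_le (length_of_mem_runLaw_support hL).le]
  | succ k hjk ih =>
    refine le_trans ?_ ih
    rw [runLaw, pmfExp_bind]
    refine pmfExp_mono fun L hL => ?_
    have hlen := length_of_mem_runLaw_support hL
    rw [pmfExp_bind]
    refine le_trans (pmfExp_mono fun fp _ => ?_) (pmfExp_const _ _).le
    rw [pmfExp_map]
    refine le_trans (pmfExp_mono fun D _ => ?_) (pmfExp_const _ _).le
    rw [List.take_append_of_le_length (by omega)]

end Run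

/-! ### Likelihood ratios of brackets and confidence sets -/

section Likelihood

open scoped ENNReal

variable [Fintype O] [Fintype A] {H : ℕ}

/-- The likelihood of a data set under the model `κ`. -/
def likelihood (κ : Dynamics O A) (D : Dataset O A H) : ℝ :=
  (D.map fun p => trajProb κ p.1 p.2).prod

theorem likelihood_nonneg (κ : Dynamics O A) (D : Dataset O A H) : 0 ≤ likelihood κ D := by
  refine List.prod_nonneg fun x hx => ?_
  obtain ⟨p, -, rfl⟩ := List.mem_map.1 hx
  exact trajProb_nonneg κ _ _

theorem likelihood_pos {κ : Dynamics O A} {D : Dataset O A H}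
    (h : ∀ p ∈ D, 0 < trajProb κ p.1 p.2) : 0 < likelihood κ D := by
  refine List.prod_pos fun x hx => ?_
  obtain ⟨p, hp, rfl⟩ := List.mem_map.1 hx
  exact h p hp

theorem logLik_eq (κ : Dynamics O A) (D : Dataset O A H) :
    logLik κ D = ENNReal.log (ENNReal.ofReal (likelihood κ D)) := by
  induction D with
  | nil => simp [logLik, likelihood]
  | cons p D ih =>
    have h1 : logLik κ (p :: D) =
        ENNReal.log (ENNReal.ofReal (trajProb κ p.1 p.2)) + logLik κ D := by
      simp [logLik]
    have h2 : likelihood κ (p :: D) = trajProb κ p.1 p.2 * likelihood κ D := by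
      simp [likelihood]
    rw [h1, h2, ih, ENNReal.ofReal_mul (trajProb_nonneg κ _ _), ENNReal.log_mul_add]

/-- `g` is the upper end of an `ε`-bracket that contains the model `f`. -/
def IsUpperBracket (ε : ℝ) (f : Dynamics O A) (g : Policy O A → Traj O A H → ℝ) : Prop :=
  (∀ π τ, trajProb f π τ ≤ g π τ) ∧ ∀ π, ∑ τ, |g π τ - trajProb f π τ| ≤ ε

/-- The Hellinger affinity of `g` and the trajectory law of `κ`. -/
def affinity (κ : Dynamics O A) (g : Policy O A → Traj O A H → ℝ) (π : Policy O A) : ℝ :=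
  ∑ τ, √(g π τ * trajProb κ π τ)

/-- The likelihood ratio of `g` and `κ`. -/
def likRatio (κ : Dynamics O A) (g : Policy O A → Traj O A H → ℝ) (π : Policy O A)
    (τ : Traj O A H) : ℝ :=
  g π τ / trajProb κ π τ

/-- The square root of the likelihood ratio, multiplied with a factor that makes its expectation
at most one. -/
def tiltedRatio (κ : Dynamics O A) (g : Policy O A → Traj O A H → ℝ) (π : Policy O A)
    (τ : Traj O A H) : ℝ :=
  √(likRatio κ g π τ) * Real.exp (1 - affinity κ g π)

section Bracket

variable {ε : ℝ} {f κ : Dynamics O A} {g : Policy O A → Traj O A H → ℝ}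

theorem IsUpperBracket.nonneg (hg : IsUpperBracket ε f g) (π : Policy O A) (τ : Traj O A H) :
    0 ≤ g π τ :=
  (trajProb_nonneg f π τ).trans (hg.1 π τ)

theorem IsUpperBracket.sum_le (hg : IsUpperBracket ε f g) (π : Policy O A) :
    ∑ τ, g π τ ≤ 1 + ε := by
  have h1 : ∀ τ ∈ Finset.univ, g π τ ≤ trajProb f π τ + |g π τ - trajProb f π τ| := by
    intro τ _
    have := le_abs_self (g π τ - trajProb f π τ)
    linarith
  have h2 := Finset.sum_le_sum h1
  rw [Finset.sum_add_distrib, sum_trajProb] at h2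
  linarith [hg.2 π]

theorem likRatio_nonneg (hg : IsUpperBracket ε f g) (π : Policy O A) (τ : Traj O A H) :
    0 ≤ likRatio κ g π τ :=
  div_nonneg (hg.nonneg π τ) (trajProb_nonneg κ π τ)

theorem tiltedRatio_nonneg (π : Policy O A) (τ : Traj O A H) : 0 ≤ tiltedRatio κ g π τ :=
  mul_nonneg (Real.sqrt_nonneg _) (Real.exp_pos _).le

theorem sum_trajProb_mul_likRatio_le (hg : IsUpperBracket ε f g) (π : Policy O A) :
    ∑ τ, ENNReal.ofReal (trajProb κ π τ) * ENNReal.ofReal (likRatio κ g π τ) ≤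
      ENNReal.ofReal (1 + ε) := by
  calc _ ≤ ∑ τ, ENNReal.ofReal (g π τ) := by
        refine Finset.sum_le_sum fun τ _ => ?_
        rw [← ENNReal.ofReal_mul (trajProb_nonneg κ π τ)]
        refine ENNReal.ofReal_le_ofReal ?_
        rcases (trajProb_nonneg κ π τ).eq_or_lt with h | h
        · rw [← h, zero_mul]; exact hg.nonneg π τ
        · rw [likRatio, mul_div_cancel₀ _ h.ne']
    _ = ENNReal.ofReal (∑ τ, g π τ) :=
        (ENNReal.ofReal_sum_of_nonneg fun τ _ => hg.nonneg π τ).symm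
    _ ≤ _ := ENNReal.ofReal_le_ofReal (hg.sum_le π)

/-- The factor `exp (1 - a)` compensates the affinity `a`, because `a * exp (1 - a) ≤ 1`. -/
theorem sum_trajProb_mul_tiltedRatio_le (κ : Dynamics O A) (g : Policy O A → Traj O A H → ℝ)
    (π : Policy O A) :
    ∑ τ, ENNReal.ofReal (trajProb κ π τ) * ENNReal.ofReal (tiltedRatio κ g π τ) ≤ 1 := by
  have h1 : ∀ τ, trajProb κ π τ * tiltedRatio κ g π τ =
      √(g π τ * trajProb κ π τ) * Real.exp (1 - affinity κ g π) := by
    intro τ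
    rw [tiltedRatio, ← mul_assoc]
    congr 1
    rcases (trajProb_nonneg κ π τ).eq_or_lt with h | h
    · rw [← h]; simp
    · have h2 : g π τ * trajProb κ π τ = trajProb κ π τ ^ 2 * likRatio κ g π τ := by
        rw [likRatio]; field_simp
      rw [h2, Real.sqrt_mul (sq_nonneg _), Real.sqrt_sq h.le]
  calc _ = ∑ τ, ENNReal.ofReal (√(g π τ * trajProb κ π τ) * Real.exp (1 - affinity κ g π)) := by
        refine Finset.sum_congr rfl fun τ _ => ?_
        rw [← ENNReal.ofReal_mul (trajProb_nonneg κ π τ), h1]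
    _ = ENNReal.ofReal (affinity κ g π * Real.exp (1 - affinity κ g π)) := by
        rw [← ENNReal.ofReal_sum_of_nonneg fun τ _ => mul_nonneg (Real.sqrt_nonneg _)
          (Real.exp_pos _).le, ← Finset.sum_mul]
        rfl
    _ ≤ 1 := by
        rw [← ENNReal.ofReal_one]
        refine ENNReal.ofReal_le_ofReal ?_
        have h2 := Real.add_one_le_exp (affinity κ g π - 1)
        have h3 : Real.exp (affinity κ g π - 1) * Real.exp (1 - affinity κ g π) = 1 := by
          rw [← Real.exp_add]; simp
        have h4 := mul_le_mul_of_nonneg_right (show affinity κ g π ≤ Real.exp (affinity κ g π - 1) by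
          linarith) (Real.exp_pos (1 - affinity κ g π)).le
        rw [h3] at h4
        exact h4

/-- The squared `ℓ¹` distance is bounded by the squared Hellinger distance. -/
theorem sq_lawDist_le (hg : IsUpperBracket ε f g) (h0 : 0 ≤ ε) (h1 : ε ≤ 1) (π : Policy O A) :
    lawDist H f κ π ^ 2 ≤ 24 * (1 - affinity κ g π) + 14 * ε := by
  set p := fun τ : Traj O A H => trajProb f π τ with hp
  set q := fun τ : Traj O A H => trajProb κ π τ with hq
  have hq0 : ∀ τ, 0 ≤ q τ := fun τ => trajProb_nonneg κ π τ
  have hg0 : ∀ τ, 0 ≤ g π τ := hg.nonneg π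
  have hq1 : ∑ τ, q τ = 1 := sum_trajProb κ π H
  have hs1 : ∀ τ, √(g π τ) ^ 2 = g π τ := fun τ => Real.sq_sqrt (hg0 τ)
  have hs2 : ∀ τ, √(q τ) ^ 2 = q τ := fun τ => Real.sq_sqrt (hq0 τ)
  set a := affinity κ g π with ha
  have ha' : a = ∑ τ, √(g π τ) * √(q τ) :=
    Finset.sum_congr rfl fun τ _ => Real.sqrt_mul (hg0 τ) _
  have hS1 : ∑ τ, (√(g π τ) - √(q τ)) ^ 2 ≤ 2 * (1 - a) + ε := by
    have h2 : ∀ τ, (√(g π τ) - √(q τ)) ^ 2 = g π τ + q τ - 2 * (√(g π τ) * √(q τ)) := by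
      intro τ
      rw [sub_sq, hs1, hs2]; ring
    simp only [h2, Finset.sum_sub_distrib, Finset.sum_add_distrib, ← Finset.mul_sum, ← ha', hq1]
    linarith [hg.sum_le π]
  have hS2 : ∑ τ, (√(g π τ) + √(q τ)) ^ 2 ≤ 6 := by
    have h2 : ∀ τ ∈ Finset.univ, (√(g π τ) + √(q τ)) ^ 2 ≤ 2 * (g π τ + q τ) := by
      intro τ _
      nlinarith [sq_nonneg (√(g π τ) - √(q τ)), hs1 τ, hs2 τ]
    have h3 := Finset.sum_le_sum h2
    rw [← Finset.mul_sum, Finset.sum_add_distrib, hq1] at h3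
    linarith [hg.sum_le π]
  have hS0 : 0 ≤ ∑ τ, (√(g π τ) - √(q τ)) ^ 2 := Finset.sum_nonneg fun _ _ => sq_nonneg _
  have hcs : (∑ τ, |g π τ - q τ|) ^ 2 ≤ 6 * (2 * (1 - a) + ε) := by
    have h2 := Finset.sum_mul_sq_le_sq_mul_sq Finset.univ (fun τ => |√(g π τ) - √(q τ)|)
      (fun τ => √(g π τ) + √(q τ))
    have h3 : ∀ τ, |√(g π τ) - √(q τ)| * (√(g π τ) + √(q τ)) = |g π τ - q τ| := by
      intro τ
      rw [← abs_of_nonneg (add_nonneg (Real.sqrt_nonneg (g π τ)) (Real.sqrt_nonneg (q τ))),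
        ← abs_mul]
      congr 1
      rw [← hs1 τ, ← hs2 τ, Real.sqrt_sq (Real.sqrt_nonneg _), Real.sqrt_sq (Real.sqrt_nonneg _)]
      ring
    simp only [h3, sq_abs] at h2
    refine h2.trans ?_
    calc _ ≤ (∑ τ, (√(g π τ) - √(q τ)) ^ 2) * 6 := mul_le_mul_of_nonneg_left hS2 hS0
      _ ≤ _ := by linarith
  have htri : lawDist H f κ π ≤ ε + ∑ τ, |g π τ - q τ| := by
    have h2 : ∀ τ ∈ Finset.univ, |p τ - q τ| ≤ |g π τ - p τ| + |g π τ - q τ| := by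
      intro τ _
      rw [abs_sub_comm (g π τ) (p τ)]
      exact abs_sub_le _ _ _
    have h3 := Finset.sum_le_sum h2
    rw [Finset.sum_add_distrib] at h3
    exact h3.trans (add_le_add_left (hg.2 π) _)
  have h4 := pow_le_pow_left₀ (lawDist_nonneg H f κ π) htri 2
  nlinarith [sq_nonneg (ε - ∑ τ, |g π τ - q τ|)]

end Bracket

theorem logLik_of_pos {κ : Dynamics O A} {D : Dataset O A H} (h : 0 < likelihood κ D) :
    logLik κ D = (Real.log (likelihood κ D) : EReal) := by
  rw [logLik_eq, ENNReal.log_ofReal_of_pos h]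

/-- The true system is in the confidence set if no bracket has a large likelihood ratio. -/
theorem mem_confSet {F : Set (Dynamics O A)} {κ : Dynamics O A} (hκ : κ ∈ F) {D : Dataset O A H}
    (hD : ∀ p ∈ D, 0 < trajProb κ p.1 p.2) {ε β T : ℝ} (hT : 0 < T) (hβ : Real.log T ≤ β)
    (hF : ∀ f ∈ F, ∃ g, IsUpperBracket ε f g ∧
      dataProd (fun π τ => ENNReal.ofReal (likRatio κ g π τ)) D < ENNReal.ofReal T) :
    κ ∈ confSet F β D := by
  have hpos := likelihood_pos hD
  refine ⟨hκ, ?_⟩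
  rw [logLik_of_pos hpos]
  refine EReal.sub_le_of_le_add (iSup₂_le fun f hf => ?_)
  obtain ⟨g, hg, hlt⟩ := hF f hf
  rw [dataProd_ofReal fun π τ => likRatio_nonneg hg π τ] at hlt
  have h1 : (D.map fun p => likRatio κ g p.1 p.2).prod ≤ T :=
    ((ENNReal.ofReal_lt_ofReal_iff hT).1 hlt).le
  have h2 : likelihood f D ≤ (D.map fun p => likRatio κ g p.1 p.2).prod * likelihood κ D := by
    rw [likelihood, likelihood, ← List.prod_map_mul]
    refine List.prod_map_le_prod_map₀ _ _ (fun p _ => trajProb_nonneg f _ _) fun p hp => ?_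
    rw [likRatio, div_mul_cancel₀ _ (hD p hp).ne']
    exact hg.1 _ _
  have h3 : likelihood f D ≤ T * likelihood κ D :=
    h2.trans (mul_le_mul_of_nonneg_right h1 hpos.le)
  rw [logLik_eq]
  refine (ENNReal.log_le_log (ENNReal.ofReal_le_ofReal h3)).trans ?_
  rw [ENNReal.log_ofReal_of_pos (mul_pos hT hpos), Real.log_mul hT.ne' hpos.ne',
    ← EReal.coe_add]
  exact_mod_cast (by linarith)

/-- A model in the confidence set is close to the true system on all executed policies if the
tilted likelihood ratio of its bracket is not large. -/
theorem sum_sq_lawDist_le {F : Set (Dynamics O A)} {f κ : Dynamics O A} (hκ : κ ∈ F)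
    {D : Dataset O A H} (hD : ∀ p ∈ D, 0 < trajProb κ p.1 p.2) {ε β T : ℝ} (hT : 0 < T)
    (hε0 : 0 ≤ ε) (hε1 : ε ≤ 1) (hf : f ∈ confSet F β D) {g : Policy O A → Traj O A H → ℝ}
    (hg : IsUpperBracket ε f g)
    (hlt : dataProd (fun π τ => ENNReal.ofReal (tiltedRatio κ g π τ)) D < ENNReal.ofReal T) :
    (D.map fun p => lawDist H f κ p.1 ^ 2).sum ≤
      24 * (Real.log T + β / 2) + 14 * (ε * D.length) := by
  have hpos := likelihood_pos hD
  have h1 : ((Real.log (likelihood κ D) - β : ℝ) : EReal) ≤ logLik f D := by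
    refine le_trans ?_ hf.2
    rw [EReal.coe_sub, ← logLik_of_pos hpos]
    exact EReal.sub_le_sub (le_iSup₂_of_le κ hκ le_rfl) le_rfl
  have hfpos : 0 < likelihood f D := by
    refine (likelihood_nonneg f D).lt_of_ne fun h0 => ?_
    rw [logLik_eq, ← h0] at h1
    simp at h1
    exact absurd h1 (EReal.coe_ne_bot _)
  have h2 : Real.log (likelihood κ D) - β ≤ Real.log (likelihood f D) := by
    rw [logLik_of_pos hfpos] at h1
    exact_mod_cast h1
  rw [dataProd_ofReal fun π τ => tiltedRatio_nonneg π τ] at hlt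
  have h3 : (D.map fun p => tiltedRatio κ g p.1 p.2).prod ≤ T :=
    ((ENNReal.ofReal_lt_ofReal_iff hT).1 hlt).le
  have h4 : √(likelihood f D / likelihood κ D) *
      Real.exp (D.map fun p => 1 - affinity κ g p.1).sum ≤
      (D.map fun p => tiltedRatio κ g p.1 p.2).prod := by
    have h5 : √(likelihood f D / likelihood κ D) *
        Real.exp (D.map fun p => 1 - affinity κ g p.1).sum =
        (D.map fun p => √(trajProb f p.1 p.2 / trajProb κ p.1 p.2) *
          Real.exp (1 - affinity κ g p.1)).prod := by
      clear * -
      induction D with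
      | nil => simp [likelihood]
      | cons p D ih =>
        simp only [likelihood, List.map_cons, List.prod_cons, List.sum_cons] at ih ⊢
        rw [← ih, mul_div_mul_comm, Real.sqrt_mul (div_nonneg (trajProb_nonneg f _ _)
          (trajProb_nonneg κ _ _)), Real.exp_add]
        ring
    rw [h5]
    refine List.prod_map_le_prod_map₀ _ _
      (fun p _ => mul_nonneg (Real.sqrt_nonneg _) (Real.exp_pos _).le) fun p hp => ?_
    refine mul_le_mul_of_nonneg_right (Real.sqrt_le_sqrt ?_) (Real.exp_pos _).le
    exact div_le_div_of_nonneg_right (hg.1 _ _) (hD p hp).le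
  have h6 : (D.map fun p => 1 - affinity κ g p.1).sum ≤ Real.log T + β / 2 := by
    have h7 := Real.log_le_log (by positivity) (h4.trans h3)
    rw [Real.log_mul (by positivity) (Real.exp_pos _).ne', Real.log_exp,
      Real.log_sqrt (by positivity), Real.log_div hfpos.ne' hpos.ne'] at h7
    linarith
  have h8 : (D.map fun p => lawDist H f κ p.1 ^ 2).sum ≤
      24 * (D.map fun p => 1 - affinity κ g p.1).sum + 14 * (ε * D.length) := by
    clear * - hg hε0 hε1
    induction D with
    | nil => simp
    | cons p D ih =>
      have := sq_lawDist_le (κ := κ) hg hε0 hε1 p.1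
      simp only [List.map_cons, List.sum_cons, List.length_cons]
      push_cast
      linarith
  linarith

variable [Nonempty A]

/-- With probability `1 - δ`, at each iteration the likelihood ratios and tilted likelihood ratios
of all brackets are small. -/
theorem concentration {F : Set (Dynamics O A)} {U : ℕ → Finset (Test O A)} {κ : Dynamics O A}
    {plan : Log O A H → PMF (Dynamics O A × Policy O A)} {ε : ℝ} {N K : ℕ} (hε : 0 ≤ ε)
    (hN : HasBracket H F ε N) (hN1 : 1 ≤ N) (hK : 1 ≤ K)
    (hn : ε * (K * (exploreList H U).length) ≤ 1) {δ : ℝ} (hδ : 0 < δ) {S : Set (Log O A H)}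
    (hS : ∀ L ∈ (runLaw H U κ plan K).support,
      (∀ j < K, ∀ f ∈ F, ∃ g, IsUpperBracket ε f g ∧
        dataProd (fun π τ => ENNReal.ofReal (likRatio κ g π τ)) (Log.data (L.take j)) <
          ENNReal.ofReal (4 * N * K / δ) ∧
        dataProd (fun π τ => ENNReal.ofReal (tiltedRatio κ g π τ)) (Log.data (L.take j)) <
          ENNReal.ofReal (4 * N * K / δ)) → L ∈ S) :
    ENNReal.ofReal (1 - δ) ≤ (runLaw H U κ plan K).toOuterMeasure S := by
  classical
  obtain ⟨g₁, g₂, hg, hbr⟩ := hN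
  let I : Finset (Fin N) := Finset.univ.filter fun i => ∃ f ∈ F, IsUpperBracket ε f (g₂ i)
  have hF : ∀ f ∈ F, ∃ i ∈ I, IsUpperBracket ε f (g₂ i) := by
    intro f hf
    obtain ⟨i, hi⟩ := hbr f hf
    have hu : IsUpperBracket ε f (g₂ i) := by
      refine ⟨fun π τ => (hi π τ).2, fun π => le_trans (Finset.sum_le_sum fun τ _ => ?_) (hg i π)⟩
      rw [abs_of_nonneg (sub_nonneg.2 (hi π τ).2), abs_sub_comm,
        abs_of_nonneg (sub_nonneg.2 ((hi π τ).1.trans (hi π τ).2))]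
      linarith [(hi π τ).1]
    exact ⟨i, Finset.mem_filter.2 ⟨Finset.mem_univ _, f, hf, hu⟩, hu⟩
  let φ : Fin N → Policy O A → Traj O A H → ℝ≥0∞ :=
    fun i π τ => ENNReal.ofReal (likRatio κ (g₂ i) π τ)
  let ψ : Fin N → Policy O A → Traj O A H → ℝ≥0∞ :=
    fun i π τ => ENNReal.ofReal (tiltedRatio κ (g₂ i) π τ)
  let G : ℕ → Fin N → Log O A H → ℝ≥0∞ := fun j i L =>
    dataProd (φ i) (Log.data L) + dataProd (ψ i) (Log.data L)
  have hT : 0 < 4 * (N : ℝ) * K / δ := by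
    have : (0 : ℝ) < N := by exact_mod_cast hN1
    have : (0 : ℝ) < K := by exact_mod_cast hK
    positivity
  have hG : ∀ j < K, ∀ i ∈ I, pmfExp (runLaw H U κ plan K) (fun L => G j i (L.take j)) ≤ 4 := by
    intro j hj i hi
    obtain ⟨-, f, -, hu⟩ := Finset.mem_filter.1 hi
    refine (pmfExp_runLaw_take hj.le (G j i)).trans ?_
    rw [pmfExp_add]
    have h1 := pmfExp_runLaw_le (U := U) (plan := plan)
      (fun π => sum_trajProb_mul_likRatio_le (κ := κ) hu π) j
    have h2 := pmfExp_runLaw_le (U := U) (plan := plan)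
      (fun π => sum_trajProb_mul_tiltedRatio_le κ (g₂ i) π) j
    rw [one_pow] at h2
    have h3 : ENNReal.ofReal (1 + ε) ^ (j * (exploreList H U).length) ≤ 3 := by
      rw [← ENNReal.ofReal_pow (by positivity)]
      have h4 : (1 + ε) ^ (j * (exploreList H U).length) ≤ 3 := by
        calc (1 + ε) ^ (j * (exploreList H U).length)
            ≤ Real.exp ε ^ (j * (exploreList H U).length) :=
              pow_le_pow_left₀ (by positivity) (by linarith [Real.add_one_le_exp ε]) _
          _ = Real.exp (ε * (j * (exploreList H U).length)) := by
              rw [← Real.exp_nat_mul]; push_cast; ring_nf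
          _ ≤ Real.exp 1 := by
              refine Real.exp_le_exp.2 (le_trans ?_ hn)
              gcongr
          _ ≤ 3 := by linarith [Real.exp_one_lt_d9]
      calc _ ≤ ENNReal.ofReal 3 := ENNReal.ofReal_le_ofReal h4
        _ = 3 := by norm_num
    calc _ ≤ (3 : ℝ≥0∞) + 1 := add_le_add (h1.trans h3) h2
      _ = 4 := by norm_num
  refine ofReal_one_sub_le_toOuterMeasure (p := runLaw H U κ plan K)
    (g := fun L => ∑ j ∈ Finset.range K, ∑ i ∈ I, G j i (L.take j))
    (t := ENNReal.ofReal (4 * N * K / δ)) hδ.le (by simpa using hT) ENNReal.ofReal_ne_top ?_ ?_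
  · rw [pmfExp_finset_sum]
    have h1 : ∀ j ∈ Finset.range K, pmfExp (runLaw H U κ plan K)
        (fun L => ∑ i ∈ I, G j i (L.take j)) ≤ (N : ℝ≥0∞) * 4 := by
      intro j hj
      rw [pmfExp_finset_sum]
      refine (Finset.sum_le_sum (hG j (Finset.mem_range.1 hj))).trans ?_
      rw [Finset.sum_const, nsmul_eq_mul]
      gcongr
      simpa using Finset.card_le_univ I
    refine (Finset.sum_le_sum h1).trans ?_
    rw [Finset.sum_const, Finset.card_range, nsmul_eq_mul, ← ENNReal.ofReal_mul hT.le]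
    have h2 : 4 * (N : ℝ) * K / δ * δ = K * (N * 4) := by field_simp
    rw [h2, ENNReal.ofReal_mul (by positivity), ENNReal.ofReal_mul (by positivity)]
    simp
  · intro L hL hlt
    refine hS L hL fun j hj f hf => ?_
    obtain ⟨i, hi, hu⟩ := hF f hf
    have h1 : G j i (L.take j) < ENNReal.ofReal (4 * N * K / δ) := by
      refine lt_of_le_of_lt ?_ hlt
      refine le_trans ?_ (Finset.single_le_sum (f := fun j => ∑ i ∈ I, G j i (L.take j))
        (fun _ _ => zero_le) (Finset.mem_range.2 hj))
      exact Finset.single_le_sum (f := fun i => G j i (L.take j)) (fun _ _ => zero_le) hi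
    exact ⟨g₂ i, hu, lt_of_le_of_lt le_self_add h1, lt_of_le_of_lt le_add_self h1⟩

end Likelihood

/-! ### Accumulated errors of the chosen models -/

section Regret

theorem abs_sum_reward_le {r : History O A → ℝ} (hr : ∀ τ, |r τ| ≤ 1) {H : ℕ}
    (τ : Traj O A H) : |∑ i : Fin H, r (past τ (i + 1))| ≤ H := by
  refine (Finset.abs_sum_le_sum_abs _ _).trans ?_
  refine (Finset.sum_le_sum fun i _ => hr _).trans_eq ?_
  simp

theorem one_le_numActionSeqs {H : ℕ} (hH : 1 ≤ H) [Nonempty O] {U : ℕ → Finset (Test O A)}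
    (hU : ∀ o : O, (([], o) : Test O A) ∈ U H) : 1 ≤ numActionSeqs H U := by
  have h1 : 1 ≤ (actionSeqs U (H - 1 + 1)).card := by
    rw [Nat.sub_add_cancel hH, Nat.one_le_iff_ne_zero, ← Nat.pos_iff_ne_zero, Finset.card_pos]
    refine ⟨Test.actions (([], Classical.arbitrary O) : Test O A), ?_⟩
    classical
    unfold actionSeqs
    exact Finset.mem_image_of_mem _ (hU _)
  exact h1.trans (card_actionSeqs_le U (by omega : H - 1 < H))

variable [Fintype O] [Fintype A]

theorem value_sub_value_le {r : History O A → ℝ} (hr : ∀ τ, |r τ| ≤ 1) (H : ℕ)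
    (f κ : Dynamics O A) (π : Policy O A) :
    value r H f π - value r H κ π ≤ H * lawDist H f κ π := by
  rw [value, value, ← Finset.sum_sub_distrib, lawDist, Finset.mul_sum]
  refine Finset.sum_le_sum fun τ _ => ?_
  rw [← sub_mul, mul_comm (H : ℝ)]
  refine (le_abs_self _).trans ?_
  rw [abs_mul]
  exact mul_le_mul_of_nonneg_left (abs_sum_reward_le hr τ) (abs_nonneg _)

theorem abs_value_le {r : History O A → ℝ} (hr : ∀ τ, |r τ| ≤ 1) (H : ℕ) (κ : Dynamics O A)
    (π : Policy O A) : |value r H κ π| ≤ H := by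
  refine (Finset.abs_sum_le_sum_abs _ _).trans ?_
  calc _ ≤ ∑ τ : Traj O A H, trajProb κ π τ * H := by
        refine Finset.sum_le_sum fun τ _ => ?_
        rw [abs_mul, abs_of_nonneg (trajProb_nonneg κ π τ)]
        exact mul_le_mul_of_nonneg_left (abs_sum_reward_le hr τ) (trajProb_nonneg κ π τ)
    _ = H := by rw [← Finset.sum_mul, sum_trajProb, one_mul]

variable [Nonempty A] {H : ℕ} {dummy : O} {U : ℕ → Finset (Test O A)} {α : ℝ}
  {κ : Dynamics O A}

theorem one_le_psrRank (hreg : IsRegular H dummy U α κ)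
    (hcore : ∀ h < H, IsCoreTestSet H dummy κ h (U (h + 1))) (hH : 1 ≤ H) :
    1 ≤ psrRank H dummy κ := by
  have h0 : (dynMatrix H dummy κ 0).rank ≤ psrRank H dummy κ :=
    Finset.le_sup (f := fun h => (dynMatrix H dummy κ h).rank) (Finset.mem_range.2 hH)
  refine le_trans ?_ h0
  by_contra h
  obtain ⟨σ, y, -, -, -, hrep⟩ := exists_coreCoeff hreg hH (hcore 0 hH)
  have h1 := hrep [] rfl (by simp [seqProb])
  have h2 : IsEmpty (Fin (dynMatrix H dummy κ 0).rank) := by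
    rw [show (dynMatrix H dummy κ 0).rank = 0 by omega]; infer_instance
  rw [Finset.univ_eq_empty, Finset.sum_empty] at h1
  have h3 := testSum_predVec H dummy κ [] []
  rw [← h1] at h3
  simp [testSum] at h3

/-- The sum of squared deviations that the exploration data reveal bounds the squared state
errors. -/
theorem sum_sq_stateErr_le {f : Dynamics O A} {π : ℕ → Policy O A} {n k : ℕ} (hn : n < H) {B : ℝ}
    (hB : ∑ i ∈ Finset.range k, ∑ w ∈ actionSeqs U (n + 1),
      lawDist H f κ (explorePolicy (π i) n w) ^ 2 ≤ B) :
    ∑ i ∈ Finset.range k, stateErr H dummy U f κ (π i) n ^ 2 ≤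
      (Fintype.card A : ℝ) ^ 2 * numActionSeqs H U * B := by
  calc _ ≤ ∑ i ∈ Finset.range k, (Fintype.card A : ℝ) ^ 2 * numActionSeqs H U *
        ∑ w ∈ actionSeqs U (n + 1), lawDist H f κ (explorePolicy (π i) n w) ^ 2 := by
        refine Finset.sum_le_sum fun i _ => ?_
        refine (pow_le_pow_left₀ (stateErr_nonneg _ _ _ _ _ _ _)
          (stateErr_le dummy U f κ (π i) hn) 2).trans ?_
        rw [mul_pow, mul_assoc]
        refine mul_le_mul_of_nonneg_left ?_ (by positivity)
        refine sq_sum_le_card_mul_sum_sq.trans ?_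
        refine mul_le_mul_of_nonneg_right ?_ (Finset.sum_nonneg fun _ _ => sq_nonneg _)
        exact_mod_cast card_actionSeqs_le U hn
    _ ≤ _ := by
        rw [← Finset.mul_sum]
        exact mul_le_mul_of_nonneg_left hB (by positivity)

/-- The accumulated error of the models at the initial state. -/
theorem sum_initErr_le (hH : 0 < H) {f : ℕ → Dynamics O A} {π : ℕ → Policy O A} {K : ℕ} {B : ℝ}
    (hB : ∀ k < K, ∑ i ∈ Finset.range k, ∑ w ∈ actionSeqs U 1,
      lawDist H (f k) κ (explorePolicy (π i) 0 w) ^ 2 ≤ B) :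
    ∑ k ∈ Finset.range K,
      testNorm (U 1) (stateVec H dummy (f k) [] - stateVec H dummy κ []) ≤
      √((1 : ℕ) * (1 * (2 * numActionSeqs H U)) ^ 2 +
        (Fintype.card A : ℝ) ^ 2 * numActionSeqs H U * B) *
        ((1 : ℕ) * √(K * (2 * ((1 : ℕ) * Real.log (1 + K))))) := by
  let x : ℕ → Unit → Fin 1 → ℝ := fun _ _ _ => 1
  let u : ℕ → U 1 → Fin 1 → ℝ :=
    fun k t _ => stateVec H dummy (f k) [] t - stateVec H dummy κ [] t
  have hux : ∀ k i, ∑ t : Unit, ∑ j, |u k j ⬝ᵥ x i t| =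
      testNorm (U 1) (stateVec H dummy (f k) [] - stateVec H dummy κ []) := by
    intro k i
    simp only [Finset.univ_unique, Finset.sum_singleton, u, x, dotProduct, mul_one]
    exact Finset.sum_coe_sort (U 1)
      fun t => |stateVec H dummy (f k) [] t - stateVec H dummy κ [] t|
  have hv : ∀ f : Dynamics O A, testNorm (U 1) (stateVec H dummy f []) ≤ numActionSeqs H U := by
    intro f
    rw [stateVec, seqProb, one_smul]
    exact testNorm_predVec_le dummy f [] U hH
  have h := sum_abs_dotProduct_le (K := K) x u (η := 1) (ρ := 2 * numActionSeqs H U)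
    (B := (Fintype.card A : ℝ) ^ 2 * numActionSeqs H U * B) one_pos (fun k => by simp [x])
    (fun k c => by
      have h1 : ∑ j, |u k j c| ≤
          testNorm (U 1) (stateVec H dummy (f k) []) + testNorm (U 1) (stateVec H dummy κ []) := by
        have h2 : ∑ j, |u k j c| =
            ∑ t ∈ U 1, |stateVec H dummy (f k) [] t - stateVec H dummy κ [] t| :=
          Finset.sum_coe_sort (U 1)
            fun t => |stateVec H dummy (f k) [] t - stateVec H dummy κ [] t|
        rw [h2, testNorm, testNorm, ← Finset.sum_add_distrib]
        exact Finset.sum_le_sum fun t _ => abs_sub _ _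
      linarith [hv (f k), hv κ])
    (fun k hk => by
      simp only [hux]
      exact sum_sq_stateErr_le (dummy := dummy) hH (hB k hk))
  simpa only [hux] using h

/-- The accumulated update errors of the models at level `n`. The true states span a space of
dimension `rank D_n`, in the coordinates given by the core histories of the true system. -/
theorem sum_stepErr_le (hα : 0 < α) (hreg : IsRegular H dummy U α κ)
    (hcore : ∀ h < H, IsCoreTestSet H dummy κ h (U (h + 1)))
    {f : ℕ → Dynamics O A} {π : ℕ → Policy O A}
    {n K : ℕ} (hn : n + 1 < H) {P : ℕ → (Test O A → ℝ) →ₗ[ℝ] (Test O A → ℝ)}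
    (hP : ∀ k, IsPredictor H dummy U α (f k) n (P k))
    (hs : 1 ≤ (numActionSeqs H U : ℝ) / α) {B : ℝ}
    (hB : ∀ m < H, ∀ k < K, ∑ i ∈ Finset.range k, ∑ w ∈ actionSeqs U (m + 1),
      lawDist H (f k) κ (explorePolicy (π i) m w) ^ 2 ≤ B) :
    ∑ k ∈ Finset.range K, (futureSum (π k) n [] fun s =>
      stepErr U n (P k) (stateVec H dummy κ s)) ≤
      √((dynMatrix H dummy κ n).rank * (numActionSeqs H U / α *
          (2 * Fintype.card A * numActionSeqs H U * (numActionSeqs H U / α))) ^ 2 +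
        4 * Fintype.card A ^ 4 * (numActionSeqs H U / α) ^ 2 * numActionSeqs H U * B) *
        ((dynMatrix H dummy κ n).rank *
          √(K * (2 * ((dynMatrix H dummy κ n).rank * Real.log (1 + K))))) := by
  obtain ⟨σ, y, hlen, hy, -, hrep⟩ := exists_coreCoeff hreg (by omega : n < H) (hcore n (by omega))
  set a : ℝ := ((Fintype.card A : ℕ) : ℝ) with ha
  set v : ℝ := ((numActionSeqs H U : ℕ) : ℝ) with hv
  have ha1 : 1 ≤ a := by rw [ha]; exact_mod_cast Fintype.card_pos
  have hv0 : 0 ≤ v := by rw [hv]; positivity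
  have hrep' : ∀ s : List (O × A), s.length = n → stateVec H dummy κ s =
      ∑ j, y (stateVec H dummy κ s) j • predVec H dummy κ (σ j) := by
    intro s hs'
    rcases (seqProb_nonneg κ [] s).eq_or_lt with h | h
    · simp [stateVec, ← h]
    · conv_lhs => rw [stateVec, ← hrep s hs' h, Finset.smul_sum]
      refine Finset.sum_congr rfl fun j _ => ?_
      rw [stateVec, map_smul, Pi.smul_apply, smul_assoc]
  let x : ℕ → Traj O A n → Fin (dynMatrix H dummy κ n).rank → ℝ :=
    fun k τ => polProb (π k) τ • y (stateVec H dummy κ (List.ofFn τ))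
  let u : ℕ → (O × A) × U (n + 2) → Fin (dynMatrix H dummy κ n).rank → ℝ :=
    fun k p c => tailVec p.1 (P k (predVec H dummy κ (σ c)) - predVec H dummy κ (σ c)) p.2
  have hdot : ∀ k i τ p, u k p ⬝ᵥ x i τ = polProb (π i) τ *
      tailVec p.1 (P k (stateVec H dummy κ (List.ofFn τ)) - stateVec H dummy κ (List.ofFn τ))
        p.2 := by
    intro k i τ p
    conv_rhs => rw [hrep' (List.ofFn τ) (by simp), map_sum, ← Finset.sum_sub_distrib]
    simp only [u, x, dotProduct, tailVec, Finset.sum_apply, Finset.mul_sum, map_smul,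
      Pi.sub_apply, Pi.smul_apply, smul_eq_mul]
    exact Finset.sum_congr rfl fun c _ => by ring
  have hux : ∀ k i, ∑ τ, ∑ p, |u k p ⬝ᵥ x i τ| = futureSum (π i) n [] fun s =>
      stepErr U n (P k) (stateVec H dummy κ s) := by
    intro k i
    rw [← sum_polProb_mul]
    refine Finset.sum_congr rfl fun τ _ => ?_
    rw [stepErr, Finset.mul_sum, Fintype.sum_prod_type]
    refine Finset.sum_congr rfl fun z _ => ?_
    simp only [hdot, abs_mul, abs_of_nonneg (polProb_nonneg (π i) τ), ← Finset.mul_sum]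
    congr 1
    exact Finset.sum_coe_sort (U (n + 2)) fun t => |tailVec z
      (P k (stateVec H dummy κ (List.ofFn τ)) - stateVec H dummy κ (List.ofFn τ)) t|
  have hstate : ∀ k, ∑ τ, ∑ c, |x k τ c| ≤ v / α := by
    intro k
    calc ∑ τ, ∑ c, |x k τ c|
        = futureSum (π k) n [] fun s => ∑ c, |y (stateVec H dummy κ s) c| := by
          rw [← sum_polProb_mul]
          refine Finset.sum_congr rfl fun τ _ => ?_
          simp [x, abs_mul, abs_of_nonneg (polProb_nonneg (π k) τ), Finset.mul_sum]
      _ ≤ futureSum (π k) n [] fun s => v / α * seqProb κ [] s := by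
          refine futureSum_mono _ fun s _ => (hy _).trans ?_
          rw [stateVec, testNorm_smul, abs_of_nonneg (seqProb_nonneg κ [] s)]
          have h1 := testNorm_predVec_le dummy κ s U (by omega : n < H)
          calc _ ≤ 1 / α * (seqProb κ [] s * v) := by
                have := seqProb_nonneg κ [] s
                gcongr
            _ = _ := by ring
      _ = v / α := by
          rw [futureSum_mul_left, futureSum_seqProb, mul_one]
  have hu : ∀ k c, ∑ p, |u k p c| ≤ 2 * a * v * (v / α) := by
    intro k c
    have hl : (σ c).length < H := by rw [hlen]; omega
    calc ∑ p, |u k p c|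
        = stepErr U n (P k) (predVec H dummy κ (σ c)) := by
          rw [stepErr, Fintype.sum_prod_type]
          refine Finset.sum_congr rfl fun z _ => ?_
          exact Finset.sum_coe_sort (U (n + 2)) fun t => |tailVec z
            (P k (predVec H dummy κ (σ c)) - predVec H dummy κ (σ c)) t|
      _ ≤ ∑ z : O × A, (testNorm (U (n + 2)) (tailVec z (P k (predVec H dummy κ (σ c)))) +
            testNorm (U (n + 2)) (tailVec z (predVec H dummy κ (σ c)))) := by
          refine Finset.sum_le_sum fun z _ => ?_
          simp only [testNorm, ← Finset.sum_add_distrib]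
          exact Finset.sum_le_sum fun t _ => abs_sub _ _
      _ ≤ a * (v / α) * v + a * v := by
          rw [Finset.sum_add_distrib]
          refine add_le_add (((hP k).sum_testNorm_tailVec_le hn _).trans ?_)
            (sum_testNorm_tailVec_predVec_le dummy κ hl U hn)
          exact mul_le_mul_of_nonneg_left
            (testNorm_predVec_le dummy κ (σ c) U (by omega : n < H)) (by positivity)
      _ ≤ 2 * a * v * (v / α) := by
          have : 0 ≤ a * v := by positivity
          nlinarith
  have h := sum_abs_dotProduct_le (K := K) x u (η := v / α) (ρ := 2 * a * v * (v / α))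
    (B := 4 * a ^ 4 * (v / α) ^ 2 * v * B) (by linarith) hstate hu
    (fun k hk => by
      simp only [hux]
      have h1 := sum_sq_stateErr_le (dummy := dummy) (by omega : n < H) (hB n (by omega) k hk)
      have h2 := sum_sq_stateErr_le (dummy := dummy) hn (hB (n + 1) hn k hk)
      have hB0 : 0 ≤ B := le_trans (Finset.sum_nonneg fun i _ =>
        Finset.sum_nonneg fun w _ => sq_nonneg _) (hB n (by omega) k hk)
      have has : 1 ≤ a * (v / α) := one_le_mul_of_one_le_of_one_le ha1 hs
      calc _ ≤ ∑ i ∈ Finset.range k, (2 * (a * (v / α)) ^ 2 *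
            stateErr H dummy U (f k) κ (π i) n ^ 2 +
              2 * stateErr H dummy U (f k) κ (π i) (n + 1) ^ 2) := by
            refine Finset.sum_le_sum fun i _ => ?_
            refine (pow_le_pow_left₀ (futureSum_nonneg _ fun s _ => stepErr_nonneg _ _ _ _)
              (futureSum_stepErr_le (hP k) hα hn (π i)) 2).trans ?_
            rw [← ha, ← hv]
            nlinarith [sq_nonneg (a * (v / α) * stateErr H dummy U (f k) κ (π i) n -
              stateErr H dummy U (f k) κ (π i) (n + 1))]
        _ = 2 * (a * (v / α)) ^ 2 *
              ∑ i ∈ Finset.range k, stateErr H dummy U (f k) κ (π i) n ^ 2 +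
            2 * ∑ i ∈ Finset.range k, stateErr H dummy U (f k) κ (π i) (n + 1) ^ 2 := by
            rw [Finset.sum_add_distrib, Finset.mul_sum, Finset.mul_sum]
        _ ≤ 2 * (a * (v / α)) ^ 2 * (a ^ 2 * v * B) + 2 * (a ^ 2 * v * B) := by gcongr
        _ ≤ 2 * (a * (v / α)) ^ 2 * (a ^ 2 * v * B) +
            2 * ((a * (v / α)) ^ 2 * (a ^ 2 * v * B)) := by
            have h3 : 0 ≤ a ^ 2 * v * B := by positivity
            have h4 : 1 ≤ (a * (v / α)) ^ 2 := one_le_pow₀ has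
            nlinarith
        _ = _ := by ring)
  simpa only [hux] using h

/-- The accumulated distance of the trajectory laws of the models and the true system. -/
theorem sum_lawDist_le (hH : 1 ≤ H) (hα : 0 < α) {F : Set (Dynamics O A)}
    (hU : ∀ o : O, (([], o) : Test O A) ∈ U H) (hκ : κ ∈ F)
    (hreg : ∀ f ∈ F, IsRegular H dummy U α f)
    (hcore : ∀ f ∈ F, ∀ h < H, IsCoreTestSet H dummy f h (U (h + 1)))
    {f : ℕ → Dynamics O A} (hf : ∀ k, f k ∈ F) {π : ℕ → Policy O A} {K : ℕ} {B : ℝ} (hB0 : 0 ≤ B)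
    (hB : ∀ m < H, ∀ k < K, ∑ i ∈ Finset.range k, ∑ w ∈ actionSeqs U (m + 1),
      lawDist H (f k) κ (explorePolicy (π i) m w) ^ 2 ≤ B) :
    ∑ k ∈ Finset.range K, lawDist H (f k) κ (π k) ≤
      numActionSeqs H U / α * (H *
        (√(psrRank H dummy κ * (numActionSeqs H U / α *
          (2 * Fintype.card A * numActionSeqs H U * (numActionSeqs H U / α))) ^ 2 +
        4 * Fintype.card A ^ 4 * (numActionSeqs H U / α) ^ 2 * numActionSeqs H U * B) *
        (psrRank H dummy κ * √(K * (2 * (psrRank H dummy κ * Real.log (1 + K))))))) := by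
  have hex : ∀ k, ∃ P : ℕ → (Test O A → ℝ) →ₗ[ℝ] (Test O A → ℝ),
      ∀ n < H, IsPredictor H dummy U α (f k) n (P n) := fun k =>
    exists_isPredictor (hreg _ (hf k)) (hcore _ (hf k))
  choose P hP using hex
  have hs : 1 ≤ (numActionSeqs H U : ℝ) / α := (hP 0 0 hH).one_le hα hH
  have hd := one_le_psrRank (hreg κ hκ) (hcore κ hκ) hH
  have hd' : (1 : ℝ) ≤ psrRank H dummy κ := by exact_mod_cast hd
  have hrank : ∀ n < H, ((dynMatrix H dummy κ n).rank : ℝ) ≤ psrRank H dummy κ := by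
    intro n hn
    exact_mod_cast Finset.le_sup (f := fun h => (dynMatrix H dummy κ h).rank)
      (Finset.mem_range.2 hn)
  have hv1 : (1 : ℝ) ≤ numActionSeqs H U := by 
    have : Nonempty O := ⟨dummy⟩
    exact_mod_cast one_le_numActionSeqs hH hU
  have ha1 : (1 : ℝ) ≤ Fintype.card A := by exact_mod_cast Fintype.card_pos
  have h1α : 1 / α ≤ numActionSeqs H U / α := by gcongr
  have hlog : 0 ≤ Real.log (1 + K) := Real.log_nonneg (by
    have : (0 : ℝ) ≤ K := Nat.cast_nonneg K
    linarith)
  set d : ℝ := ((psrRank H dummy κ : ℕ) : ℝ) with hd_def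
  set a : ℝ := ((Fintype.card A : ℕ) : ℝ) with ha
  set v : ℝ := ((numActionSeqs H U : ℕ) : ℝ) with hv
  set E := √(d * (v / α * (2 * a * v * (v / α))) ^ 2 + 4 * a ^ 4 * (v / α) ^ 2 * v * B) *
    (d * √(K * (2 * (d * Real.log (1 + K))))) with hE
  have hinit : ∑ k ∈ Finset.range K,
      testNorm (U 1) (stateVec H dummy (f k) [] - stateVec H dummy κ []) ≤ E := by
    refine (sum_initErr_le (dummy := dummy) hH (hB 0 hH)).trans ?_
    rw [hE, ← ha, ← hv, Nat.cast_one]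
    have h2 : 1 * (2 * v) ≤ v / α * (2 * a * v * (v / α)) := by
      have h3 : 1 ≤ v / α * (a * (v / α)) :=
        one_le_mul_of_one_le_of_one_le hs (one_le_mul_of_one_le_of_one_le ha1 hs)
      nlinarith
    have h4 : a ^ 2 * v * B ≤ 4 * a ^ 4 * (v / α) ^ 2 * v * B := by
      have h5 : a ^ 2 ≤ a ^ 4 := pow_le_pow_right₀ ha1 (by norm_num)
      have h6 : 1 ≤ (v / α) ^ 2 := one_le_pow₀ hs
      have h7 : 0 ≤ v * B := by positivity
      have h8 : a ^ 2 ≤ 4 * a ^ 4 * (v / α) ^ 2 := by nlinarith [sq_nonneg a]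
      nlinarith
    have h9 : (1 : ℝ) * (1 * (2 * v)) ^ 2 ≤ d * (v / α * (2 * a * v * (v / α))) ^ 2 := by
      gcongr
    gcongr
  have hstep : ∀ n ∈ Finset.range (H - 1), ∑ k ∈ Finset.range K, (futureSum (π k) n [] fun s =>
      stepErr U n (P k n) (stateVec H dummy κ s)) ≤ E := by
    intro n hn
    rw [Finset.mem_range] at hn
    refine (sum_stepErr_le (P := fun k => P k n) hα (hreg κ hκ) (hcore κ hκ) (by omega)
      (fun k => hP k n (by omega)) hs hB).trans ?_
    have := hrank n (by omega)
    rw [hE]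
    gcongr
  calc ∑ k ∈ Finset.range K, lawDist H (f k) κ (π k)
      ≤ ∑ k ∈ Finset.range K, v / α *
        (testNorm (U 1) (stateVec H dummy (f k) [] - stateVec H dummy κ []) +
          ∑ n ∈ Finset.range (H - 1), futureSum (π k) n [] fun s =>
            stepErr U n (P k n) (stateVec H dummy κ s)) :=
        Finset.sum_le_sum fun k _ => lawDist_le hH (hP k) hU hs h1α (π k)
    _ ≤ v / α * (E + ∑ n ∈ Finset.range (H - 1), E) := by
        rw [← Finset.mul_sum, Finset.sum_add_distrib, Finset.sum_comm]
        gcongr with n hn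
        exact hstep n hn
    _ = v / α * (H * E) := by
        rw [Finset.sum_const, Finset.card_range, nsmul_eq_mul]
        have : ((H - 1 : ℕ) : ℝ) = H - 1 := by
          rw [Nat.cast_sub hH]; simp
        rw [this]; ring

end Regret

/-! ### Bracket numbers, data of a run and constants -/

theorem polProb_le_one [Fintype A] (π : Policy O A) {n : ℕ} (τ : Traj O A n) : polProb π τ ≤ 1 :=
  Finset.prod_le_one (fun _ _ => (π _ _).2.1 _) fun _ _ => simplex_le_one _ _

section Brackets

variable [Fintype O]

theorem seqProb_le_one (κ : Dynamics O A) (τ : History O A) (l : List (O × A)) :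
    seqProb κ τ l ≤ 1 := by
  induction l generalizing τ with
  | nil => exact le_rfl
  | cons x l ih =>
    exact mul_le_one₀ (simplex_le_one (κ τ) x.1) (seqProb_nonneg _ _ _) (ih _)

variable [Fintype A]

/-- Finite brackets exist: round the probabilities of the observations to a grid. -/
theorem exists_hasBracket (H : ℕ) (F : Set (Dynamics O A)) {ε : ℝ} (hε : 0 < ε) :
    ∃ N, HasBracket H F ε N := by
  classical
  obtain ⟨m, hm⟩ := exists_nat_gt ((Fintype.card (Traj O A H) : ℝ) / ε)
  have hm0 : (0 : ℝ) < m := lt_of_le_of_lt (by positivity) hm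
  let e := Fintype.equivFin (Traj O A H → Fin (m + 1))
  refine ⟨_, fun i π τ => (e.symm i τ : ℝ) / m * polProb π τ,
    fun i π τ => ((e.symm i τ : ℝ) + 1) / m * polProb π τ, fun i π => ?_, fun κ _ => ?_⟩
  · have h : ∀ τ ∈ Finset.univ, |(e.symm i τ : ℝ) / m * polProb π τ -
        ((e.symm i τ : ℝ) + 1) / m * polProb π τ| ≤ 1 / m := by
      intro τ _
      have h1 : (e.symm i τ : ℝ) / m * polProb π τ - ((e.symm i τ : ℝ) + 1) / m * polProb π τ =
          -(1 / m * polProb π τ) := by ring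
      rw [h1, abs_neg, abs_of_nonneg (mul_nonneg (by positivity) (polProb_nonneg π τ))]
      exact mul_le_of_le_one_right (by positivity) (polProb_le_one π τ)
    refine (Finset.sum_le_sum h).trans ?_
    rw [Finset.sum_const, nsmul_eq_mul, Finset.card_univ, mul_one_div, div_le_iff₀ hm0, mul_comm]
    exact ((div_lt_iff₀ hε).1 hm).le
  · have hlt : ∀ τ : Traj O A H, ⌊m * seqProb κ [] (List.ofFn τ)⌋₊ < m + 1 := by
      intro τ
      refine Nat.lt_succ_of_le (Nat.floor_le_of_le ?_)
      exact mul_le_of_le_one_right hm0.le (seqProb_le_one _ _ _)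
    refine ⟨e fun τ => ⟨⌊m * seqProb κ [] (List.ofFn τ)⌋₊, hlt τ⟩, fun π τ => ?_⟩
    simp only [Equiv.symm_apply_apply, trajProb_eq]
    have h0 : 0 ≤ m * seqProb κ [] (List.ofFn τ) := mul_nonneg hm0.le (seqProb_nonneg _ _ _)
    constructor
    · refine mul_le_mul_of_nonneg_right ?_ (polProb_nonneg π τ)
      rw [div_le_iff₀ hm0, mul_comm (seqProb _ _ _)]
      exact Nat.floor_le h0
    · refine mul_le_mul_of_nonneg_right ?_ (polProb_nonneg π τ)
      rw [le_div_iff₀ hm0, mul_comm (seqProb _ _ _)]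
      exact (Nat.lt_floor_add_one _).le

theorem hasBracket_bracketNumber (H : ℕ) (F : Set (Dynamics O A)) {ε : ℝ} (hε : 0 < ε) :
    HasBracket H F ε (bracketNumber H F ε) :=
  Nat.sInf_mem (exists_hasBracket H F hε)

theorem one_le_bracketNumber (H : ℕ) {F : Set (Dynamics O A)} {κ : Dynamics O A} (hκ : κ ∈ F)
    {ε : ℝ} (hε : 0 < ε) : 1 ≤ bracketNumber H F ε := by
  obtain ⟨g₁, g₂, -, h⟩ := hasBracket_bracketNumber H F hε
  obtain ⟨i, -⟩ := h κ hκ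
  exact i.pos

end Brackets

section Logs

theorem sum_map_take {X : Type*} (L : List X) (e : ℕ → X) (g : X → ℝ) (k : ℕ)
    (h : ∀ i < k, L[i]? = some (e i)) :
    ((L.take k).map g).sum = ∑ i ∈ Finset.range k, g (e i) := by
  induction k with
  | zero => simp
  | succ k ih =>
    rw [List.take_add_one, h k (Nat.lt_succ_self k), Finset.sum_range_succ,
      ← ih fun i hi => h i (hi.trans (Nat.lt_succ_self k))]
    simp

theorem sum_map_exploreList (H : ℕ) (U : ℕ → Finset (Test O A)) (g : ℕ × List A → ℝ) :
    ((exploreList H U).map g).sum =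
      ∑ h ∈ Finset.range H, ∑ w ∈ actionSeqs U (h + 1), g (h, w) := by
  induction H with
  | zero => simp [exploreList]
  | succ H ih =>
    unfold exploreList at ih ⊢
    rw [List.range_succ, List.flatMap_append, List.map_append, List.sum_append, ih,
      Finset.sum_range_succ]
    simp only [List.flatMap_cons, List.flatMap_nil, List.append_nil, List.map_map]
    congr 1
    exact Finset.sum_map_toList _ _

variable [Fintype O] [Fintype A]

theorem sum_map_data {H : ℕ} (L : Log O A H) (g : Policy O A × Traj O A H → ℝ) :
    (L.data.map g).sum = (L.map fun e => (e.2.map g).sum).sum := by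
  induction L with
  | nil => simp [Log.data]
  | cons e L ih =>
    unfold Log.data at ih ⊢
    simp [ih]

theorem length_data_take [Nonempty A] {H : ℕ} {U : ℕ → Finset (Test O A)}
    {κ : Dynamics O A} (L : Log O A H) (e : ℕ → (Dynamics O A × Policy O A) × Dataset O A H)
    (k : ℕ) (h : ∀ i < k, L[i]? = some (e i) ∧
      (e i).2 ∈ (collect H κ (e i).1.2 (exploreList H U)).support) :
    ((Log.data (L.take k)).length : ℝ) = k * (exploreList H U).length := by
  have h1 := sum_map_data (L.take k : Log O A H) fun _ => (1 : ℝ)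
  rw [sum_map_take L e _ k fun i hi => (h i hi).1] at h1
  simp only [List.map_const', List.sum_replicate, nsmul_eq_mul, mul_one] at h1
  rw [h1]
  have h2 : ∀ i ∈ Finset.range k, (((e i).2.length : ℕ) : ℝ) = (exploreList H U).length := by
    intro i hi
    have := congrArg List.length (collect_support (h i (Finset.mem_range.1 hi)).2).1
    simpa using this
  rw [Finset.sum_congr rfl h2]
  simp

/-- The data of the first `k` iterations contain an episode of each exploration policy of these
iterations. -/
theorem sum_explore_le_sum_data [Nonempty A] {H : ℕ} {U : ℕ → Finset (Test O A)}
    {κ : Dynamics O A} (L : Log O A H) (e : ℕ → (Dynamics O A × Policy O A) × Dataset O A H)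
    (k : ℕ) (h : ∀ i < k, L[i]? = some (e i) ∧
      (e i).2 ∈ (collect H κ (e i).1.2 (exploreList H U)).support)
    {g : Policy O A → ℝ} (hg : ∀ π, 0 ≤ g π) {m : ℕ} (hm : m < H) :
    ∑ i ∈ Finset.range k, ∑ w ∈ actionSeqs U (m + 1), g (explorePolicy (e i).1.2 m w) ≤
      ((Log.data (L.take k)).map fun p => g p.1).sum := by
  rw [sum_map_data, sum_map_take L e _ k fun i hi => (h i hi).1]
  refine Finset.sum_le_sum fun i hi => ?_
  have h1 := (collect_support (h i (Finset.mem_range.1 hi)).2).1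
  have h2 : ((e i).2.map fun p => g p.1) =
      (exploreList H U).map fun p => g (explorePolicy (e i).1.2 p.1 p.2) := by
    have h3 := congrArg (List.map g) h1
    simpa [List.map_map, Function.comp_def] using h3
  rw [h2, sum_map_exploreList]
  exact Finset.single_le_sum
    (f := fun n => ∑ w ∈ actionSeqs U (n + 1), g (explorePolicy (e i).1.2 n w))
    (fun n _ => Finset.sum_nonneg fun _ _ => hg _) (Finset.mem_range.2 hm)

end Logs

section Numerics

/-- The constants of the final bound, where `s = v / α`, and `B` is the bound on the squared
deviations in the data. The exponent `2` of `h` is enlarged to `7 / 2`. -/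
theorem regret_numerics {a v s d h K l B : ℝ} (ha : 1 ≤ a) (hv : 1 ≤ v) (hs : 1 ≤ s) (hd : 1 ≤ d)
    (hh : 1 ≤ h) (hK : 1 ≤ K) (hl : 1 / 2 ≤ l) (hlog : Real.log (1 + K) ≤ 2 * l)
    (hB : B ≤ 272 * v * l) :
    h * (s * (h * (√(d * (s * (2 * a * v * s)) ^ 2 + 4 * a ^ 4 * s ^ 2 * v * B) *
      (d * √(K * (2 * (d * Real.log (1 + K)))))))) ≤
    100 * (d ^ 2 * h ^ (7 / 2 : ℝ) * (v * s ^ 3) * a ^ 2 * K ^ (1 / 2 : ℝ) * l) := by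
  have hl0 : 0 ≤ l := by linarith
  have hX : d * (s * (2 * a * v * s)) ^ 2 + 4 * a ^ 4 * s ^ 2 * v * B ≤
      1096 * l * d * a ^ 4 * v ^ 2 * s ^ 4 := by
    have h1 : d * (s * (2 * a * v * s)) ^ 2 ≤ 8 * l * d * a ^ 4 * v ^ 2 * s ^ 4 := by
      have h2 : a ^ 2 ≤ a ^ 4 := pow_le_pow_right₀ ha (by norm_num)
      calc d * (s * (2 * a * v * s)) ^ 2 = 4 * 1 * d * a ^ 2 * v ^ 2 * s ^ 4 := by ring
        _ ≤ 4 * (2 * l) * d * a ^ 4 * v ^ 2 * s ^ 4 := by gcongr; linarith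
        _ = _ := by ring
    have h3 : 4 * a ^ 4 * s ^ 2 * v * B ≤ 1088 * l * d * a ^ 4 * v ^ 2 * s ^ 4 := by
      have h4 : s ^ 2 ≤ s ^ 4 := pow_le_pow_right₀ hs (by norm_num)
      calc 4 * a ^ 4 * s ^ 2 * v * B ≤ 4 * a ^ 4 * s ^ 4 * v * (272 * v * l) := by
            have h5 : 0 ≤ 272 * v * l := by positivity
            calc _ ≤ 4 * a ^ 4 * s ^ 2 * v * (272 * v * l) := by gcongr
              _ ≤ _ := by gcongr
        _ = 1088 * l * 1 * a ^ 4 * v ^ 2 * s ^ 4 := by ring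
        _ ≤ _ := by gcongr
    linarith
  have hY : K * (2 * (d * Real.log (1 + K))) ≤ 4 * l * d * K := by
    have : K * (2 * (d * Real.log (1 + K))) ≤ K * (2 * (d * (2 * l))) := by gcongr
    linarith
  have hE : √(d * (s * (2 * a * v * s)) ^ 2 + 4 * a ^ 4 * s ^ 2 * v * B) *
      √(K * (2 * (d * Real.log (1 + K)))) ≤ 67 * l * d * a ^ 2 * v * s ^ 2 * √K := by
    calc _ ≤ √(1096 * l * d * a ^ 4 * v ^ 2 * s ^ 4) * √(4 * l * d * K) := by gcongr
      _ = √((1096 * l * d * a ^ 4 * v ^ 2 * s ^ 4) * (4 * l * d * K)) :=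
          (Real.sqrt_mul (by positivity) _).symm
      _ ≤ √((67 * l * d * a ^ 2 * v * s ^ 2) ^ 2 * K) := by
          refine Real.sqrt_le_sqrt ?_
          have h1 : 0 ≤ l ^ 2 * d ^ 2 * a ^ 4 * v ^ 2 * s ^ 4 * K := by positivity
          nlinarith
      _ = _ := by rw [Real.sqrt_mul (sq_nonneg _), Real.sqrt_sq (by positivity)]
  have hh2 : h ^ 2 ≤ h ^ (7 / 2 : ℝ) := by
    rw [← Real.rpow_natCast]
    exact Real.rpow_le_rpow_of_exponent_le hh (by norm_num)
  calc _ = h ^ 2 * s * d * (√(d * (s * (2 * a * v * s)) ^ 2 + 4 * a ^ 4 * s ^ 2 * v * B) *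
        √(K * (2 * (d * Real.log (1 + K))))) := by ring
    _ ≤ h ^ (7 / 2 : ℝ) * s * d * (67 * l * d * a ^ 2 * v * s ^ 2 * √K) := by gcongr
    _ = 67 * (d ^ 2 * h ^ (7 / 2 : ℝ) * (v * s ^ 3) * a ^ 2 * √K * l) := by ring
    _ ≤ 100 * (d ^ 2 * h ^ (7 / 2 : ℝ) * (v * s ^ 3) * a ^ 2 * √K * l) := by
        gcongr
        norm_num
    _ = _ := by rw [Real.sqrt_eq_rpow]

/-- The radius of the confidence sets in terms of the logarithm in the final bound. The factor
`v` absorbs the logarithm of `v` in the first argument. -/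
theorem confidence_numerics {N K h v o a δ : ℝ} (hN : 1 ≤ N) (hK : 2 ≤ K) (hh : 1 ≤ h) (hv : 1 ≤ v)
    (ho : 1 ≤ o) (ha : 1 ≤ a) (hδ : 0 < δ) (hδ1 : δ ≤ 1) :
    Real.log (4 * N * K / δ) ≤ 3 * Real.log (N * K * h * v / δ) ∧
    24 * (Real.log (4 * N * K / δ) + 3 * Real.log (N * K * h * v / δ) / 2) + 14 ≤
      272 * v * Real.log (K * h * N * o * a / δ) ∧
    1 / 2 ≤ Real.log (K * h * N * o * a / δ) ∧
    Real.log (1 + K) ≤ 2 * Real.log (K * h * N * o * a / δ) := by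
  set l := Real.log (K * h * N * o * a / δ) with hl
  set q := Real.log (N * K / δ) with hq
  have hlog2 : 0.6931471803 < Real.log 2 := Real.log_two_gt_d9
  have hK0 : 0 < K := by linarith
  have hNK : K ≤ N * K / δ := by
    rw [le_div_iff₀ hδ]
    nlinarith
  have hKq : Real.log K ≤ q := Real.log_le_log hK0 hNK
  have h2K : Real.log 2 ≤ Real.log K := Real.log_le_log (by norm_num) hK
  have hpos : 0 < N * K / δ := by positivity
  have hlogh : 0 ≤ Real.log h := Real.log_nonneg hh
  have hlogv : 0 ≤ Real.log v := Real.log_nonneg hv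
  have hlogo : 0 ≤ Real.log o := Real.log_nonneg ho
  have hloga : 0 ≤ Real.log a := Real.log_nonneg ha
  have h4 : Real.log (4 * N * K / δ) = 2 * Real.log 2 + q := by
    rw [show 4 * N * K / δ = 2 ^ 2 * (N * K / δ) by ring, Real.log_mul (by norm_num) hpos.ne',
      Real.log_pow]
    push_cast; ring
  have hL : Real.log (N * K * h * v / δ) = q + Real.log h + Real.log v := by
    rw [show N * K * h * v / δ = N * K / δ * h * v by ring,
      Real.log_mul (by positivity) (by positivity), Real.log_mul hpos.ne' (by positivity)]
  have hl' : l = q + Real.log h + Real.log o + Real.log a := by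
    rw [hl, show K * h * N * o * a / δ = N * K / δ * h * o * a by ring,
      Real.log_mul (by positivity) (by positivity), Real.log_mul (by positivity) (by positivity),
      Real.log_mul hpos.ne' (by positivity)]
  have hlv : Real.log v ≤ v - 1 := Real.log_le_sub_one_of_pos (by linarith)
  have hlge : 1 / 2 ≤ l := by linarith
  refine ⟨by rw [h4, hL]; linarith, ?_, hlge, ?_⟩
  · have h5 : q + Real.log h + Real.log v ≤ 2 * v * l := by
      nlinarith [mul_nonneg (sub_nonneg.2 hv) (sub_nonneg.2 hlge)]
    rw [h4, hL]
    linarith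
  · have h6 : Real.log (1 + K) ≤ Real.log (K ^ 2) :=
      Real.log_le_log (by linarith) (by nlinarith)
    rw [Real.log_pow] at h6
    push_cast at h6
    linarith

end Numerics

/-! ### The suboptimality of a run -/

section Run

variable [Fintype O] [Fintype A] [Nonempty A]

theorem optValue_le {r : History O A → ℝ} {H : ℕ} {κ : Dynamics O A} {c : ℝ}
    (h : ∀ π, value r H κ π ≤ c) : optValue r H κ ≤ c :=
  have : Nonempty (Policy O A) := ⟨fun _ _ => stdSimplex.barycenter⟩
  ciSup_le h

/-- On the event of the concentration bound, optimism bounds the suboptimality of each iteration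
by the error of the chosen model, and these errors are summable because the chosen models are
accurate on all earlier exploration policies. -/
theorem totalSubopt_le {r : History O A → ℝ} (hr : ∀ τ, |r τ| ≤ 1) {H : ℕ} (hH : 1 ≤ H)
    {dummy : O} {U : ℕ → Finset (Test O A)} {α : ℝ} (hα : 0 < α) {F : Set (Dynamics O A)}
    (hU : ∀ o : O, (([], o) : Test O A) ∈ U H) {κ : Dynamics O A} (hκ : κ ∈ F)
    (hreg : ∀ f ∈ F, IsRegular H dummy U α f)
    (hcore : ∀ f ∈ F, ∀ h < H, IsCoreTestSet H dummy f h (U (h + 1)))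
    {plan : Log O A H → PMF (Dynamics O A × Policy O A)} {K : ℕ} {β : ℝ}
    (hplan : IsCrane r H U κ F β K plan) {ε T : ℝ} (hε0 : 0 ≤ ε) (hε1 : ε ≤ 1)
    (hn : ε * (K * (exploreList H U).length) ≤ 1) (hT : 1 ≤ T) (hβ : Real.log T ≤ β)
    {L : Log O A H} (hL : L ∈ (runLaw H U κ plan K).support)
    (hgood : ∀ j < K, ∀ f ∈ F, ∃ g, IsUpperBracket ε f g ∧
      dataProd (fun π τ => ENNReal.ofReal (likRatio κ g π τ)) (Log.data (L.take j)) <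
        ENNReal.ofReal T ∧
      dataProd (fun π τ => ENNReal.ofReal (tiltedRatio κ g π τ)) (Log.data (L.take j)) <
        ENNReal.ofReal T) :
    totalSubopt r κ L ≤ H * (numActionSeqs H U / α * (H *
        (√(psrRank H dummy κ * (numActionSeqs H U / α *
          (2 * Fintype.card A * numActionSeqs H U * (numActionSeqs H U / α))) ^ 2 +
        4 * Fintype.card A ^ 4 * (numActionSeqs H U / α) ^ 2 * numActionSeqs H U *
          (24 * (Real.log T + β / 2) + 14)) *
        (psrRank H dummy κ * √(K * (2 * (psrRank H dummy κ * Real.log (1 + K)))))))) := by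
  classical
  have hex : ∀ j, ∃ e : (Dynamics O A × Policy O A) × Dataset O A H, j < K →
      L[j]? = some e ∧ IsOptimisticPair r H (confSet F β (Log.data (L.take j))) e.1 ∧
      e.2 ∈ (collect H κ e.1.2 (exploreList H U)).support := by
    intro j
    by_cases hj : j < K
    · obtain ⟨e, h1, h2, h3, h4⟩ := runLaw_support_getElem hL hj
      exact ⟨e, fun _ => ⟨h1, hplan j hj _ h2 _ h3, h4⟩⟩
    · exact ⟨((κ, fun _ _ => stdSimplex.barycenter), []), fun h => absurd h hj⟩
  choose e he using hex
  have hcol : ∀ k ≤ K, ∀ i < k, L[i]? = some (e i) ∧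
      (e i).2 ∈ (collect H κ (e i).1.2 (exploreList H U)).support := fun k hk i hi =>
    ⟨(he i (hi.trans_le hk)).1, (he i (hi.trans_le hk)).2.2⟩
  have hpos : ∀ k < K, ∀ p ∈ Log.data (L.take k), 0 < trajProb κ p.1 p.2 := by
    intro k hk p hp
    obtain ⟨x, hx, hpx⟩ := List.mem_flatMap.1 hp
    obtain ⟨i, hi, rfl⟩ := List.mem_take_iff_getElem.1 hx
    have hiK : i < K := by omega
    have h1 := (he i hiK).1
    rw [List.getElem?_eq_getElem (by omega), Option.some_inj] at h1
    rw [h1] at hpx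
    exact (collect_support (he i hiK).2.2).2 p hpx
  have htrue : ∀ k < K, κ ∈ confSet F β (Log.data (L.take k)) := by
    intro k hk
    refine mem_confSet hκ (hpos k hk) (ε := ε) (by linarith) hβ fun f hf => ?_
    obtain ⟨g, h1, h2, -⟩ := hgood k hk f hf
    exact ⟨g, h1, h2⟩
  have hlogT : 0 ≤ Real.log T := Real.log_nonneg hT
  have hdata : ∀ k < K, ((Log.data (L.take k)).map
      fun p => lawDist H (e k).1.1 κ p.1 ^ 2).sum ≤ 24 * (Real.log T + β / 2) + 14 := by
    intro k hk
    have hmem := (he k hk).2.1.1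
    obtain ⟨g, h1, -, h2⟩ := hgood k hk _ hmem.1
    refine (sum_sq_lawDist_le hκ (hpos k hk) (by linarith) hε0 hε1 hmem h1 h2).trans ?_
    have h3 : ε * (Log.data (L.take k)).length ≤ 1 := by
      rw [length_data_take L e k (hcol k hk.le)]
      refine le_trans ?_ hn
      gcongr
    linarith
  have hB : ∀ m < H, ∀ k < K, ∑ i ∈ Finset.range k, ∑ w ∈ actionSeqs U (m + 1),
      lawDist H (if k < K then (e k).1.1 else κ) κ (explorePolicy (e i).1.2 m w) ^ 2 ≤
        24 * (Real.log T + β / 2) + 14 := by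
    intro m hm k hk
    rw [if_pos hk]
    exact (sum_explore_le_sum_data L e k (hcol k hk.le)
      (g := fun π => lawDist H (e k).1.1 κ π ^ 2) (fun _ => sq_nonneg _) hm).trans (hdata k hk)
  have hsum := sum_lawDist_le hH hα hU hκ hreg hcore
    (f := fun k => if k < K then (e k).1.1 else κ)
    (fun k => by
      split_ifs with hk
      · exact (he k hk).2.1.1.1
      · exact hκ)
    (π := fun k => (e k).1.2) (by linarith) hB
  refine le_trans ?_ (mul_le_mul_of_nonneg_left hsum (Nat.cast_nonneg H))
  have htotal : totalSubopt r κ L =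
      ∑ k ∈ Finset.range K, (optValue r H κ - value r H κ (e k).1.2) := by
    have h1 : L.take K = L := List.take_of_length_le (length_of_mem_runLaw_support hL).le
    rw [totalSubopt, ← sum_map_take L e (fun e => optValue r H κ - value r H κ e.1.2) K
      fun i hi => (he i hi).1, h1]
  rw [htotal, Finset.mul_sum]
  refine Finset.sum_le_sum fun k hk => ?_
  rw [Finset.mem_range] at hk
  rw [if_pos hk]
  have h1 : optValue r H κ ≤ value r H (e k).1.1 (e k).1.2 :=
    optValue_le fun π => (he k hk).2.1.2 κ (htrue k hk) π
  have h2 := value_sub_value_le hr H (e k).1.1 κ (e k).1.2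
  linarith

/-- The trivial bound on the suboptimality of a single iteration. It is zero if there is only one
action. -/
theorem totalSubopt_le_of_length_eq_one {r : History O A → ℝ} (hr : ∀ τ, |r τ| ≤ 1) {H : ℕ}
    (κ : Dynamics O A) {L : Log O A H} (hL : L.length = 1) :
    totalSubopt r κ L ≤ if Fintype.card A = 1 then 0 else (2 * H : ℝ) := by
  obtain ⟨e, rfl⟩ := List.length_eq_one_iff.1 hL
  simp only [totalSubopt, List.map_cons, List.map_nil, List.sum_cons, List.sum_nil, add_zero]
  split_ifs with hA
  · have : Subsingleton A := (Fintype.card_le_one_iff_subsingleton).1 hA.le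
    have hopt : optValue r H κ ≤ value r H κ e.1.2 :=
      optValue_le fun π => (congrArg (value r H κ) (Subsingleton.elim π e.1.2)).le
    linarith
  · have hopt : optValue r H κ ≤ H := optValue_le fun π => (abs_le.1 (abs_value_le hr H κ π)).2
    have := (abs_le.1 (abs_value_le hr H κ e.1.2)).1
    linarith

theorem pow_mul_zpow_eq (v α : ℝ) : v ^ 4 * α ^ (-3 : ℤ) = v * (v / α) ^ 3 := by
  rw [zpow_neg, div_pow]
  norm_cast
  rw [div_eq_mul_inv]
  ring

end Run

end

end PSR

theorem theorem1 :
    ∃ c C : ℝ, 0 < c ∧ 0 < C ∧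
      ∀ (O A : Type*) [Fintype O] [Fintype A] [Nonempty A] (dummy : O) (H : ℕ) (_ : 1 ≤ H)
        (r : PSR.History O A → ℝ) (_ : ∀ τ, |r τ| ≤ 1)
        -- the true system, the core test sets, the model class
        (env : PSR.Dynamics O A) (U : ℕ → Finset (PSR.Test O A)) (F : Set (PSR.Dynamics O A))
        (α : ℝ) (_ : 0 < α)
        -- the true system is regular
        (_ : PSR.IsRegular H dummy U α env)
        -- every one-step observation is a core test at step `H`
        (_ : ∀ o : O, (([], o) : PSR.Test O A) ∈ U H)
        -- realizability, regularity and validity of the model class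
        (_ : env ∈ F)
        (_ : ∀ f ∈ F, PSR.IsRegular H dummy U α f)
        (_ : ∀ f ∈ F, ∀ h < H, PSR.IsCoreTestSet H dummy f h (U (h + 1)))
        (δ : ℝ) (_ : 0 < δ) (_ : δ ≤ 1) (K : ℕ) (_ : 1 ≤ K)
        (εb β : ℝ) (_ : εb = 1 / (K * H * PSR.numActionSeqs H U : ℝ))
        (_ : β = c * Real.log
          ((PSR.bracketNumber H F εb : ℝ) * K * H * PSR.numActionSeqs H U / δ))
        (plan : PSR.Log O A H → PMF (PSR.Dynamics O A × PSR.Policy O A))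
        (_ : PSR.IsCrane r H U env F β K plan),
        ENNReal.ofReal (1 - δ) ≤ (PSR.runLaw H U env plan K).toOuterMeasure
          {L | PSR.totalSubopt r env L ≤
            C * ((PSR.psrRank H dummy env : ℝ) ^ 2 * (H : ℝ) ^ (7 / 2 : ℝ) *
              (PSR.numActionSeqs H U : ℝ) ^ 4 * (Fintype.card A : ℝ) ^ 2 *
              (K : ℝ) ^ (1 / 2 : ℝ) * α ^ (-3 : ℤ) *
              Real.log (K * H * PSR.bracketNumber H F εb * Fintype.card O * Fintype.card A / δ))} := by
  -- For `K ≥ 2` the slack `3 * log (N * K * H * v / δ)` dominates `log (4 * N * K / δ)`, the level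
  -- of the union bound.
  refine ⟨3, 100, by norm_num, by norm_num, ?_⟩
  intro O A _ _ _ dummy H hH r hr env U F α hα hregE hU hκ hreg hcore δ hδ hδ1 K hK εb β hεb hβ
    plan hplan
  have : Nonempty O := ⟨dummy⟩
  have hv : (1 : ℝ) ≤ PSR.numActionSeqs H U := by exact_mod_cast PSR.one_le_numActionSeqs hH hU
  have hh : (1 : ℝ) ≤ H := by exact_mod_cast hH
  have hK1 : (1 : ℝ) ≤ K := by exact_mod_cast hK
  have ha : (1 : ℝ) ≤ Fintype.card A := by exact_mod_cast Fintype.card_pos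
  have ho : (1 : ℝ) ≤ Fintype.card O := by exact_mod_cast Fintype.card_pos
  have hd : (1 : ℝ) ≤ PSR.psrRank H dummy env := by
    exact_mod_cast PSR.one_le_psrRank hregE (hcore env hκ) hH
  have hprod : (1 : ℝ) ≤ K * H * PSR.numActionSeqs H U :=
    one_le_mul_of_one_le_of_one_le (one_le_mul_of_one_le_of_one_le hK1 hh) hv
  have hε : 0 < εb := by rw [hεb]; positivity
  have hε1 : εb ≤ 1 := by rw [hεb]; exact div_le_one_of_le₀ hprod (by positivity)
  have hn : εb * (K * (PSR.exploreList H U).length) ≤ 1 := by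
    have h1 : ((PSR.exploreList H U).length : ℝ) ≤ H * PSR.numActionSeqs H U := by
      exact_mod_cast PSR.length_exploreList_le H U
    rw [hεb, one_div_mul_eq_div]
    refine div_le_one_of_le₀ ?_ (by positivity)
    rw [mul_assoc]
    gcongr
  have hN := PSR.one_le_bracketNumber H hκ hε
  have hN1 : (1 : ℝ) ≤ PSR.bracketNumber H F εb := by exact_mod_cast hN
  have hs : 1 ≤ (PSR.numActionSeqs H U : ℝ) / α := by
    obtain ⟨P, hP⟩ := PSR.exists_isPredictor hregE (hcore env hκ)
    exact PSR.IsPredictor.one_le (hP 0 hH) hα hH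
  set d : ℝ := ((PSR.psrRank H dummy env : ℕ) : ℝ)
  set v : ℝ := ((PSR.numActionSeqs H U : ℕ) : ℝ)
  set N : ℝ := ((PSR.bracketNumber H F εb : ℕ) : ℝ)
  set a : ℝ := ((Fintype.card A : ℕ) : ℝ) with ha_def
  set o : ℝ := ((Fintype.card O : ℕ) : ℝ)
  set l : ℝ := Real.log (K * H * N * o * a / δ)
  have hR : d ^ 2 * (H : ℝ) ^ (7 / 2 : ℝ) * v ^ 4 * a ^ 2 * (K : ℝ) ^ (1 / 2 : ℝ) *
      α ^ (-3 : ℤ) * l =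
      d ^ 2 * (H : ℝ) ^ (7 / 2 : ℝ) * (v * (v / α) ^ 3) * a ^ 2 * (K : ℝ) ^ (1 / 2 : ℝ) * l := by
    rw [← PSR.pow_mul_zpow_eq]; ring
  rw [hR]
  rcases hK.eq_or_lt with hK' | hK2
  -- For `K = 1` the logarithm can vanish, but then there is only one policy.
  · refine PSR.ofReal_one_sub_le_toOuterMeasure (g := fun _ => 0) (t := 1) hδ.le one_ne_zero
      ENNReal.one_ne_top ?_ fun L hL _ => ?_
    · rw [PSR.pmfExp_const]
      exact zero_le
    have hlen : L.length = 1 := by rw [PSR.length_of_mem_runLaw_support hL, ← hK']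
    refine (PSR.totalSubopt_le_of_length_eq_one hr env hlen).trans ?_
    have hpre : (1 : ℝ) ≤ K * H * N * o :=
      one_le_mul_of_one_le_of_one_le (one_le_mul_of_one_le_of_one_le
        (one_le_mul_of_one_le_of_one_le hK1 hh) hN1) ho
    have hal : Real.log a ≤ l := by
      refine Real.log_le_log (by linarith) ?_
      rw [le_div_iff₀ hδ]
      have h1 : a * δ ≤ a * 1 := by gcongr
      have h2 : 1 * a ≤ K * H * N * o * a := by gcongr
      linarith
    have hl0 : 0 ≤ l := (Real.log_nonneg ha).trans hal
    split_ifs with hA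
    · positivity
    · have hA2 : (2 : ℝ) ≤ a := by
        have : 2 ≤ Fintype.card A := by
          have := Fintype.card_pos (α := A)
          omega
        rw [ha_def]
        exact_mod_cast this
      have hl2 : 1 / 2 ≤ l := by
        have h1 := Real.log_le_log (by norm_num) hA2
        have h2 := Real.log_two_gt_d9
        linarith
      have hh2 : (H : ℝ) ≤ (H : ℝ) ^ (7 / 2 : ℝ) := Real.self_le_rpow_of_one_le hh (by norm_num)
      have hvs : 1 ≤ v * (v / α) ^ 3 := one_le_mul_of_one_le_of_one_le hv (one_le_pow₀ hs)
      have hKp : 1 ≤ (K : ℝ) ^ (1 / 2 : ℝ) := Real.one_le_rpow hK1 (by norm_num)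
      have h1 : 1 ^ 2 * (H : ℝ) * 1 * 1 ^ 2 * 1 * (1 / 2) ≤ d ^ 2 * (H : ℝ) ^ (7 / 2 : ℝ) *
          (v * (v / α) ^ 3) * a ^ 2 * (K : ℝ) ^ (1 / 2 : ℝ) * l := by gcongr
      linarith
  · have hK2' : (2 : ℝ) ≤ K := by exact_mod_cast hK2
    obtain ⟨h1, h2, h3, h4⟩ := PSR.confidence_numerics hN1 hK2' hh hv ho ha hδ hδ1
    refine PSR.concentration hε.le (PSR.hasBracket_bracketNumber H F hε) hN hK hn hδ
      fun L hL hgood => ?_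
    have hT : 1 ≤ 4 * N * K / δ := by
      rw [le_div_iff₀ hδ]
      nlinarith
    have h5 := PSR.totalSubopt_le hr hH hα hU hκ hreg hcore hplan hε.le hε1 hn hT
      (h1.trans_eq hβ.symm) hL hgood
    refine h5.trans (PSR.regret_numerics ha hv hs hd hh hK1 h3 h4 ?_)
    rw [hβ]
    exact h2
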